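/- **Theorem (complexity of ASPR).** Let $Q\in\mathbb R^{n\times n}$ be a symmetric matrix with non-positive off-diagonal entries and $\alpha I\preccurlyeq Q\preccurlyeq L I$ with $\alpha>0$; let $b\in\mathbb R^n$, $g(x)=\tfrac12\langle x,Qx\rangle-\langle b,x\rangle$, $x^*=\arg\min_{x\ge 0}g(x)$, $S^*=\operatorname{supp}(x^*)$, $\operatorname{vol}(S)=\operatorname{nnz}(Q_{:,S})$, $\widetilde{\operatorname{vol}}(S)=\operatorname{nnz}(Q_{S,S})$, and $\varepsilon>0$. *Algorithm.* APGD$(C,x_0,f,N)$ with $\kappa=L/\alpha$ sets $z_0=y_0=x_0$, $A_0=0$, $a_0=1$, and for $t=0,\dots,N-1$: $A_{t+1}=A_t+a_t$; $x_{t+1}=\frac{A_t}{A_{t+1}}y_t+\frac{a_t}{A_{t+1}}z_t$; $z_{t+1}$ is the Euclidean projection onto $C$ of $\frac{\kappa-1+A_t}{\kappa-1+A_{t+1}}z_t+\frac{a_t}{\kappa-1+A_{t+1}}\left(x_{t+1}-\frac1\alpha\nabla f(x_{t+1})\right)$; $y_{t+1}=\frac{A_t}{A_{t+1}}y_t+\frac{a_t}{A_{t+1}}z_{t+1}$;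 $a_{t+1}=A_{t+1}\left(\frac{2\kappa}{2\kappa+1-\sqrt{1+4\kappa}}-1\right)$; it returns $y_N$. ASPR starts with $x^{(0)}=0$, $S^{(-1)}=\emptyset$, $S^{(0)}=\{i:\nabla_i g(0)<0\}$. While $S^{(t)}\ne S^{(t-1)}$ it sets $\delta_t=\sqrt{\varepsilon\alpha/((1+|S^{(t)}|)L^2)}$, $\hat\varepsilon_t=\delta_t^2\alpha/2$, $C^{(t)}=\operatorname{span}\{e_i:i\in S^{(t)}\}\cap\mathbb R^n_{\ge0}$, $\bar x^{(t+1)}=\mathrm{APGD}(C^{(t)},x^{(t)},g,N_t)$ with $N_t=\max\left\{1,\,1+\left\lceil 2\sqrt{\kappa}\log\frac{(L-\alpha)\|\nabla_{S^{(t)}}g(x^{(t)})\|_2^2}{2\hat\varepsilon_t\alpha^2}\right\rceil\right\}$ (where $N_t=1$ if the logarithm is that of $0$), $x^{(t+1)}=\max\{0,\bar x^{(t+1)}-\delta_t\mathbb 1\}$ coordinatewise, $S^{(t+1)}=S^{(t)}\cup\{i:\nabla_i g(x^{(t+1)})<0\}$. It returns $x^{(T)}$ for the first $T$ with $S^{(T)}=S^{(T-1)}$.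 *Cost model.* Real-number machine: each arithmetic operation (including $\sqrt{\cdot}$, $\log$, $\lceil\cdot\rceil$, $\max$), comparison, memory access and reading of an input entry costs one step. The input $(Q,b)$ is read-only and sparsely accessible: the indices with $b_i>0$, the nonzero entries of a row of $Q$ with column in a stored index set $S$, and the rows of $Q$ with a nonzero entry in a column of $S$ can be enumerated at a constant number of steps per listed element (plus a constant per enumeration). Space is the peak number of working-memory cells (registers, entries of stored sparse vectors and index sets). ASPR is executed by the natural program that keeps sparse vectors supported in $S^{(t)}$, computes $\nabla_{S^{(t)}}g$ from the nonzeros of $Q_{S^{(t)},S^{(t)}}$ in each APGD iteration, and forms $S^{(t+1)}$ by computing partial derivatives one after the other without storing them. There is a universal constant $c>0$ such that the following holds. 1. For all such $n,Q,b,\alpha,L,\varepsilon$, the program halts and returns the output $x^{(T)}$ of ASPR in time at most $$c\left(|S^*|\,\widetilde{\operatorname{vol}}(S^*)\sqrt{\tfrac L\alpha}\;\log\!\left(2+\tfrac{L^4(1+|S^*|)(L-\alpha)\|x^*\|_2^2}{\alpha^4\varepsilon}\right)+|S^*|\operatorname{vol}(S^*)+1\right),$$ that is, $\widetilde{\mathcal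 O}\left(|S^*|\,\widetilde{\operatorname{vol}}(S^*)\sqrt{L/\alpha}+|S^*|\operatorname{vol}(S^*)\right)$ if $S^*\neq\emptyset$, using at most $c(|S^*|+1)$ memory cells. 2. ($\ell_1$-regularized PageRank.) Let $G$ be a connected graph on $n\ge2$ vertices with adjacency matrix $A$ and degree matrix $D=\operatorname{diag}(d_1,\dots,d_n)$, $\alpha\in(0,1)$, $\rho>0$, $\varepsilon>0$, $s$ in the probability simplex, $Q=D^{-1/2}\left(D-\frac{1-\alpha}2(D+A)\right)D^{-1/2}$, $x^*$ the minimizer over $\mathbb R^n$ of $\frac12\langle x,Qx\rangle-\alpha\langle s,D^{-1/2}x\rangle+\alpha\rho\|D^{1/2}x\|_1$, $S^*=\operatorname{supp}(x^*)$, $\operatorname{vol}(S)=\sum_{i\in S}d_i+|S|$, $\widetilde{\operatorname{vol}}(S)=|S|+|\{(i,j)\in S\times S: i\sim j\}|$. Then $Q\preccurlyeq I$, and for every $L$ with $Q\preccurlyeq LI$ (in particular $L=1$) the program, applied to $Q$ and $b=\alpha D^{-1/2}s-\alpha\rho D^{1/2}\mathbb 1$, halts and returns the output $x^{(T)}$ of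 ASPR in time at most $$c\left(|S^*|\,\widetilde{\operatorname{vol}}(S^*)\sqrt{\tfrac L\alpha}\;\log\!\left(2+\tfrac{2L^4(1+|S^*|)(L-\alpha)|S^*|\operatorname{vol}(S^*)}{\alpha^6\varepsilon}\right)+|S^*|\operatorname{vol}(S^*)+1\right)$$ using at most $c(|S^*|+1)$ memory cells. -/

import Mathlib

open scoped Gradient

/-! ## The optimization problem -/

/-- `ℝⁿ` with its Euclidean norm. -/
abbrev EVec (n : ℕ) : Type := EuclideanSpace ℝ (Fin n)

/-- The quadratic form `⟨x, Q x⟩`. -/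
def quadForm {n : ℕ} (Q : Matrix (Fin n) (Fin n) ℝ) (x : EVec n) : ℝ :=
  dotProduct x.ofLp (Q.mulVec x.ofLp)

/-- The quadratic objective `g(x) = ½⟨x, Q x⟩ - ⟨b, x⟩`, whose Hessian is `Q`. -/
noncomputable def quadObj {n : ℕ} (Q : Matrix (Fin n) (Fin n) ℝ) (b : Fin n → ℝ)
    (x : EVec n) : ℝ :=
  (1 / 2) * quadForm Q x - dotProduct b x.ofLp

/-- The nonnegative orthant. -/
def nonnegOrthant (n : ℕ) : Set (EVec n) := {x | ∀ i, 0 ≤ x i}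

/-- `span {e_i | i ∈ S} ∩ ℝⁿ_{≥ 0}`. -/
def orthantOn {n : ℕ} (S : Finset (Fin n)) : Set (EVec n) :=
  {x | (∀ i, 0 ≤ x i) ∧ ∀ i, i ∉ S → x i = 0}

/-- The support of a vector. -/
noncomputable def vecSupp {n : ℕ} (x : EVec n) : Finset (Fin n) :=
  Finset.univ.filter fun i => x i ≠ 0

/-- `vol(S) = nnz(Q_{:,S})`. -/
noncomputable def matVol {n : ℕ} (Q : Matrix (Fin n) (Fin n) ℝ) (S : Finset (Fin n)) : ℕ :=
  ((Finset.univ ×ˢ S).filter fun p : Fin n × Fin n => Q p.1 p.2 ≠ 0).card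

/-- The internal volume `nnz(Q_{S,S})`. -/
noncomputable def matIntVol {n : ℕ} (Q : Matrix (Fin n) (Fin n) ℝ) (S : Finset (Fin n)) : ℕ :=
  ((S ×ˢ S).filter fun p : Fin n × Fin n => Q p.1 p.2 ≠ 0).card

/-! ## The algorithm ASPR, mathematically -/

/-- `p` is the Euclidean projection of `u` onto `C`. -/
def IsProj {n : ℕ} (C : Set (EVec n)) (u p : EVec n) : Prop :=
  p ∈ C ∧ ∀ y ∈ C, ‖u - p‖ ≤ ‖u - y‖

/-- `out` is the output of accelerated projected gradient descent on the set `C` with initial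
point `x₀`, objective `f`, and `N` iterations. -/
def IsAPGDOutput {n : ℕ} (C : Set (EVec n)) (x₀ : EVec n) (f : EVec n → ℝ) (α L : ℝ)
    (N : ℕ) (out : EVec n) : Prop :=
  ∃ (x y z : ℕ → EVec n) (A a : ℕ → ℝ),
    z 0 = x₀ ∧ y 0 = x₀ ∧ A 0 = 0 ∧ a 0 = 1 ∧
    (∀ t < N,
      A (t + 1) = A t + a t ∧
      x (t + 1) = (A t / A (t + 1)) • y t + (a t / A (t + 1)) • z t ∧
      IsProj C
        (((L / α - 1 + A t) / (L / α - 1 + A (t + 1))) • z t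
          + (a t / (L / α - 1 + A (t + 1))) • (x (t + 1) - (1 / α) • ∇ f (x (t + 1))))
        (z (t + 1)) ∧
      y (t + 1) = (A t / A (t + 1)) • y t + (a t / A (t + 1)) • z (t + 1) ∧
      a (t + 1) = A (t + 1)
        * (2 * (L / α) / (2 * (L / α) + 1 - Real.sqrt (1 + 4 * (L / α))) - 1)) ∧
    out = y N

/-- The retraction parameter `δ_t`, as a function of `|S^{(t)}|`. -/
noncomputable def asprDelta (α L ε : ℝ) (k : ℕ) : ℝ :=
  Real.sqrt (ε * α / ((1 + k) * L ^ 2))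

/-- The accuracy of the subproblem, as a function of `|S^{(t)}|`. -/
noncomputable def asprAccuracy (α L ε : ℝ) (k : ℕ) : ℝ :=
  asprDelta α L ε k ^ 2 * α / 2

/-- The number of iterations of the subroutine at the point `x` with known good set `S`. It is at
least one. -/
noncomputable def asprIters {n : ℕ} (g : EVec n → ℝ) (α L ε : ℝ) (S : Finset (Fin n))
    (x : EVec n) : ℕ :=
  (max 1 (1 + ⌈2 * Real.sqrt (L / α) *
    Real.log ((L - α) * (∑ i ∈ S, (∇ g x i) ^ 2)
      / (2 * asprAccuracy α L ε S.card * α ^ 2))⌉)).toNat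

/-- The coordinates with negative partial derivative. -/
noncomputable def negCoords {n : ℕ} (g : EVec n → ℝ) (x : EVec n) : Finset (Fin n) :=
  Finset.univ.filter fun i => ∇ g x i < 0

/-- The set `S^{(t-1)}`, where `S^{(-1)} = ∅`. -/
def prevSet {n : ℕ} (S : ℕ → Finset (Fin n)) : ℕ → Finset (Fin n)
  | 0 => ∅
  | t + 1 => S t

/-- `x⁽⁰⁾, …, x⁽ᵀ⁾` and `S⁽⁰⁾, …, S⁽ᵀ⁾` are the iterates and the sets of known good coordinates
of a complete run of ASPR; the output of the run is `x T`. -/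
structure IsASPRRun {n : ℕ} (g : EVec n → ℝ) (α L ε : ℝ) (T : ℕ) (x : ℕ → EVec n)
    (S : ℕ → Finset (Fin n)) : Prop where
  x_zero : x 0 = 0
  S_zero : S 0 = negCoords g (x 0)
  continues : ∀ t < T, S t ≠ prevSet S t
  x_step : ∀ t < T, ∃ xbar : EVec n,
    IsAPGDOutput (orthantOn (S t)) (x t) g α L (asprIters g α L ε (S t) (x t)) xbar ∧
    ∀ i, x (t + 1) i = max 0 (xbar i - asprDelta α L ε (S t).card)
  S_step : ∀ t < T, S (t + 1) = S t ∪ negCoords g (x (t + 1))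
  stops : S T = prevSet S T

/-! ## A real-number machine with sparse access to its input

The input `(Q, b)` is read-only. Reading an entry, an arithmetic operation, a comparison, and a
memory access each cost one step. Sparsity of the input can be exploited through enumerations,
which cost one step per element that is produced. -/

/-- Real registers. -/
inductive Reg
  | alpha | lip | eps | kappa | delta | acc | nrm | grad | count | A | Anew | a
  deriving DecidableEq

instance : Fintype Reg :=
  ⟨{.alpha, .lip, .eps, .kappa, .delta, .acc, .nrm, .grad, .count, .A, .Anew, .a},
    fun r => by cases r <;> decide⟩

/-- Names of sparse vectors in memory. -/
inductive VecName
  | x | y | z | p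
  deriving DecidableEq

instance : Fintype VecName := ⟨{.x, .y, .z, .p}, fun v => by cases v <;> decide⟩

/-- Names of index sets in memory. -/
inductive SetName
  | known | fresh
  deriving DecidableEq

instance : Fintype SetName := ⟨{.known, .fresh}, fun s => by cases s <;> decide⟩

/-- The contents of the working memory. The finset `dom v` holds the positions of the vector `v`
that have been allocated; other entries read as zero. -/
structure Mem (n : ℕ) where
  reg : Reg → ℝ
  vec : VecName → Fin n → ℝ
  dom : VecName → Finset (Fin n)
  set : SetName → Finset (Fin n)

/-- The number of memory cells in use. -/
def Mem.space {n : ℕ} (σ : Mem n) : ℕ :=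
  Fintype.card Reg + ∑ v, (σ.dom v).card + ∑ s, (σ.set s).card

def Mem.setReg {n : ℕ} (σ : Mem n) (r : Reg) (c : ℝ) : Mem n :=
  { σ with reg := Function.update σ.reg r c }

def Mem.setVec {n : ℕ} (σ : Mem n) (v : VecName) (i : Fin n) (c : ℝ) : Mem n :=
  { σ with
    vec := Function.update σ.vec v (Function.update (σ.vec v) i c)
    dom := Function.update σ.dom v (insert i (σ.dom v)) }

def Mem.setSet {n : ℕ} (σ : Mem n) (s : SetName) (U : Finset (Fin n)) : Mem n :=
  { σ with set := Function.update σ.set s U }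

/-- Real-valued expressions. -/
inductive Expr (n : ℕ)
  | nat (k : ℕ)
  | reg (r : Reg)
  | vec (v : VecName) (i : Fin n)
  | coef (i j : Fin n)
  | rhs (i : Fin n)
  | card (s : SetName)
  | add (e₁ e₂ : Expr n)
  | sub (e₁ e₂ : Expr n)
  | mul (e₁ e₂ : Expr n)
  | div (e₁ e₂ : Expr n)
  | max (e₁ e₂ : Expr n)
  | sqrt (e : Expr n)
  | log (e : Expr n)
  | ceil (e : Expr n)

namespace Expr

instance (n : ℕ) : Add (Expr n) := ⟨Expr.add⟩
instance (n : ℕ) : Sub (Expr n) := ⟨Expr.sub⟩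
instance (n : ℕ) : Mul (Expr n) := ⟨Expr.mul⟩
instance (n : ℕ) : Div (Expr n) := ⟨Expr.div⟩
instance (n : ℕ) : Coe Reg (Expr n) := ⟨Expr.reg⟩

/-- The value of an expression. -/
noncomputable def eval {n : ℕ} (Q : Matrix (Fin n) (Fin n) ℝ) (b : Fin n → ℝ) (σ : Mem n) :
    Expr n → ℝ
  | nat k => k
  | reg r => σ.reg r
  | vec v i => σ.vec v i
  | coef i j => Q i j
  | rhs i => b i
  | card s => (σ.set s).card
  | add e₁ e₂ => eval Q b σ e₁ + eval Q b σ e₂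
  | sub e₁ e₂ => eval Q b σ e₁ - eval Q b σ e₂
  | mul e₁ e₂ => eval Q b σ e₁ * eval Q b σ e₂
  | div e₁ e₂ => eval Q b σ e₁ / eval Q b σ e₂
  | max e₁ e₂ => Max.max (eval Q b σ e₁) (eval Q b σ e₂)
  | sqrt e => Real.sqrt (eval Q b σ e)
  | log e => Real.log (eval Q b σ e)
  | ceil e => (⌈eval Q b σ e⌉ : ℝ)

/-- The number of steps needed to evaluate an expression: one for each node. -/
def steps {n : ℕ} : Expr n → ℕ
  | nat _ => 1
  | reg _ => 1
  | vec _ _ => 1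
  | coef _ _ => 1
  | rhs _ => 1
  | card _ => 1
  | add e₁ e₂ => steps e₁ + steps e₂ + 1
  | sub e₁ e₂ => steps e₁ + steps e₂ + 1
  | mul e₁ e₂ => steps e₁ + steps e₂ + 1
  | div e₁ e₂ => steps e₁ + steps e₂ + 1
  | max e₁ e₂ => steps e₁ + steps e₂ + 1
  | sqrt e => steps e + 1
  | log e => steps e + 1
  | ceil e => steps e + 1

end Expr

/-- The enumerations: a stored set; the indices `i` with `b i > 0`; the nonzero entries of row `i`
of `Q` with column in a stored set; the rows of `Q` with a nonzero entry in a column of a stored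
set. -/
inductive Iter (n : ℕ)
  | elems (s : SetName)
  | posRhs
  | rowIn (i : Fin n) (s : SetName)
  | nbrs (s : SetName)

/-- The elements enumerated. -/
noncomputable def Iter.toFinset {n : ℕ} (Q : Matrix (Fin n) (Fin n) ℝ) (b : Fin n → ℝ)
    (σ : Mem n) : Iter n → Finset (Fin n)
  | elems s => σ.set s
  | posRhs => Finset.univ.filter fun i => 0 < b i
  | rowIn i s => (σ.set s).filter fun j => Q i j ≠ 0
  | nbrs s => by
      classical
      exact Finset.univ.filter fun i => ∃ j ∈ σ.set s, Q i j ≠ 0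

/-- Commands. The command `forList` is the state of a `forEach` loop whose enumeration has been
fixed. -/
inductive Cmd (n : ℕ)
  | assign (r : Reg) (e : Expr n)
  | store (v : VecName) (i : Fin n) (e : Expr n)
  | insert (s : SetName) (i : Fin n)
  | clear (s : SetName)
  | seq (c₁ c₂ : Cmd n)
  | ifNeg (e : Expr n) (c : Cmd n)
  | ifNotMem (i : Fin n) (s : SetName) (c : Cmd n)
  | whilePos (e : Expr n) (c : Cmd n)
  | forEach (it : Iter n) (c : Fin n → Cmd n)
  | forList (l : List (Fin n)) (c : Fin n → Cmd n)

infixr:30 " ;; " => Cmd.seq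
infix:35 " ≔ " => Cmd.assign

/-- `Exec Q b c σ σ' t m`: on input `(Q, b)`, the command `c` started with memory `σ` halts with
memory `σ'` after `t` steps, and at most `m` memory cells are in use at any time (an active loop
takes one cell for its index). -/
inductive Exec {n : ℕ} (Q : Matrix (Fin n) (Fin n) ℝ) (b : Fin n → ℝ) :
    Cmd n → Mem n → Mem n → ℕ → ℕ → Prop
  | assign (r : Reg) (e : Expr n) (σ : Mem n) :
      Exec Q b (.assign r e) σ (σ.setReg r (e.eval Q b σ)) (e.steps + 1)
        (max σ.space (σ.setReg r (e.eval Q b σ)).space)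
  | store (v : VecName) (i : Fin n) (e : Expr n) (σ : Mem n) :
      Exec Q b (.store v i e) σ (σ.setVec v i (e.eval Q b σ)) (e.steps + 1)
        (max σ.space (σ.setVec v i (e.eval Q b σ)).space)
  | insert (s : SetName) (i : Fin n) (σ : Mem n) :
      Exec Q b (.insert s i) σ (σ.setSet s (Insert.insert i (σ.set s))) 1
        (max σ.space (σ.setSet s (Insert.insert i (σ.set s))).space)
  | clear (s : SetName) (σ : Mem n) :
      Exec Q b (.clear s) σ (σ.setSet s ∅) ((σ.set s).card + 1)
        (max σ.space (σ.setSet s ∅).space)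
  | seq {c₁ c₂ : Cmd n} {σ₁ σ₂ σ₃ : Mem n} {t₁ t₂ m₁ m₂ : ℕ} :
      Exec Q b c₁ σ₁ σ₂ t₁ m₁ → Exec Q b c₂ σ₂ σ₃ t₂ m₂ →
      Exec Q b (.seq c₁ c₂) σ₁ σ₃ (t₁ + t₂) (max m₁ m₂)
  | ifNeg_true {e : Expr n} {c : Cmd n} {σ σ' : Mem n} {t m : ℕ} :
      e.eval Q b σ < 0 → Exec Q b c σ σ' t m →
      Exec Q b (.ifNeg e c) σ σ' (e.steps + 1 + t) m
  | ifNeg_false {e : Expr n} {c : Cmd n} {σ : Mem n} :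
      ¬ e.eval Q b σ < 0 → Exec Q b (.ifNeg e c) σ σ (e.steps + 1) σ.space
  | ifNotMem_true {i : Fin n} {s : SetName} {c : Cmd n} {σ σ' : Mem n} {t m : ℕ} :
      i ∉ σ.set s → Exec Q b c σ σ' t m →
      Exec Q b (.ifNotMem i s c) σ σ' (1 + t) m
  | ifNotMem_false {i : Fin n} {s : SetName} {c : Cmd n} {σ : Mem n} :
      i ∈ σ.set s → Exec Q b (.ifNotMem i s c) σ σ 1 σ.space
  | while_true {e : Expr n} {c : Cmd n} {σ₁ σ₂ σ₃ : Mem n} {t₁ t₂ m₁ m₂ : ℕ} :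
      0 < e.eval Q b σ₁ → Exec Q b c σ₁ σ₂ t₁ m₁ → Exec Q b (.whilePos e c) σ₂ σ₃ t₂ m₂ →
      Exec Q b (.whilePos e c) σ₁ σ₃ (e.steps + 1 + t₁ + t₂) (max m₁ m₂)
  | while_false {e : Expr n} {c : Cmd n} {σ : Mem n} :
      ¬ 0 < e.eval Q b σ → Exec Q b (.whilePos e c) σ σ (e.steps + 1) σ.space
  | forEach {it : Iter n} {c : Fin n → Cmd n} {σ σ' : Mem n} {t m : ℕ} :
      Exec Q b (.forList ((it.toFinset Q b σ).sort (· ≤ ·)) c) σ σ' t m →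
      Exec Q b (.forEach it c) σ σ' (t + 1) (m + 1)
  | forList_nil {c : Fin n → Cmd n} {σ : Mem n} :
      Exec Q b (.forList [] c) σ σ 0 σ.space
  | forList_cons {i : Fin n} {l : List (Fin n)} {c : Fin n → Cmd n} {σ₁ σ₂ σ₃ : Mem n}
      {t₁ t₂ m₁ m₂ : ℕ} :
      Exec Q b (c i) σ₁ σ₂ t₁ m₁ → Exec Q b (.forList l c) σ₂ σ₃ t₂ m₂ →
      Exec Q b (.forList (i :: l) c) σ₁ σ₃ (1 + t₁ + t₂) (max m₁ m₂)

/-! ## ASPR as a program -/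

namespace ASPR

open Expr

/-- `grad := ∇_i g(v)` for a vector `v` supported in the set `known`. -/
def computeGrad {n : ℕ} (v : VecName) (i : Fin n) : Cmd n :=
  Reg.grad ≔ nat 0 - rhs i ;;
  .forEach (.rowIn i .known) fun j =>
    Reg.grad ≔ reg .grad + coef i j * vec v j

/-- `nrm := ‖∇_S g(x)‖²`, where `S` is the set `known`. -/
def computeNorm (n : ℕ) : Cmd n :=
  Reg.nrm ≔ nat 0 ;;
  .forEach (.elems .known) fun i =>
    computeGrad .x i ;;
    Reg.nrm ≔ reg .nrm + reg .grad * reg .grad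

/-- `δ_t`, the subproblem accuracy, `κ`, and the number of iterations of the subroutine. -/
def setParameters (n : ℕ) : Cmd n :=
  Reg.kappa ≔ reg .lip / reg .alpha ;;
  Reg.delta ≔ sqrt (reg .eps * reg .alpha
    / ((nat 1 + card .known) * (reg .lip * reg .lip))) ;;
  Reg.acc ≔ reg .delta * reg .delta * reg .alpha / nat 2 ;;
  computeNorm n ;;
  Reg.count ≔ max (nat 1) (nat 1 + ceil (nat 2 * sqrt (reg .kappa) *
    log ((reg .lip - reg .alpha) * reg .nrm
      / (nat 2 * reg .acc * (reg .alpha * reg .alpha)))))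

/-- One iteration of accelerated projected gradient descent on the coordinates in `known`. -/
def apgdStep (n : ℕ) : Cmd n :=
  Reg.Anew ≔ reg .A + reg .a ;;
  .forEach (.elems .known) (fun i =>
    .store .p i (reg .A / reg .Anew * vec .y i + reg .a / reg .Anew * vec .z i)) ;;
  .forEach (.elems .known) (fun i =>
    computeGrad .p i ;;
    .store .z i (max (nat 0)
      ((reg .kappa - nat 1 + reg .A) / (reg .kappa - nat 1 + reg .Anew) * vec .z i
        + reg .a / (reg .kappa - nat 1 + reg .Anew)
          * (vec .p i - nat 1 / reg .alpha * reg .grad))) ;;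
    .store .y i (reg .A / reg .Anew * vec .y i + reg .a / reg .Anew * vec .z i)) ;;
  Reg.a ≔ reg .Anew * (nat 2 * reg .kappa
    / (nat 2 * reg .kappa + nat 1 - sqrt (nat 1 + nat 4 * reg .kappa)) - nat 1) ;;
  Reg.A ≔ reg .Anew ;;
  Reg.count ≔ reg .count - nat 1

/-- Accelerated projected gradient descent started at `x`, with result in `y`. -/
def apgd (n : ℕ) : Cmd n :=
  .forEach (.elems .known) (fun i =>
    .store .z i (vec .x i) ;;
    .store .y i (vec .x i)) ;;
  Reg.A ≔ nat 0 ;;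
  Reg.a ≔ nat 1 ;;
  .whilePos (reg .count) (apgdStep n)

/-- `x := max (0, y - δ_t 𝟙)` on the coordinates in `known`. -/
def retract (n : ℕ) : Cmd n :=
  .forEach (.elems .known) fun i => .store .x i (max (nat 0) (vec .y i - reg .delta))

/-- Collect in `fresh` the coordinates outside `known` with a negative partial derivative at `x`.
The partial derivatives are computed one after the other and not stored. -/
def expand (n : ℕ) : Cmd n :=
  .forEach (.nbrs .known) fun i =>
    computeGrad .x i ;;
    .ifNeg (reg .grad) (.ifNotMem i .known (.insert .fresh i))

/-- The program ASPR. At the start of the `t`-th pass through the main loop, `S^{(t)}` is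
`known ∪ fresh`, where `known` is `S^{(t-1)}` and `fresh` is `S^{(t)} \ S^{(t-1)}`. -/
def program (n : ℕ) : Cmd n :=
  .forEach .posRhs (fun i => .insert .fresh i) ;;
  .whilePos (card .fresh)
    (.forEach (.elems .fresh) (fun i => .insert .known i) ;;
     .clear .fresh ;;
     setParameters n ;;
     apgd n ;;
     retract n ;;
     expand n)

/-- The initial memory: the parameters in their registers, and nothing else. -/
noncomputable def initMem (n : ℕ) (α L ε : ℝ) : Mem n where
  reg := fun r => match r with
    | .alpha => α
    | .lip => L
    | .eps => ε
    | _ => 0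
  vec := fun _ _ => 0
  dom := fun _ => ∅
  set := fun _ => ∅

end ASPR

/-- On the problem with data `(Q, b)`, the program ASPR with parameters `α, L, ε` halts after `t`
steps, using `m` memory cells, and returns the output `x⁽ᵀ⁾` of the algorithm ASPR. -/
def ASPRRunsIn {n : ℕ} (Q : Matrix (Fin n) (Fin n) ℝ) (b : Fin n → ℝ) (α L ε : ℝ)
    (t m : ℕ) : Prop :=
  ∃ (T : ℕ) (x : ℕ → EVec n) (S : ℕ → Finset (Fin n)) (σ : Mem n),
    IsASPRRun (quadObj Q b) α L ε T x S ∧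
    Exec Q b (ASPR.program n) (ASPR.initMem n α L ε) σ t m ∧
    σ.vec .x = (x T).ofLp

/-! ## Personalized PageRank with `ℓ₁`-regularization -/

/-- `D^{-1/2} (D - (1-α)/2 (D + A)) D^{-1/2}`. -/
noncomputable def pageRankMatrix {n : ℕ} (G : SimpleGraph (Fin n)) [DecidableRel G.Adj]
    (α : ℝ) : Matrix (Fin n) (Fin n) ℝ :=
  let D : Matrix (Fin n) (Fin n) ℝ := Matrix.diagonal fun i => (G.degree i : ℝ)
  let Dinvsqrt : Matrix (Fin n) (Fin n) ℝ :=
    Matrix.diagonal fun i => (Real.sqrt (G.degree i))⁻¹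
  Dinvsqrt * (D - ((1 - α) / 2) • (D + G.adjMatrix ℝ)) * Dinvsqrt

/-- The `ℓ₁`-regularized PageRank objective
`½⟨x, Q x⟩ - α ⟨s, D^{-1/2} x⟩ + α ρ ‖D^{1/2} x‖₁`. -/
noncomputable def pageRankObj {n : ℕ} (G : SimpleGraph (Fin n)) [DecidableRel G.Adj]
    (α ρ : ℝ) (s : Fin n → ℝ) (x : EVec n) : ℝ :=
  (1 / 2) * quadForm (pageRankMatrix G α) x
    - α * ∑ i, s i * ((Real.sqrt (G.degree i))⁻¹ * x i)
    + α * ρ * ∑ i, |Real.sqrt (G.degree i) * x i|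

/-- The linear term of the equivalent problem over the nonnegative orthant: for `x ≥ 0` the
regularized objective is `½⟨x, Q x⟩ - ⟨b, x⟩` with `b = α D^{-1/2} s - α ρ D^{1/2} 𝟙`. -/
noncomputable def pageRankRhs {n : ℕ} (G : SimpleGraph (Fin n)) [DecidableRel G.Adj]
    (α ρ : ℝ) (s : Fin n → ℝ) (i : Fin n) : ℝ :=
  α * ((Real.sqrt (G.degree i))⁻¹ * s i) - α * ρ * Real.sqrt (G.degree i)

/-- `vol(S) = ∑_{i ∈ S} d_i + |S|`. -/
def graphVol {n : ℕ} (G : SimpleGraph (Fin n)) [DecidableRel G.Adj] (S : Finset (Fin n)) : ℕ :=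
  ∑ i ∈ S, G.degree i + S.card

/-- The internal volume: `|S|` plus the number of pairs `(i, j) ∈ S × S` of adjacent vertices. -/
def graphIntVol {n : ℕ} (G : SimpleGraph (Fin n)) [DecidableRel G.Adj]
    (S : Finset (Fin n)) : ℕ :=
  S.card + ((S ×ˢ S).filter fun p : Fin n × Fin n => G.Adj p.1 p.2).card

/-!
The complexity of ASPR rests on a monotonicity property of M-matrices. Let `x*` be the minimizer of
`g(x) = ½⟨x, Q x⟩ - ⟨b, x⟩` over `x ≥ 0`. If `0 ≤ x ≤ x*` and `∂ᵢ g(x) < 0`, then `x*ᵢ > 0`, because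
increasing the other coordinates can only decrease `∂ᵢ g`
(`IsBoundedMMatrix.pos_of_quadGrad_neg`). Hence as long as the iterates stay below `x*`, every known
set is contained in the support `S*` of `x*`, and since the known sets grow strictly there are at
most `|S*|` passes (`IsBoundedMMatrix.exists_isASPRRun`).

The iterates do stay below `x*`. For `S ⊆ S*`, the minimizer `u` of `g` over the vectors `x ≥ 0`
supported in `S` satisfies `u ≤ x*` (`IsBoundedMMatrix.exists_isSubproblemMin`). The accelerated
method decreases the potential `A (g(y) - g(u)) + α (κ - 1 + A) / 2 ‖z - u‖²`, which is checked one
coordinate at a time (`potential_coordinate`), and its weights grow at least by the factor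
`exp (1 / (2 √κ))` (`exp_le_apgdRatio`). So the prescribed number of iterations brings `y` within
distance `δ` of `u`, and subtracting `δ` from every coordinate puts the next iterate below `u`, thus
below `x*` (`IsBoundedMMatrix.asprNext_le`). On `S` the gradient of `g` vanishes at `x*`, so
`‖∇_S g(x)‖ ≤ L ‖x*‖` at every iterate, which bounds the number of iterations
(`IsBoundedMMatrix.cast_asprIters_le`).

The program is analysed with a small program logic: `Runs` is total correctness with bounds on time
and space, and loops are handled by invariants indexed by the set of elements already processed
(`Runs.forEach`) or by the number of passes (`Runs.whilePos`). The cost of one pass is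
`runs_pass`: each iteration of the subroutine takes time `O(nnz(Q_{S,S}))` and the search for new
coordinates takes time `O(nnz(Q_{:,S}))`.

For PageRank, the spectral bounds on `Q` follow from `|∑ A_ij y_i y_j| ≤ ∑ d_i y_i²`
(`abs_sum_adjMatrix_le`). Dropping the negative part of a vector decreases the regularized
objective, so its minimizer is nonnegative and solves the problem over the nonnegative orthant
(`isKKTPoint_pageRank`); moreover it has norm at most one, since `α ‖x*‖² ≤ ⟨x*, b⟩ ≤ α ⟨x*, s⟩`.
-/

/-! ### Quadratic functions -/

section Quadratic

variable {n : ℕ}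

/-- The objective `½⟨x, Q x⟩ - ⟨b, x⟩` on plain coordinate vectors. -/
noncomputable def quadFun (Q : Matrix (Fin n) (Fin n) ℝ) (b x : Fin n → ℝ) : ℝ :=
  (1 / 2) * (x ⬝ᵥ Q.mulVec x) - b ⬝ᵥ x

/-- The gradient `Q x - b` of `quadFun Q b`. -/
def quadGrad (Q : Matrix (Fin n) (Fin n) ℝ) (b x : Fin n → ℝ) : Fin n → ℝ :=
  Q.mulVec x - b

theorem quadGrad_apply (Q : Matrix (Fin n) (Fin n) ℝ) (b x : Fin n → ℝ) (i : Fin n) :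
    quadGrad Q b x i = ∑ j, Q i j * x j - b i := rfl

/-- `Q` is a symmetric matrix with nonpositive off-diagonal entries and
`α I ≼ Q ≼ L I`, where `α > 0`. -/
structure IsBoundedMMatrix (Q : Matrix (Fin n) (Fin n) ℝ) (α L : ℝ) : Prop where
  symm : Q.IsSymm
  offDiag : ∀ i j, i ≠ j → Q i j ≤ 0
  pos : 0 < α
  lower : ∀ x : Fin n → ℝ, α * (x ⬝ᵥ x) ≤ x ⬝ᵥ Q.mulVec x
  upper : ∀ x : Fin n → ℝ, x ⬝ᵥ Q.mulVec x ≤ L * (x ⬝ᵥ x)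

theorem norm_sq_eq_dotProduct (x : EVec n) : ‖x‖ ^ 2 = x.ofLp ⬝ᵥ x.ofLp := by
  rw [EuclideanSpace.norm_sq_eq]
  simp [dotProduct, sq]

theorem dotProduct_mulVec_symm {Q : Matrix (Fin n) (Fin n) ℝ} (hQ : Q.IsSymm)
    (x y : Fin n → ℝ) : x ⬝ᵥ Q.mulVec y = y ⬝ᵥ Q.mulVec x := by
  rw [Matrix.dotProduct_mulVec, ← Matrix.mulVec_transpose, hQ.eq, dotProduct_comm]

theorem quadFun_add {Q : Matrix (Fin n) (Fin n) ℝ} (hQ : Q.IsSymm) (b x d : Fin n → ℝ) :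
    quadFun Q b (x + d)
      = quadFun Q b x + quadGrad Q b x ⬝ᵥ d + (1 / 2) * (d ⬝ᵥ Q.mulVec d) := by
  have h := dotProduct_mulVec_symm hQ x d
  have h' : Q.mulVec x ⬝ᵥ d = d ⬝ᵥ Q.mulVec x := dotProduct_comm _ _
  simp only [quadFun, quadGrad, Matrix.mulVec_add, dotProduct_add, add_dotProduct,
    sub_dotProduct, h, h']
  ring

theorem hasGradientAt_quadObj {Q : Matrix (Fin n) (Fin n) ℝ} (hQ : Q.IsSymm) (b : Fin n → ℝ)
    (x : EVec n) :
    HasGradientAt (quadObj Q b) (WithLp.toLp 2 (quadGrad Q b x.ofLp)) x := by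
  rw [hasGradientAt_iff_hasFDerivAt]
  have hexp : ∀ y : EVec n, quadObj Q b y = quadFun Q b x.ofLp
      + quadGrad Q b x.ofLp ⬝ᵥ (y - x).ofLp
      + (1 / 2) * ((y - x).ofLp ⬝ᵥ Q.mulVec (y - x).ofLp) := by
    intro y
    rw [← quadFun_add hQ]
    simp [quadObj, quadForm, quadFun]
  let B : EVec n →L[ℝ] EVec n := Matrix.toEuclideanCLM (𝕜 := ℝ) Q
  have hB : ∀ y : EVec n, y.ofLp ⬝ᵥ Q.mulVec y.ofLp = inner ℝ y (B y) := by
    intro y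
    simp [B, PiLp.inner_apply, dotProduct, mul_comm, Matrix.ofLp_toEuclideanCLM]
  have hlin : ∀ y : EVec n, quadGrad Q b x.ofLp ⬝ᵥ y.ofLp
      = InnerProductSpace.toDual ℝ (EVec n) (WithLp.toLp 2 (quadGrad Q b x.ofLp)) y := by
    intro y
    simp [PiLp.inner_apply, dotProduct, mul_comm]
  have h1 : HasFDerivAt (fun y : EVec n => y - x) (ContinuousLinearMap.id ℝ (EVec n)) x :=
    (hasFDerivAt_id x).sub_const x
  have h2 := h1.inner ℝ (B.hasFDerivAt.comp x h1)
  have h3 := (InnerProductSpace.toDual ℝ (EVec n)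
    (WithLp.toLp 2 (quadGrad Q b x.ofLp))).hasFDerivAt.comp x h1
  have h4 := (h3.const_add (quadFun Q b x.ofLp)).add (h2.const_mul (1 / 2))
  refine (h4.congr_of_eventuallyEq (Filter.Eventually.of_forall fun y => ?_)).congr_fderiv ?_
  · rw [hexp, hB, hlin]; rfl
  · ext y
    simp

theorem gradient_quadObj {Q : Matrix (Fin n) (Fin n) ℝ} (hQ : Q.IsSymm) (b : Fin n → ℝ)
    (x : EVec n) : ∇ (quadObj Q b) x = WithLp.toLp 2 (quadGrad Q b x.ofLp) :=
  (hasGradientAt_quadObj hQ b x).gradient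

theorem dotProduct_self_nonneg (x : Fin n → ℝ) : 0 ≤ x ⬝ᵥ x :=
  Finset.sum_nonneg fun i _ => mul_self_nonneg (x i)

namespace IsBoundedMMatrix

variable {Q : Matrix (Fin n) (Fin n) ℝ} {α L : ℝ}

theorem diag_ge (h : IsBoundedMMatrix Q α L) (i : Fin n) : α ≤ Q i i := by
  simpa using h.lower (Pi.single i 1)

theorem diag_ne_zero (h : IsBoundedMMatrix Q α L) (i : Fin n) : Q i i ≠ 0 :=
  (h.pos.trans_le (h.diag_ge i)).ne'

theorem le_of_index (h : IsBoundedMMatrix Q α L) (i : Fin n) : α ≤ L := by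
  have h1 := h.upper (Pi.single i 1)
  have h2 : Q i i ≤ L := by simpa using h1
  exact (h.diag_ge i).trans h2

theorem quadFun_ge (h : IsBoundedMMatrix Q α L) (b x y : Fin n → ℝ) :
    quadFun Q b x + quadGrad Q b x ⬝ᵥ (y - x) + α / 2 * ((y - x) ⬝ᵥ (y - x))
      ≤ quadFun Q b y := by
  have h1 := quadFun_add h.symm b x (y - x)
  have h2 := h.lower (y - x)
  rw [add_sub_cancel] at h1
  linarith

theorem quadFun_le (h : IsBoundedMMatrix Q α L) (b x y : Fin n → ℝ) :
    quadFun Q b y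
      ≤ quadFun Q b x + quadGrad Q b x ⬝ᵥ (y - x) + L / 2 * ((y - x) ⬝ᵥ (y - x)) := by
  have h1 := quadFun_add h.symm b x (y - x)
  have h2 := h.upper (y - x)
  rw [add_sub_cancel] at h1
  linarith

/-- `‖Q v‖ ≤ L ‖v‖`, obtained by testing `0 ≼ Q` with the vector `v - Q v / L`. -/
theorem mulVec_dotProduct_self_le (h : IsBoundedMMatrix Q α L) (v : Fin n → ℝ) :
    Q.mulVec v ⬝ᵥ Q.mulVec v ≤ L ^ 2 * (v ⬝ᵥ v) := by
  rcases isEmpty_or_nonempty (Fin n) with hn | ⟨⟨i⟩⟩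
  · simp [dotProduct]
  have hL : 0 < L := h.pos.trans_le (h.le_of_index i)
  set w := Q.mulVec v
  have h1 : (0 : ℝ) ≤ (v - L⁻¹ • w) ⬝ᵥ Q.mulVec (v - L⁻¹ • w) :=
    (mul_nonneg h.pos.le (dotProduct_self_nonneg _)).trans (h.lower _)
  have h2 := h.upper w
  have h3 : v ⬝ᵥ Q.mulVec w = w ⬝ᵥ w := by
    rw [dotProduct_mulVec_symm h.symm]
  have h4 := h.upper v
  simp only [Matrix.mulVec_sub, Matrix.mulVec_smul, dotProduct_sub, sub_dotProduct,
    dotProduct_smul, smul_dotProduct, smul_eq_mul] at h1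
  have h5 : L⁻¹ * (L⁻¹ * (w ⬝ᵥ Q.mulVec w)) ≤ L⁻¹ * (w ⬝ᵥ w) := by
    have : L⁻¹ * (w ⬝ᵥ Q.mulVec w) ≤ w ⬝ᵥ w := by
      rw [inv_mul_le_iff₀ hL]; exact h2
    gcongr
  have h6 : L⁻¹ * (w ⬝ᵥ w) ≤ v ⬝ᵥ w := by
    rw [show Q.mulVec v = w from rfl, h3] at h1
    linarith
  rw [inv_mul_le_iff₀ hL] at h6
  calc w ⬝ᵥ w ≤ L * (v ⬝ᵥ w) := h6
    _ ≤ L * (L * (v ⬝ᵥ v)) := by gcongr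
    _ = _ := by ring

/-- Outside the coordinate `i`, increasing `x` decreases the `i`-th partial derivative. -/
theorem quadGrad_anti (h : IsBoundedMMatrix Q α L) (b : Fin n → ℝ) {x y : Fin n → ℝ}
    (hxy : x ≤ y) {i : Fin n} (hi : x i = y i) : quadGrad Q b y i ≤ quadGrad Q b x i := by
  rw [quadGrad_apply, quadGrad_apply]
  gcongr 1
  refine Finset.sum_le_sum fun j _ => ?_
  rcases eq_or_ne i j with rfl | hij
  · rw [hi]
  · exact mul_le_mul_of_nonpos_left (hxy j) (h.offDiag i j hij)

end IsBoundedMMatrix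

theorem nonneg_of_small_quadratic {p q τ : ℝ} (hτ : 0 < τ)
    (h : ∀ t, 0 < t → t ≤ τ → 0 ≤ t * p + t ^ 2 * q) : 0 ≤ p := by
  by_contra! hp
  have hq : 0 < |q| + 1 := by positivity
  have ht : 0 < min τ (-p / (2 * (|q| + 1))) := lt_min hτ (by apply div_pos <;> linarith)
  set t := min τ (-p / (2 * (|q| + 1)))
  have h1 := h t ht (min_le_left _ _)
  have h2 : t * (2 * (|q| + 1)) ≤ -p := (le_div_iff₀ (by positivity)).1 (min_le_right _ _)
  have h3 : t * q ≤ t * |q| := by gcongr; exact le_abs_self q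
  nlinarith

/-- First-order optimality: if moving from `x` in the direction `c e_i` does not decrease the
objective, then the directional derivative is nonnegative. -/
theorem quadGrad_mul_nonneg {Q : Matrix (Fin n) (Fin n) ℝ} (hQ : Q.IsSymm) (b x : Fin n → ℝ)
    (i : Fin n) (c : ℝ) {τ : ℝ} (hτ : 0 < τ)
    (h : ∀ t, 0 < t → t ≤ τ → quadFun Q b x ≤ quadFun Q b (x + Pi.single i (t * c))) :
    0 ≤ quadGrad Q b x i * c := by
  refine nonneg_of_small_quadratic (q := Q i i * c ^ 2 / 2) hτ fun t ht htτ => ?_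
  have h1 := h t ht htτ
  rw [quadFun_add hQ] at h1
  simp only [dotProduct_single, single_dotProduct, Matrix.mulVec_single, Pi.smul_apply,
    Matrix.col_apply, op_smul_eq_smul, smul_eq_mul] at h1
  nlinarith

/-- The optimality conditions of the minimizer of `½⟨x, Q x⟩ - ⟨b, x⟩` over `x ≥ 0`. -/
structure IsKKTPoint (Q : Matrix (Fin n) (Fin n) ℝ) (b x : Fin n → ℝ) : Prop where
  nonneg : 0 ≤ x
  grad_nonneg : ∀ i, 0 ≤ quadGrad Q b x i
  grad_eq_zero : ∀ i, 0 < x i → quadGrad Q b x i = 0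

theorem isKKTPoint_of_isMinOn {Q : Matrix (Fin n) (Fin n) ℝ} (hQ : Q.IsSymm) {b : Fin n → ℝ}
    {xs : EVec n} (h0 : xs ∈ nonnegOrthant n)
    (hmin : IsMinOn (quadObj Q b) (nonnegOrthant n) xs) : IsKKTPoint Q b xs.ofLp := by
  have hmin' : ∀ y : Fin n → ℝ, 0 ≤ y → quadFun Q b xs.ofLp ≤ quadFun Q b y := fun y hy =>
    hmin (show WithLp.toLp 2 y ∈ nonnegOrthant n from hy)
  have h0' : (0 : Fin n → ℝ) ≤ xs.ofLp := h0
  have hge : ∀ i, 0 ≤ quadGrad Q b xs.ofLp i := fun i => by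
    have := quadGrad_mul_nonneg hQ b xs.ofLp i 1 one_pos fun t ht _ =>
      hmin' _ (add_nonneg h0' (Pi.single_nonneg.2 (by linarith)))
    simpa using this
  refine ⟨h0', hge, fun i hi => le_antisymm ?_ (hge i)⟩
  have := quadGrad_mul_nonneg hQ b xs.ofLp i (-1) hi fun t ht htτ => hmin' _ fun j => by
    rcases eq_or_ne j i with rfl | hj
    · simpa using htτ
    · simpa [hj] using h0' j
  linarith

/-- The optimality conditions of the minimizer `u` of the objective over the vectors `x ≥ 0`
supported in `S`. -/
structure IsSubproblemMin (Q : Matrix (Fin n) (Fin n) ℝ) (b : Fin n → ℝ) (S : Finset (Fin n))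
    (u : Fin n → ℝ) : Prop where
  nonneg : 0 ≤ u
  support : ∀ i, i ∉ S → u i = 0
  grad_nonneg : ∀ i ∈ S, 0 ≤ quadGrad Q b u i
  grad_eq_zero : ∀ i ∈ S, 0 < u i → quadGrad Q b u i = 0

/-- If `S` lies in the support of the optimal point `xs`, the subproblem on `S` has a solution
below `xs`. It is found by minimizing over the box `0 ≤ u ≤ xs` only: at a coordinate where the
upper bound is attained, the partial derivative dominates that at `xs`, which vanishes. -/
theorem IsBoundedMMatrix.exists_isSubproblemMin {Q : Matrix (Fin n) (Fin n) ℝ} {α L : ℝ}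
    (h : IsBoundedMMatrix Q α L) {b xs : Fin n → ℝ} (hxs : IsKKTPoint Q b xs)
    {S : Finset (Fin n)} (hS : ∀ i ∈ S, 0 < xs i) :
    ∃ u, IsSubproblemMin Q b S u ∧ u ≤ xs := by
  set v : Fin n → ℝ := fun i => if i ∈ S then xs i else 0 with hv
  have hv0 : 0 ≤ v := fun i => by
    by_cases hi : i ∈ S
    · simpa [hv, hi] using hxs.nonneg i
    · simp [hv, hi]
  have hvxs : v ≤ xs := fun i => by
    by_cases hi : i ∈ S
    · simp [hv, hi]
    · simpa [hv, hi] using hxs.nonneg i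
  have hcont : Continuous (quadFun Q b) := by
    unfold quadFun dotProduct Matrix.mulVec dotProduct
    fun_prop
  obtain ⟨u, hu, hmin⟩ := isCompact_Icc.exists_isMinOn (s := Set.Icc (0 : Fin n → ℝ) v)
    ⟨0, le_rfl, hv0⟩ hcont.continuousOn
  have huxs : u ≤ xs := hu.2.trans hvxs
  have hge : ∀ i ∈ S, 0 ≤ quadGrad Q b u i := by
    intro i hi
    have hvi : v i = xs i := by simp [hv, hi]
    rcases (hu.2 i).lt_or_eq with hlt | heq
    · have := quadGrad_mul_nonneg h.symm b u i 1 (sub_pos.2 hlt) fun t ht htτ =>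
        hmin ⟨add_nonneg hu.1 (Pi.single_nonneg.2 (by linarith)), fun j => by
          rcases eq_or_ne j i with rfl | hj
          · simp; linarith
          · simpa [hj] using hu.2 j⟩
      simpa using this
    · rw [← hxs.grad_eq_zero i (hS i hi)]
      exact h.quadGrad_anti b huxs (heq.trans hvi)
  refine ⟨u, ⟨hu.1, fun i hi => le_antisymm (by simpa [hv, hi] using hu.2 i) (hu.1 i), hge,
    fun i hi hpos => le_antisymm ?_ (hge i hi)⟩, huxs⟩
  have := quadGrad_mul_nonneg h.symm b u i (-1) hpos fun t ht htτ =>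
    hmin ⟨fun j => by
      rcases eq_or_ne j i with rfl | hj
      · simpa using htτ
      · simpa [hj] using hu.1 j, fun j => by
      rcases eq_or_ne j i with rfl | hj
      · have := hu.2 j
        simp; linarith
      · simpa [hj] using hu.2 j⟩
  linarith

/-- The variational inequality at the solution of a subproblem. -/
theorem IsSubproblemMin.grad_dotProduct_nonneg {Q : Matrix (Fin n) (Fin n) ℝ} {b : Fin n → ℝ}
    {S : Finset (Fin n)} {u : Fin n → ℝ} (hu : IsSubproblemMin Q b S u) {y : Fin n → ℝ}
    (hy : 0 ≤ y) (hyS : ∀ i, i ∉ S → y i = 0) : 0 ≤ quadGrad Q b u ⬝ᵥ (y - u) := by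
  refine Finset.sum_nonneg fun i _ => ?_
  by_cases hi : i ∈ S
  · rcases (hu.nonneg i).lt_or_eq with hpos | h0
    · rw [hu.grad_eq_zero i hi hpos, zero_mul]
    · have h0' : u i = 0 := h0.symm
      rw [Pi.sub_apply, h0', sub_zero]
      exact mul_nonneg (hu.grad_nonneg i hi) (hy i)
  · simp [hyS i hi, hu.support i hi]

end Quadratic

/-! ### Accelerated projected gradient descent -/

section APGD

variable {n : ℕ}

/-- The factor `2κ / (2κ + 1 - √(1 + 4κ))` by which the weights `A` of the accelerated method
grow. -/
noncomputable def apgdRatio (κ : ℝ) : ℝ :=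
  2 * κ / (2 * κ + 1 - Real.sqrt (1 + 4 * κ))

/-- In terms of `s = √(1 + 4κ)` the ratio is `(s + 1) / (s - 1)`. -/
theorem apgdRatio_eq {κ : ℝ} (hκ : 1 ≤ κ) :
    apgdRatio κ = (Real.sqrt (1 + 4 * κ) + 1) / (Real.sqrt (1 + 4 * κ) - 1) := by
  have h0 : (0 : ℝ) ≤ 1 + 4 * κ := by linarith
  have hsq := Real.sq_sqrt h0
  have hs : 2 < Real.sqrt (1 + 4 * κ) := Real.lt_sqrt_of_sq_lt (by linarith)
  unfold apgdRatio
  set s := Real.sqrt (1 + 4 * κ)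
  have hden : 2 * κ + 1 - s = (s - 1) ^ 2 / 2 := by nlinarith
  rw [hden, div_eq_div_iff (by nlinarith) (by linarith)]
  nlinarith

theorem one_lt_apgdRatio {κ : ℝ} (hκ : 1 ≤ κ) : 1 < apgdRatio κ := by
  have hs : 2 < Real.sqrt (1 + 4 * κ) := Real.lt_sqrt_of_sq_lt (by linarith)
  rw [apgdRatio_eq hκ, one_lt_div (by linarith)]
  linarith

/-- The equation `κ a² = A A'` for consecutive weights, divided by `A²`. -/
theorem mul_apgdRatio_sub_one_sq {κ : ℝ} (hκ : 1 ≤ κ) :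
    κ * (apgdRatio κ - 1) ^ 2 = apgdRatio κ := by
  have hsq := Real.sq_sqrt (show (0 : ℝ) ≤ 1 + 4 * κ by linarith)
  have hs : 2 < Real.sqrt (1 + 4 * κ) := Real.lt_sqrt_of_sq_lt (by linarith)
  rw [apgdRatio_eq hκ]
  set s := Real.sqrt (1 + 4 * κ)
  have h1 : s - 1 ≠ 0 := by linarith
  field_simp
  nlinarith

theorem exp_le_apgdRatio {κ : ℝ} (hκ : 1 ≤ κ) :
    Real.exp (1 / (2 * Real.sqrt κ)) ≤ apgdRatio κ := by
  have hsq := Real.sq_sqrt (show (0 : ℝ) ≤ 1 + 4 * κ by linarith)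
  have hs : 2 < Real.sqrt (1 + 4 * κ) := Real.lt_sqrt_of_sq_lt (by linarith)
  have hκsq := Real.sq_sqrt (show (0 : ℝ) ≤ κ by linarith)
  have hk : 1 ≤ Real.sqrt κ := Real.one_le_sqrt.2 hκ
  rw [apgdRatio_eq hκ]
  set s := Real.sqrt (1 + 4 * κ)
  set k := Real.sqrt κ
  have hsk : s + 1 ≤ 4 * k := by
    have : s ≤ 4 * k - 1 := abs_le_of_sq_le_sq' (by nlinarith) (by linarith) |>.2
    linarith
  have h1 : 1 / (2 * k) ≤ 2 / (s + 1) := by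
    rw [div_le_div_iff₀ (by linarith) (by linarith)]
    linarith
  have h2 := Real.add_one_le_exp (-(2 / (s + 1)))
  have h3 : -(2 / (s + 1)) + 1 = (s - 1) / (s + 1) := by
    have : s + 1 ≠ 0 := by linarith
    field_simp
    ring
  rw [h3, Real.exp_neg] at h2
  calc Real.exp (1 / (2 * k)) ≤ Real.exp (2 / (s + 1)) := Real.exp_le_exp.2 h1
    _ ≤ ((s - 1) / (s + 1))⁻¹ := by
        rw [le_inv_comm₀ (Real.exp_pos _) (div_pos (by linarith) (by linarith))]
        exact h2
    _ = _ := inv_div _ _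

/-- The variables of the accelerated method. -/
structure APGDState (n : ℕ) where
  y : Fin n → ℝ
  z : Fin n → ℝ
  A : ℝ
  a : ℝ

/-- The point at which the next gradient is evaluated. -/
noncomputable def APGDState.point (s : APGDState n) : Fin n → ℝ := fun i =>
  s.A / (s.A + s.a) * s.y i + s.a / (s.A + s.a) * s.z i

/-- The step from `z` before its projection, for `κ = L / α`. -/
noncomputable def APGDState.step (Q : Matrix (Fin n) (Fin n) ℝ) (b : Fin n → ℝ) (α L : ℝ)
    (s : APGDState n) : Fin n → ℝ := fun i =>
  (L / α - 1 + s.A) / (L / α - 1 + (s.A + s.a)) * s.z i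
    + s.a / (L / α - 1 + (s.A + s.a)) * (s.point i - 1 / α * quadGrad Q b s.point i)

/-- The projection onto the nonnegative vectors supported in `S`. -/
noncomputable def projOn (S : Finset (Fin n)) (w : Fin n → ℝ) : Fin n → ℝ := fun i =>
  if i ∈ S then max 0 (w i) else 0

/-- One iteration of the accelerated method on the nonnegative vectors supported in `S`. -/
noncomputable def APGDState.next (Q : Matrix (Fin n) (Fin n) ℝ) (b : Fin n → ℝ) (α L : ℝ)
    (S : Finset (Fin n)) (s : APGDState n) : APGDState n where
  y := fun i => s.A / (s.A + s.a) * s.y i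
    + s.a / (s.A + s.a) * projOn S (s.step Q b α L) i
  z := projOn S (s.step Q b α L)
  A := s.A + s.a
  a := (s.A + s.a) * (apgdRatio (L / α) - 1)

/-- The iterates of the accelerated method started at `x₀`. -/
noncomputable def apgdIter (Q : Matrix (Fin n) (Fin n) ℝ) (b : Fin n → ℝ) (α L : ℝ)
    (S : Finset (Fin n)) (x₀ : Fin n → ℝ) : ℕ → APGDState n
  | 0 => ⟨x₀, x₀, 0, 1⟩
  | t + 1 => (apgdIter Q b α L S x₀ t).next Q b α L S

theorem projOn_nonneg (S : Finset (Fin n)) (w : Fin n → ℝ) : 0 ≤ projOn S w := fun i => by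
  unfold projOn
  split_ifs
  · exact le_max_left _ _
  · exact le_rfl

theorem projOn_of_notMem {S : Finset (Fin n)} (w : Fin n → ℝ) {i : Fin n} (hi : i ∉ S) :
    projOn S w i = 0 := by
  simp [projOn, hi]

theorem isProj_projOn (S : Finset (Fin n)) (w : Fin n → ℝ) :
    IsProj (orthantOn S) (WithLp.toLp 2 w) (WithLp.toLp 2 (projOn S w)) := by
  refine ⟨⟨fun i => projOn_nonneg S w i, fun i hi => projOn_of_notMem w hi⟩, fun v hv => ?_⟩
  rw [EuclideanSpace.norm_eq, EuclideanSpace.norm_eq]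
  refine Real.sqrt_le_sqrt (Finset.sum_le_sum fun i _ => ?_)
  simp only [PiLp.sub_apply, Real.norm_eq_abs, sq_abs]
  by_cases hi : i ∈ S
  · simp only [projOn, hi, if_true]
    have h0 := hv.1 i
    rcases le_total 0 (w i) with h | h
    · rw [max_eq_right h]
      nlinarith [sq_nonneg (w i - v.ofLp i)]
    · rw [max_eq_left h]
      nlinarith
  · simp [projOn, hi, hv.2 i hi]

theorem isAPGDOutput_apgdIter {Q : Matrix (Fin n) (Fin n) ℝ} (hQ : Q.IsSymm) (b : Fin n → ℝ)
    (α L : ℝ) (S : Finset (Fin n)) (x₀ : Fin n → ℝ) (N : ℕ) :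
    IsAPGDOutput (orthantOn S) (WithLp.toLp 2 x₀) (quadObj Q b) α L N
      (WithLp.toLp 2 (apgdIter Q b α L S x₀ N).y) := by
  refine ⟨fun t => WithLp.toLp 2 (apgdIter Q b α L S x₀ (t - 1)).point,
    fun t => WithLp.toLp 2 (apgdIter Q b α L S x₀ t).y,
    fun t => WithLp.toLp 2 (apgdIter Q b α L S x₀ t).z,
    fun t => (apgdIter Q b α L S x₀ t).A, fun t => (apgdIter Q b α L S x₀ t).a,
    rfl, rfl, rfl, rfl, fun t _ => ⟨rfl, ?_, ?_, ?_, rfl⟩, rfl⟩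
  · ext i
    simp [APGDState.point, apgdIter, APGDState.next]
  · have h := isProj_projOn S ((apgdIter Q b α L S x₀ t).step Q b α L)
    rw [gradient_quadObj hQ]
    convert h using 1
    · ext i
      simp [APGDState.step, apgdIter, APGDState.next]
    · rfl
  · ext i
    simp [apgdIter, APGDState.next]

theorem apgdIter_support (Q : Matrix (Fin n) (Fin n) ℝ) (b : Fin n → ℝ) (α L : ℝ)
    {S : Finset (Fin n)} {x₀ : Fin n → ℝ} (hx : ∀ i, i ∉ S → x₀ i = 0) (t : ℕ) {i : Fin n}
    (hi : i ∉ S) : (apgdIter Q b α L S x₀ t).y i = 0 ∧ (apgdIter Q b α L S x₀ t).z i = 0 := by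
  induction t with
  | zero => exact ⟨hx i hi, hx i hi⟩
  | succ t ih => simp [apgdIter, APGDState.next, ih.1, projOn_of_notMem _ hi]

theorem apgdIter_weights (Q : Matrix (Fin n) (Fin n) ℝ) (b : Fin n → ℝ) (α L : ℝ)
    (S : Finset (Fin n)) (x₀ : Fin n → ℝ) (t : ℕ) :
    (apgdIter Q b α L S x₀ (t + 1)).A = apgdRatio (L / α) ^ t
      ∧ (apgdIter Q b α L S x₀ (t + 1)).a
        = apgdRatio (L / α) ^ t * (apgdRatio (L / α) - 1) := by
  induction t with
  | zero => simp [apgdIter, APGDState.next]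
  | succ t ih =>
    rw [apgdIter, APGDState.next]
    simp only [ih.1, ih.2]
    constructor <;> ring

theorem apgdIter_weights_nonneg (Q : Matrix (Fin n) (Fin n) ℝ) (b : Fin n → ℝ) {α L : ℝ}
    (hκ : 1 ≤ L / α) (S : Finset (Fin n)) (x₀ : Fin n → ℝ) (t : ℕ) :
    0 ≤ (apgdIter Q b α L S x₀ t).A ∧ 0 < (apgdIter Q b α L S x₀ t).a := by
  cases t with
  | zero => exact ⟨le_rfl, one_pos⟩
  | succ t =>
    have h := apgdIter_weights Q b α L S x₀ t
    have hr := one_lt_apgdRatio hκ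
    rw [h.1, h.2]
    exact ⟨by positivity, mul_pos (by positivity) (by linarith)⟩

/-- The inequality between consecutive weights that makes the potential decrease. -/
theorem apgdIter_weights_sq (Q : Matrix (Fin n) (Fin n) ℝ) (b : Fin n → ℝ) {α L : ℝ}
    (hκ : 1 ≤ L / α) (S : Finset (Fin n)) (x₀ : Fin n → ℝ) (t : ℕ) :
    (L / α - 1) * (apgdIter Q b α L S x₀ t).a ^ 2
      ≤ (L / α - 1 + (apgdIter Q b α L S x₀ t).A)
        * ((apgdIter Q b α L S x₀ t).A + (apgdIter Q b α L S x₀ t).a) := by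
  cases t with
  | zero => simp [apgdIter]
  | succ t =>
    have h := apgdIter_weights Q b α L S x₀ t
    have hr := one_lt_apgdRatio hκ
    have hr2 := mul_apgdRatio_sub_one_sq hκ
    rw [h.1, h.2]
    set r := apgdRatio (L / α)
    have hp : 0 < r ^ t := by positivity
    set P := r ^ t
    have e1 : (L / α) * (P * (r - 1)) ^ 2 = P ^ 2 * r := by rw [mul_pow, mul_left_comm, hr2]
    have e2 : 0 ≤ (L / α - 1) * (P + P * (r - 1)) :=
      mul_nonneg (by linarith) (by nlinarith)
    nlinarith [sq_nonneg (P * (r - 1))]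

theorem three_point_identity (B a x z z' u : ℝ) :
    a * (u - x) ^ 2 + B * (u - z) ^ 2 - (B + a) * (u - z') ^ 2
      = a * (z' - x) ^ 2 + B * (z' - z) ^ 2
        - 2 * ((B * (z - z') + a * (x - z')) * (u - z')) := by
  ring

/-- The decrease of the potential in one coordinate: `y, z, y', z'` are the old and new iterates,
`x` is the point at which the partial derivative `g` is evaluated, `w` is the step that is
projected, and `u` is the point of comparison. -/
theorem potential_coordinate {κ α A a x y z y' z' u w g : ℝ} (hα : 0 < α) (hκ : 1 ≤ κ)
    (hA : 0 ≤ A) (ha : 0 < a)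
    (hx : x = A / (A + a) * y + a / (A + a) * z)
    (hy : y' = A / (A + a) * y + a / (A + a) * z')
    (hw : w = (κ - 1 + A) / (κ - 1 + (A + a)) * z + a / (κ - 1 + (A + a)) * (x - 1 / α * g))
    (hproj : (w - z') * (u - z') ≤ 0)
    (hwt : (κ - 1) * a ^ 2 ≤ (κ - 1 + A) * (A + a)) :
    (A + a) * (g * (y' - x) + κ * α / 2 * (y' - x) ^ 2)
      ≤ A * (g * (y - x) + α / 2 * (y - x) ^ 2) + a * (g * (u - x) + α / 2 * (u - x) ^ 2)
        + α * (κ - 1 + A) / 2 * (u - z) ^ 2 - α * (κ - 1 + (A + a)) / 2 * (u - z') ^ 2 := by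
  have hA' : 0 < A + a := by linarith
  have hB' : 0 < κ - 1 + (A + a) := by linarith
  -- optimality of `z'` in the proximal problem that defines the projection
  have hw' : (κ - 1 + (A + a)) * (w - z')
      = (κ - 1 + A) * (z - z') + a * (x - z') - a / α * g := by
    rw [hw]
    field_simp
    ring
  have h1 : α * ((κ - 1 + (A + a)) * (w - z')) * (u - z') ≤ 0 := by
    rw [mul_assoc, mul_assoc]
    exact mul_nonpos_of_nonneg_of_nonpos hα.le (mul_nonpos_of_nonneg_of_nonpos hB'.le hproj)
  rw [hw', mul_sub α, show α * (a / α * g) = a * g by field_simp] at h1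
  have hx' : (A + a) * x = A * y + a * z := by
    rw [hx]; field_simp
  have hy' : (A + a) * y' = A * y + a * z' := by
    rw [hy]; field_simp
  have hd : (A + a) * (y' - x) = a * (z' - z) := by linarith
  have hlin : (A + a) * (g * (y' - x)) = A * (g * (y - x)) + a * (g * (z' - x)) := by
    linear_combination g * hy'
  -- convexity of the square, for the strong convexity part of the smoothness term
  have hsq1 : (A + a) * (y' - x) ^ 2 ≤ A * (y - x) ^ 2 + a * (z' - x) ^ 2 := by
    have h2 : (A + a) * ((A + a) * (y' - x) ^ 2)
        ≤ (A + a) * (A * (y - x) ^ 2 + a * (z' - x) ^ 2) := by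
      have h3 : (A + a) * (y' - x) = A * (y - x) + a * (z' - x) := by linarith
      have h4 : (A + a) * ((A + a) * (y' - x) ^ 2) = (A * (y - x) + a * (z' - x)) ^ 2 := by
        rw [← h3]; ring
      rw [h4]
      have h5 : (A + a) * (A * (y - x) ^ 2 + a * (z' - x) ^ 2)
          = (A * (y - x) + a * (z' - x)) ^ 2 + A * a * (y - z') ^ 2 := by ring
      rw [h5]
      exact le_add_of_nonneg_right (by positivity)
    exact le_of_mul_le_mul_left h2 hA'
  -- the weights absorb the remaining part
  have hsq2 : (A + a) * ((κ - 1) * (y' - x) ^ 2) ≤ (κ - 1 + A) * (z' - z) ^ 2 := by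
    have h2 : (A + a) * ((A + a) * ((κ - 1) * (y' - x) ^ 2))
        ≤ (A + a) * ((κ - 1 + A) * (z' - z) ^ 2) := by
      have h4 : (A + a) * ((A + a) * ((κ - 1) * (y' - x) ^ 2))
          = (κ - 1) * a ^ 2 * (z' - z) ^ 2 := by
        rw [show (κ - 1) * a ^ 2 * (z' - z) ^ 2 = (κ - 1) * (a * (z' - z)) ^ 2 by ring, ← hd]
        ring
      rw [h4]
      calc (κ - 1) * a ^ 2 * (z' - z) ^ 2
          ≤ (κ - 1 + A) * (A + a) * (z' - z) ^ 2 := by gcongr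
        _ = _ := by ring
    exact le_of_mul_le_mul_left h2 hA'
  have h5 := mul_le_mul_of_nonneg_left hsq1 (show 0 ≤ α / 2 by linarith)
  have h6 := mul_le_mul_of_nonneg_left hsq2 (show 0 ≤ α / 2 by linarith)
  have h7 := congrArg (α / 2 * ·) (three_point_identity (κ - 1 + A) a x z z' u)
  rw [show κ - 1 + A + a = κ - 1 + (A + a) by ring] at h7
  linarith

/-- The potential `A (f(y) - f(u)) + α (κ - 1 + A) / 2 ‖u - z‖²` does not increase. -/
theorem IsBoundedMMatrix.potential_next_le {Q : Matrix (Fin n) (Fin n) ℝ} {α L : ℝ}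
    (h : IsBoundedMMatrix Q α L) (hκ : 1 ≤ L / α) (b : Fin n → ℝ) {S : Finset (Fin n)}
    {s : APGDState n} {u : Fin n → ℝ} (hu : 0 ≤ u) (huS : ∀ i, i ∉ S → u i = 0)
    (hA : 0 ≤ s.A) (ha : 0 < s.a) (hs : ∀ i, i ∉ S → s.y i = 0 ∧ s.z i = 0)
    (hwt : (L / α - 1) * s.a ^ 2 ≤ (L / α - 1 + s.A) * (s.A + s.a)) :
    (s.A + s.a) * (quadFun Q b (s.next Q b α L S).y - quadFun Q b u)
        + α * (L / α - 1 + (s.A + s.a)) / 2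
          * ((u - (s.next Q b α L S).z) ⬝ᵥ (u - (s.next Q b α L S).z))
      ≤ s.A * (quadFun Q b s.y - quadFun Q b u)
        + α * (L / α - 1 + s.A) / 2 * ((u - s.z) ⬝ᵥ (u - s.z)) := by
  set x := s.point with hx
  set g := quadGrad Q b x with hg
  set y' := (s.next Q b α L S).y with hy'
  set z' := (s.next Q b α L S).z with hz'
  have hL : L / α * α = L := div_mul_cancel₀ _ h.pos.ne'
  have hcoord : ∀ i, (s.A + s.a) * (g i * (y' i - x i) + L / α * α / 2 * (y' i - x i) ^ 2)
      ≤ s.A * (g i * (s.y i - x i) + α / 2 * (s.y i - x i) ^ 2)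
        + s.a * (g i * (u i - x i) + α / 2 * (u i - x i) ^ 2)
        + α * (L / α - 1 + s.A) / 2 * (u i - s.z i) ^ 2
        - α * (L / α - 1 + (s.A + s.a)) / 2 * (u i - z' i) ^ 2 := by
    intro i
    by_cases hi : i ∈ S
    · refine potential_coordinate (w := s.step Q b α L i) h.pos hκ hA ha rfl rfl rfl ?_ hwt
      have hz : z' i = max 0 (s.step Q b α L i) := by
        simp [hz', APGDState.next, projOn, hi]
      have h0 : 0 ≤ u i := hu i
      rw [hz]
      rcases le_total 0 (s.step Q b α L i) with hw | hw
      · rw [max_eq_right hw]; simp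
      · rw [max_eq_left hw]; nlinarith
    · have e1 : z' i = 0 := projOn_of_notMem _ hi
      have e2 : x i = 0 := by simp [hx, APGDState.point, hs i hi]
      have e3 : y' i = 0 := by
        simp [hy', APGDState.next, hs i hi, projOn_of_notMem _ hi]
      simp [e1, e2, e3, hs i hi, huS i hi]
  have hsum := Finset.sum_le_sum fun i (_ : i ∈ Finset.univ) => hcoord i
  simp only [Finset.sum_sub_distrib, Finset.sum_add_distrib, ← Finset.mul_sum] at hsum
  have e : ∀ v w : Fin n → ℝ, ∑ i, (v i - w i) ^ 2 = (v - w) ⬝ᵥ (v - w) := fun v w => by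
    simp [dotProduct, sq]
  have e' : ∀ v : Fin n → ℝ, ∑ i, g i * (v i - x i) = g ⬝ᵥ (v - x) := fun v => rfl
  simp only [e, e', hL] at hsum
  have h1 := mul_le_mul_of_nonneg_left (h.quadFun_le b x y') (show 0 ≤ s.A + s.a by linarith)
  have h2 := mul_le_mul_of_nonneg_left (h.quadFun_ge b x s.y) hA
  have h3 := mul_le_mul_of_nonneg_left (h.quadFun_ge b x u) ha.le
  rw [← hg] at h1 h2 h3
  linarith

/-- The convergence rate of the accelerated method. -/
theorem IsBoundedMMatrix.apgdIter_gap_le {Q : Matrix (Fin n) (Fin n) ℝ} {α L : ℝ}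
    (h : IsBoundedMMatrix Q α L) (hκ : 1 ≤ L / α) (b : Fin n → ℝ) {S : Finset (Fin n)}
    {x₀ u : Fin n → ℝ} (hx : ∀ i, i ∉ S → x₀ i = 0) (hu : 0 ≤ u)
    (huS : ∀ i, i ∉ S → u i = 0) (t : ℕ) :
    apgdRatio (L / α) ^ t
        * (quadFun Q b (apgdIter Q b α L S x₀ (t + 1)).y - quadFun Q b u)
      ≤ (L - α) / 2 * ((u - x₀) ⬝ᵥ (u - x₀)) := by
  have hL : α * (L / α) = L := mul_div_cancel₀ _ h.pos.ne'
  have key : ∀ t, (apgdIter Q b α L S x₀ t).A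
        * (quadFun Q b (apgdIter Q b α L S x₀ t).y - quadFun Q b u)
        + α * (L / α - 1 + (apgdIter Q b α L S x₀ t).A) / 2
          * ((u - (apgdIter Q b α L S x₀ t).z) ⬝ᵥ (u - (apgdIter Q b α L S x₀ t).z))
      ≤ (L - α) / 2 * ((u - x₀) ⬝ᵥ (u - x₀)) := by
    intro t
    induction t with
    | zero =>
      simp only [apgdIter]
      apply le_of_eq
      linear_combination (1 / 2 * ((u - x₀) ⬝ᵥ (u - x₀))) * hL
    | succ t ih =>
      have hw := apgdIter_weights_nonneg Q b hκ S x₀ t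
      exact (h.potential_next_le hκ b hu huS hw.1 hw.2
        (fun i hi => apgdIter_support Q b α L hx t hi)
        (apgdIter_weights_sq Q b hκ S x₀ t)).trans ih
  have h1 := key (t + 1)
  have hw := apgdIter_weights_nonneg Q b hκ S x₀ (t + 1)
  rw [(apgdIter_weights Q b α L S x₀ t).1] at h1 hw
  have h2 : 0 ≤ α * (L / α - 1 + apgdRatio (L / α) ^ t) / 2
      * ((u - (apgdIter Q b α L S x₀ (t + 1)).z)
        ⬝ᵥ (u - (apgdIter Q b α L S x₀ (t + 1)).z)) := by
    have := h.pos
    have := dotProduct_self_nonneg (u - (apgdIter Q b α L S x₀ (t + 1)).z)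
    have : 0 ≤ L / α - 1 + apgdRatio (L / α) ^ t := by linarith [hw.1]
    positivity
  linarith

end APGD

/-! ### The iterates of ASPR -/

section ASPRIterates

variable {n : ℕ}

theorem mem_negCoords {Q : Matrix (Fin n) (Fin n) ℝ} (hQ : Q.IsSymm) (b x : Fin n → ℝ)
    (i : Fin n) : i ∈ negCoords (quadObj Q b) (WithLp.toLp 2 x) ↔ quadGrad Q b x i < 0 := by
  simp [negCoords, gradient_quadObj hQ]

theorem one_le_asprIters (g : EVec n → ℝ) (α L ε : ℝ) (S : Finset (Fin n)) (x : EVec n) :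
    1 ≤ asprIters g α L ε S x := by
  have : (1 : ℤ) ≤ _ := le_max_left 1 (1 + ⌈2 * Real.sqrt (L / α) *
    Real.log ((L - α) * (∑ i ∈ S, (∇ g x i) ^ 2)
      / (2 * asprAccuracy α L ε S.card * α ^ 2))⌉)
  unfold asprIters
  omega

/-- The number of iterations as a real number, computed from the gradient of the quadratic
objective. -/
theorem cast_asprIters {Q : Matrix (Fin n) (Fin n) ℝ} (hQ : Q.IsSymm) (b : Fin n → ℝ)
    (α L ε : ℝ) (S : Finset (Fin n)) (x : Fin n → ℝ) :
    (asprIters (quadObj Q b) α L ε S (WithLp.toLp 2 x) : ℝ)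
      = max 1 (1 + (⌈2 * Real.sqrt (L / α) *
        Real.log ((L - α) * (∑ i ∈ S, quadGrad Q b x i ^ 2)
          / (2 * asprAccuracy α L ε S.card * α ^ 2))⌉ : ℝ)) := by
  have h : ∀ k : ℤ, ((max 1 (1 + k)).toNat : ℝ) = max 1 (1 + (k : ℝ)) := fun k => by
    have h1 : ((max 1 (1 + k)).toNat : ℤ) = max 1 (1 + k) :=
      Int.toNat_of_nonneg (zero_le_one.trans (le_max_left _ _))
    have h2 := congrArg (Int.cast : ℤ → ℝ) h1
    push_cast at h2
    exact h2
  rw [asprIters, h, gradient_quadObj hQ]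

theorem asprDelta_nonneg (α L ε : ℝ) (k : ℕ) : 0 ≤ asprDelta α L ε k :=
  Real.sqrt_nonneg _

theorem asprAccuracy_eq {α L ε : ℝ} (hα : 0 < α) (hε : 0 < ε) (k : ℕ) :
    asprAccuracy α L ε k = ε * α / ((1 + k) * L ^ 2) * α / 2 := by
  rw [asprAccuracy, asprDelta, Real.sq_sqrt (by positivity)]

theorem asprAccuracy_pos {α L ε : ℝ} (hα : 0 < α) (hL : 0 < L) (hε : 0 < ε) (k : ℕ) :
    0 < asprAccuracy α L ε k := by
  rw [asprAccuracy_eq hα hε]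
  positivity

/-- The result of the accelerated method, started at `x` on the known set `S`, with the number of
iterations chosen by ASPR. -/
noncomputable def asprSubproblem (Q : Matrix (Fin n) (Fin n) ℝ) (b : Fin n → ℝ) (α L ε : ℝ)
    (S : Finset (Fin n)) (x : Fin n → ℝ) : Fin n → ℝ :=
  (apgdIter Q b α L S x (asprIters (quadObj Q b) α L ε S (WithLp.toLp 2 x))).y

/-- The next iterate of ASPR: the approximate solution of the subproblem, retracted by `δ`. -/
noncomputable def asprNext (Q : Matrix (Fin n) (Fin n) ℝ) (b : Fin n → ℝ) (α L ε : ℝ)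
    (S : Finset (Fin n)) (x : Fin n → ℝ) : Fin n → ℝ := fun i =>
  max 0 (asprSubproblem Q b α L ε S x i - asprDelta α L ε S.card)

/-- The pairs of an iterate and a set of known good coordinates that ASPR produces. -/
noncomputable def asprSeq (Q : Matrix (Fin n) (Fin n) ℝ) (b : Fin n → ℝ) (α L ε : ℝ) :
    ℕ → (Fin n → ℝ) × Finset (Fin n)
  | 0 => (0, negCoords (quadObj Q b) (WithLp.toLp 2 0))
  | t + 1 =>
    (asprNext Q b α L ε (asprSeq Q b α L ε t).2 (asprSeq Q b α L ε t).1,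
      (asprSeq Q b α L ε t).2 ∪ negCoords (quadObj Q b)
        (WithLp.toLp 2 (asprNext Q b α L ε (asprSeq Q b α L ε t).2 (asprSeq Q b α L ε t).1)))

theorem asprSubproblem_of_notMem (Q : Matrix (Fin n) (Fin n) ℝ) (b : Fin n → ℝ) (α L ε : ℝ)
    {S : Finset (Fin n)} {x : Fin n → ℝ} (hx : ∀ i, i ∉ S → x i = 0) {i : Fin n} (hi : i ∉ S) :
    asprSubproblem Q b α L ε S x i = 0 :=
  (apgdIter_support Q b α L hx _ hi).1

theorem asprNext_of_notMem (Q : Matrix (Fin n) (Fin n) ℝ) (b : Fin n → ℝ) (α L ε : ℝ)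
    {S : Finset (Fin n)} {x : Fin n → ℝ} (hx : ∀ i, i ∉ S → x i = 0) {i : Fin n} (hi : i ∉ S) :
    asprNext Q b α L ε S x i = 0 := by
  simp [asprNext, asprSubproblem_of_notMem Q b α L ε hx hi, asprDelta_nonneg]

namespace IsBoundedMMatrix

variable {Q : Matrix (Fin n) (Fin n) ℝ} {α L ε : ℝ}

/-- The distance from a feasible point `x` to the solution `u` of the subproblem is controlled by
the gradient at `x` on the known coordinates. -/
theorem sq_dist_subproblemMin_le (h : IsBoundedMMatrix Q α L) {b : Fin n → ℝ}
    {S : Finset (Fin n)} {x u : Fin n → ℝ} (hu : IsSubproblemMin Q b S u) (hx0 : 0 ≤ x)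
    (hxS : ∀ i, i ∉ S → x i = 0) :
    α ^ 2 * ((u - x) ⬝ᵥ (u - x)) ≤ ∑ i ∈ S, quadGrad Q b x i ^ 2 := by
  have hα := h.pos
  have h1 := h.lower (x - u)
  have h2 : (x - u) ⬝ᵥ Q.mulVec (x - u)
      = quadGrad Q b x ⬝ᵥ (x - u) - quadGrad Q b u ⬝ᵥ (x - u) := by
    rw [dotProduct_comm, ← sub_dotProduct, Matrix.mulVec_sub]
    simp [quadGrad]
  have h3 := hu.grad_dotProduct_nonneg hx0 hxS
  have h4 : quadGrad Q b x ⬝ᵥ (x - u) = ∑ i ∈ S, quadGrad Q b x i * (x i - u i) := by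
    refine (Finset.sum_subset (Finset.subset_univ S) fun i _ hi => ?_).symm
    simp [hxS i hi, hu.support i hi]
  have h5 : (u - x) ⬝ᵥ (u - x) = (x - u) ⬝ᵥ (x - u) := by
    rw [← neg_sub x u, neg_dotProduct_neg]
  have h6 : ∑ i ∈ S, (x i - u i) ^ 2 ≤ (x - u) ⬝ᵥ (x - u) := by
    calc ∑ i ∈ S, (x i - u i) ^ 2 ≤ ∑ i, (x i - u i) ^ 2 :=
          Finset.sum_le_sum_of_subset_of_nonneg (Finset.subset_univ S) fun _ _ _ => sq_nonneg _
      _ = _ := by simp [dotProduct, sq]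
  have h7 : 2 * α * ∑ i ∈ S, quadGrad Q b x i * (x i - u i)
      ≤ ∑ i ∈ S, quadGrad Q b x i ^ 2 + α ^ 2 * ∑ i ∈ S, (x i - u i) ^ 2 := by
    rw [Finset.mul_sum, Finset.mul_sum, ← Finset.sum_add_distrib]
    exact Finset.sum_le_sum fun i _ => by
      nlinarith [sq_nonneg (quadGrad Q b x i - α * (x i - u i))]
  rw [h5]
  nlinarith

/-- The chosen number of iterations suffices for the distance `δ` to the solution of the
subproblem. -/
theorem sq_dist_asprSubproblem_le (h : IsBoundedMMatrix Q α L) (hε : 0 < ε) {b : Fin n → ℝ}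
    {S : Finset (Fin n)} {x u : Fin n → ℝ} (hS : S.Nonempty) (hu : IsSubproblemMin Q b S u)
    (hx0 : 0 ≤ x) (hxS : ∀ i, i ∉ S → x i = 0) :
    (asprSubproblem Q b α L ε S x - u) ⬝ᵥ (asprSubproblem Q b α L ε S x - u)
      ≤ asprDelta α L ε S.card ^ 2 := by
  obtain ⟨i₀, -⟩ := hS
  have hα := h.pos
  have hαL := h.le_of_index i₀
  have hκ : 1 ≤ L / α := (one_le_div hα).2 hαL
  have hacc : 0 < asprAccuracy α L ε S.card := asprAccuracy_pos hα (hα.trans_le hαL) hε _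
  obtain ⟨M, hM⟩ : ∃ M, asprIters (quadObj Q b) α L ε S (WithLp.toLp 2 x) = M + 1 :=
    Nat.exists_eq_add_of_le' (one_le_asprIters _ _ _ _ _ _)
  have hcast := cast_asprIters h.symm b α L ε S x
  have hdist := h.sq_dist_subproblemMin_le hu hx0 hxS
  have hgap := h.apgdIter_gap_le hκ b hxS hu.nonneg hu.support M
  rw [asprSubproblem, hM]
  rw [hM] at hcast
  set G := ∑ i ∈ S, quadGrad Q b x i ^ 2 with hG
  have hG0 : 0 ≤ G := Finset.sum_nonneg fun _ _ => sq_nonneg _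
  set y := (apgdIter Q b α L S x (M + 1)).y with hy
  set acc := asprAccuracy α L ε S.card with hacc_def
  set r := apgdRatio (L / α) with hr
  have hr1 : 1 < r := one_lt_apgdRatio hκ
  -- `r ^ M` dominates the argument of the logarithm
  have hpow : (L - α) * G / (2 * acc * α ^ 2) ≤ r ^ M := by
    -- if `L = α` or `G = 0`, then the logarithm is `log 0`, but the bound is trivial
    rcases le_or_gt ((L - α) * G / (2 * acc * α ^ 2)) 0 with h0 | h0
    · exact h0.trans (by positivity)
    have hsq : 0 < Real.sqrt (L / α) := Real.sqrt_pos.2 (by linarith)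
    have h1 : 2 * Real.sqrt (L / α) * Real.log ((L - α) * G / (2 * acc * α ^ 2)) ≤ M := by
      have h2 := Int.le_ceil (2 * Real.sqrt (L / α) *
        Real.log ((L - α) * G / (2 * acc * α ^ 2)))
      have h3 := le_max_right (1 : ℝ) (1 + (⌈2 * Real.sqrt (L / α) *
        Real.log ((L - α) * G / (2 * acc * α ^ 2))⌉ : ℝ))
      rw [← hcast] at h3
      push_cast at h3
      linarith
    have h4 : Real.log ((L - α) * G / (2 * acc * α ^ 2))
        ≤ M * (1 / (2 * Real.sqrt (L / α))) := by
      rw [mul_one_div, le_div_iff₀ (by positivity)]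
      linarith
    calc (L - α) * G / (2 * acc * α ^ 2)
        = Real.exp (Real.log ((L - α) * G / (2 * acc * α ^ 2))) := (Real.exp_log h0).symm
      _ ≤ Real.exp (M * (1 / (2 * Real.sqrt (L / α)))) := Real.exp_le_exp.2 h4
      _ = Real.exp (1 / (2 * Real.sqrt (L / α))) ^ M := Real.exp_nat_mul _ _
      _ ≤ r ^ M := by gcongr; exact exp_le_apgdRatio hκ
  rw [div_le_iff₀ (by positivity)] at hpow
  have hy0 : 0 ≤ y := fun i => by
    have hw := apgdIter_weights_nonneg Q b hκ S x
    have : ∀ t, 0 ≤ (apgdIter Q b α L S x t).y ∧ 0 ≤ (apgdIter Q b α L S x t).z := by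
      intro t
      induction t with
      | zero => exact ⟨hx0, hx0⟩
      | succ t ih =>
        refine ⟨fun j => ?_, projOn_nonneg _ _⟩
        have h1 := (hw t).1
        have h2 := (hw t).2
        have h3 := ih.1 j
        have h4 := projOn_nonneg S ((apgdIter Q b α L S x t).step Q b α L) j
        simp only [Pi.zero_apply] at h3 h4
        simp only [apgdIter, APGDState.next, Pi.zero_apply]
        positivity
    exact (this (M + 1)).1 i
  have hyS : ∀ i, i ∉ S → y i = 0 := fun i hi => (apgdIter_support Q b α L hxS _ hi).1
  have hvi := hu.grad_dotProduct_nonneg hy0 hyS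
  have hsc := h.quadFun_ge b u y
  have hrM : 0 < r ^ M := by positivity
  have h1 : r ^ M * (α / 2 * ((y - u) ⬝ᵥ (y - u))) ≤ r ^ M * acc := by
    have h2 : r ^ M * (α / 2 * ((y - u) ⬝ᵥ (y - u)))
        ≤ r ^ M * (quadFun Q b y - quadFun Q b u) := by
      gcongr
      linarith
    have h3 : α ^ 2 * ((L - α) / 2 * ((u - x) ⬝ᵥ (u - x))) ≤ α ^ 2 * (r ^ M * acc) := by
      nlinarith
    exact (h2.trans hgap).trans (le_of_mul_le_mul_left h3 (by positivity))
  have h2 := le_of_mul_le_mul_left h1 hrM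
  rw [hacc_def, asprAccuracy] at h2
  nlinarith

/-- Retraction keeps the iterate below the optimal point: the approximate solution is within
`δ` of the exact solution of the subproblem, which lies below `xs`. -/
theorem asprNext_le (h : IsBoundedMMatrix Q α L) (hε : 0 < ε) {b xs : Fin n → ℝ}
    (hxs : IsKKTPoint Q b xs) {S : Finset (Fin n)} (hS : ∀ i ∈ S, 0 < xs i) {x : Fin n → ℝ}
    (hx0 : 0 ≤ x) (hxS : ∀ i, i ∉ S → x i = 0) : asprNext Q b α L ε S x ≤ xs := by
  intro i
  by_cases hi : i ∈ S
  · obtain ⟨u, hu, huxs⟩ := h.exists_isSubproblemMin hxs hS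
    have h1 := h.sq_dist_asprSubproblem_le hε ⟨i, hi⟩ hu hx0 hxS
    have h2 : (asprSubproblem Q b α L ε S x i - u i) ^ 2 ≤ asprDelta α L ε S.card ^ 2 := by
      refine le_trans ?_ h1
      rw [sq]
      exact Finset.single_le_sum (f := fun j => (asprSubproblem Q b α L ε S x - u) j
        * (asprSubproblem Q b α L ε S x - u) j) (fun j _ => mul_self_nonneg _)
        (Finset.mem_univ i)
    have h3 := (abs_le_of_sq_le_sq' h2 (asprDelta_nonneg _ _ _ _)).2
    exact max_le (hxs.nonneg i) (by linarith [huxs i])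
  · rw [asprNext_of_notMem Q b α L ε hxS hi]
    exact hxs.nonneg i

/-- Below the optimal point `xs`, a negative partial derivative certifies a coordinate in the
support of `xs`. -/
theorem pos_of_quadGrad_neg (h : IsBoundedMMatrix Q α L) {b xs : Fin n → ℝ}
    (hxs : IsKKTPoint Q b xs) {x : Fin n → ℝ} (hx0 : 0 ≤ x) (hx : x ≤ xs) {i : Fin n}
    (hi : quadGrad Q b x i < 0) : 0 < xs i := by
  refine (hxs.nonneg i).lt_of_ne fun h0 => ?_
  have h0' : xs i = 0 := h0.symm
  have hxi : x i = xs i := le_antisymm (hx i) (by rw [h0']; exact hx0 i)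
  linarith [h.quadGrad_anti b hx hxi, hxs.grad_nonneg i]

theorem asprSeq_invariant (h : IsBoundedMMatrix Q α L) (hε : 0 < ε) {b xs : Fin n → ℝ}
    (hxs : IsKKTPoint Q b xs) (t : ℕ) :
    0 ≤ (asprSeq Q b α L ε t).1 ∧ (asprSeq Q b α L ε t).1 ≤ xs
      ∧ (∀ i, i ∉ (asprSeq Q b α L ε t).2 → (asprSeq Q b α L ε t).1 i = 0)
      ∧ ∀ i ∈ (asprSeq Q b α L ε t).2, 0 < xs i := by
  induction t with
  | zero =>
    refine ⟨le_rfl, hxs.nonneg, fun _ _ => rfl, fun i hi => ?_⟩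
    exact h.pos_of_quadGrad_neg hxs le_rfl hxs.nonneg ((mem_negCoords h.symm b 0 i).1 hi)
  | succ t ih =>
    obtain ⟨h0, -, hsupp, hS⟩ := ih
    have h0' : 0 ≤ (asprSeq Q b α L ε (t + 1)).1 := fun i => le_max_left _ _
    have hle : (asprSeq Q b α L ε (t + 1)).1 ≤ xs := h.asprNext_le hε hxs hS h0 hsupp
    refine ⟨h0', hle, fun i hi => ?_, fun i hi => ?_⟩
    · exact asprNext_of_notMem Q b α L ε hsupp fun hi' =>
        hi (Finset.mem_union_left _ hi')
    · rcases Finset.mem_union.1 hi with hi | hi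
      · exact hS i hi
      · exact h.pos_of_quadGrad_neg hxs h0' hle ((mem_negCoords h.symm b _ i).1 hi)

/-- On known coordinates the gradient at an iterate is that of `Q (x - xs)`, and so its norm is at
most `L ‖xs‖`. -/
theorem sum_sq_quadGrad_le (h : IsBoundedMMatrix Q α L) {b xs : Fin n → ℝ}
    (hxs : IsKKTPoint Q b xs) {S : Finset (Fin n)} (hS : ∀ i ∈ S, 0 < xs i) {x : Fin n → ℝ}
    (hx0 : 0 ≤ x) (hx : x ≤ xs) :
    ∑ i ∈ S, quadGrad Q b x i ^ 2 ≤ L ^ 2 * (xs ⬝ᵥ xs) := by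
  calc ∑ i ∈ S, quadGrad Q b x i ^ 2
      = ∑ i ∈ S, Q.mulVec (x - xs) i * Q.mulVec (x - xs) i := by
        refine Finset.sum_congr rfl fun i hi => ?_
        have h1 := hxs.grad_eq_zero i (hS i hi)
        simp only [quadGrad, Pi.sub_apply, Matrix.mulVec_sub] at h1 ⊢
        rw [sub_eq_zero.1 h1, sq]
    _ ≤ Q.mulVec (x - xs) ⬝ᵥ Q.mulVec (x - xs) :=
        Finset.sum_le_sum_of_subset_of_nonneg (Finset.subset_univ S)
          fun _ _ _ => mul_self_nonneg _
    _ ≤ L ^ 2 * ((x - xs) ⬝ᵥ (x - xs)) := h.mulVec_dotProduct_self_le _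
    _ ≤ L ^ 2 * (xs ⬝ᵥ xs) := by
        refine mul_le_mul_of_nonneg_left (Finset.sum_le_sum fun i _ => ?_) (sq_nonneg L)
        have h1 : 0 ≤ x i := hx0 i
        have h2 := hx i
        rw [Pi.sub_apply]
        nlinarith

/-- The number of iterations of the subroutine in every pass. -/
theorem cast_asprIters_le (h : IsBoundedMMatrix Q α L) (hε : 0 < ε) {b xs : Fin n → ℝ}
    (hxs : IsKKTPoint Q b xs) {S : Finset (Fin n)} (hSne : S.Nonempty)
    (hS : ∀ i ∈ S, 0 < xs i) {k : ℕ} (hk : S.card ≤ k) {x : Fin n → ℝ}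
    (hx0 : 0 ≤ x) (hx : x ≤ xs) :
    (asprIters (quadObj Q b) α L ε S (WithLp.toLp 2 x) : ℝ)
      ≤ 2 + 2 * Real.sqrt (L / α) *
        Real.log (2 + L ^ 4 * (1 + k) * (L - α) * (xs ⬝ᵥ xs) / (α ^ 4 * ε)) := by
  obtain ⟨i₀, -⟩ := hSne
  have hα := h.pos
  have hαL := h.le_of_index i₀
  have hL : 0 < L := hα.trans_le hαL
  have hk' : (S.card : ℝ) ≤ k := by exact_mod_cast hk
  have hG0 : 0 ≤ ∑ i ∈ S, quadGrad Q b x i ^ 2 := Finset.sum_nonneg fun _ _ => sq_nonneg _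
  have hG := h.sum_sq_quadGrad_le hxs hS hx0 hx
  rw [cast_asprIters h.symm, asprAccuracy_eq hα hε]
  set G := ∑ i ∈ S, quadGrad Q b x i ^ 2
  have harg : (L - α) * G / (2 * (ε * α / ((1 + (S.card : ℝ)) * L ^ 2) * α / 2) * α ^ 2)
      = L ^ 2 * (1 + S.card) * (L - α) * G / (α ^ 4 * ε) := by
    field_simp
  rw [harg]
  have h0 : 0 ≤ L - α := by linarith
  have hle : L ^ 2 * (1 + S.card) * (L - α) * G / (α ^ 4 * ε)
      ≤ L ^ 4 * (1 + k) * (L - α) * (xs ⬝ᵥ xs) / (α ^ 4 * ε) := by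
    have : L ^ 4 * (1 + k) * (L - α) * (xs ⬝ᵥ xs)
        = L ^ 2 * (1 + k) * (L - α) * (L ^ 2 * (xs ⬝ᵥ xs)) := by ring
    rw [this]
    gcongr
  have h1 : 0 ≤ L ^ 2 * (1 + S.card) * (L - α) * G / (α ^ 4 * ε) := by positivity
  set X := L ^ 4 * (1 + k) * (L - α) * (xs ⬝ᵥ xs) / (α ^ 4 * ε)
  set Y := L ^ 2 * (1 + S.card) * (L - α) * G / (α ^ 4 * ε)
  have hlog0 : 0 ≤ Real.log (2 + X) := Real.log_nonneg (by linarith)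
  have hlog : Real.log Y ≤ Real.log (2 + X) := by
    rcases h1.eq_or_lt with h2 | h2
    · rw [← h2, Real.log_zero]; exact hlog0
    · exact Real.log_le_log h2 (by linarith)
  have h2 : 2 * Real.sqrt (L / α) * Real.log Y
      ≤ 2 * Real.sqrt (L / α) * Real.log (2 + X) := by gcongr
  have h3 : 0 ≤ 2 * Real.sqrt (L / α) * Real.log (2 + X) := by positivity
  refine max_le (by linarith) ?_
  linarith [(Int.ceil_lt_add_one (2 * Real.sqrt (L / α) * Real.log Y)).le]

end IsBoundedMMatrix

theorem prevSet_asprSeq_subset (Q : Matrix (Fin n) (Fin n) ℝ) (b : Fin n → ℝ) (α L ε : ℝ)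
    (t : ℕ) : prevSet (fun t => (asprSeq Q b α L ε t).2) t ⊆ (asprSeq Q b α L ε t).2 := by
  cases t with
  | zero => exact Finset.empty_subset _
  | succ t => exact Finset.subset_union_left

/-- The known sets grow until ASPR stops, which happens after at most `|supp xs|` passes. -/
theorem IsBoundedMMatrix.exists_isASPRRun {Q : Matrix (Fin n) (Fin n) ℝ} {α L ε : ℝ}
    (h : IsBoundedMMatrix Q α L) (hε : 0 < ε) {b xs : Fin n → ℝ} (hxs : IsKKTPoint Q b xs)
    {U : Finset (Fin n)} (hU : ∀ i, 0 < xs i → i ∈ U) :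
    ∃ T ≤ U.card, IsASPRRun (quadObj Q b) α L ε T
      (fun t => WithLp.toLp 2 (asprSeq Q b α L ε t).1) fun t => (asprSeq Q b α L ε t).2 := by
  classical
  set S : ℕ → Finset (Fin n) := fun t => (asprSeq Q b α L ε t).2 with hS
  have hgrow : ∀ t, (∀ s ≤ t, S s ≠ prevSet S s) → t + 1 ≤ (S t).card := by
    intro t
    induction t with
    | zero =>
      intro hne
      have h0 : S 0 ≠ ∅ := hne 0 le_rfl
      exact Finset.card_pos.2 (Finset.nonempty_iff_ne_empty.2 h0)
    | succ t ih =>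
      intro hne
      have h1 := ih fun s hs => hne s (by omega)
      have h2 : S t ⊂ S (t + 1) :=
        (prevSet_asprSeq_subset Q b α L ε (t + 1)).ssubset_of_ne (hne (t + 1) le_rfl).symm
      have h3 := Finset.card_lt_card h2
      omega
  have hex : ∃ T ≤ U.card, S T = prevSet S T := by
    by_contra! hne
    have h1 := hgrow U.card hne
    have h2 := Finset.card_le_card
      (fun i hi => hU i ((h.asprSeq_invariant hε hxs U.card).2.2.2 i hi) : S U.card ⊆ U)
    omega
  have hex' : ∃ T, S T = prevSet S T := hex.imp fun _ hT => hT.2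
  obtain ⟨T₀, hT₀, hT₀'⟩ := hex
  refine ⟨Nat.find hex', (Nat.find_min' hex' hT₀').trans hT₀, ?_⟩
  exact
    { x_zero := rfl
      S_zero := rfl
      continues := fun t ht => Nat.find_min hex' ht
      x_step := fun t _ => ⟨WithLp.toLp 2 (asprSubproblem Q b α L ε (S t)
          (asprSeq Q b α L ε t).1), isAPGDOutput_apgdIter h.symm b α L _ _ _, fun i => rfl⟩
      S_step := fun t _ => rfl
      stops := Nat.find_spec hex' }

end ASPRIterates

/-! ### A program logic with time and space bounds -/

section ProgramLogic

variable {n : ℕ} {Q : Matrix (Fin n) (Fin n) ℝ} {b : Fin n → ℝ}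

/-- Started in memory `σ`, the command `c` halts within time `T` and space `M` in a memory that
satisfies `R`. -/
def Runs (Q : Matrix (Fin n) (Fin n) ℝ) (b : Fin n → ℝ) (c : Cmd n) (σ : Mem n) (T M : ℕ)
    (R : Mem n → Prop) : Prop :=
  ∃ σ' t m, Exec Q b c σ σ' t m ∧ t ≤ T ∧ m ≤ M ∧ R σ'

/-- All vectors and index sets in memory are confined to `U`. -/
structure Mem.Fits (U : Finset (Fin n)) (σ : Mem n) : Prop where
  dom : ∀ v, σ.dom v ⊆ U
  set : ∀ s, σ.set s ⊆ U

/-- The number of memory cells that suffice for vectors and index sets confined to `U`: twelve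
registers, four vectors and two index sets. -/
def spaceBound (U : Finset (Fin n)) : ℕ := 12 + 6 * U.card

theorem Mem.Fits.space_le {U : Finset (Fin n)} {σ : Mem n} (h : σ.Fits U) :
    σ.space ≤ spaceBound U := by
  have h1 : ∑ v, (σ.dom v).card ≤ ∑ _v : VecName, U.card :=
    Finset.sum_le_sum fun v _ => Finset.card_le_card (h.dom v)
  have h2 : ∑ s, (σ.set s).card ≤ ∑ _s : SetName, U.card :=
    Finset.sum_le_sum fun s _ => Finset.card_le_card (h.set s)
  rw [Finset.sum_const, Finset.card_univ, smul_eq_mul] at h1 h2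
  have e1 : Fintype.card Reg = 12 := rfl
  have e2 : Fintype.card VecName = 4 := rfl
  have e3 : Fintype.card SetName = 2 := rfl
  rw [e2] at h1
  rw [e3] at h2
  unfold Mem.space spaceBound
  omega

@[simp] theorem Mem.setReg_reg (σ : Mem n) (r r' : Reg) (c : ℝ) :
    (σ.setReg r c).reg r' = if r' = r then c else σ.reg r' := Function.update_apply _ _ _ _

@[simp] theorem Mem.setReg_vec (σ : Mem n) (r : Reg) (c : ℝ) : (σ.setReg r c).vec = σ.vec := rfl

@[simp] theorem Mem.setReg_set (σ : Mem n) (r : Reg) (c : ℝ) : (σ.setReg r c).set = σ.set := rfl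

@[simp] theorem Mem.setVec_reg (σ : Mem n) (v : VecName) (i : Fin n) (c : ℝ) :
    (σ.setVec v i c).reg = σ.reg := rfl

@[simp] theorem Mem.setVec_vec (σ : Mem n) (v v' : VecName) (i : Fin n) (c : ℝ) :
    (σ.setVec v i c).vec v' = if v' = v then Function.update (σ.vec v) i c else σ.vec v' :=
  Function.update_apply _ _ _ _

@[simp] theorem Mem.setSet_set (σ : Mem n) (s s' : SetName) (V : Finset (Fin n)) :
    (σ.setSet s V).set s' = if s' = s then V else σ.set s' := Function.update_apply _ _ _ _

@[simp] theorem Mem.setReg_setReg (σ : Mem n) (r : Reg) (c c' : ℝ) :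
    (σ.setReg r c).setReg r c' = σ.setReg r c' := by
  simp [Mem.setReg]

theorem Mem.setReg_comm (σ : Mem n) {r r' : Reg} (h : r ≠ r') (c c' : ℝ) :
    (σ.setReg r c).setReg r' c' = (σ.setReg r' c').setReg r c := by
  simp [Mem.setReg, Function.update_comm h]

@[simp] theorem Mem.setSet_setSet (σ : Mem n) (s : SetName) (V V' : Finset (Fin n)) :
    (σ.setSet s V).setSet s V' = σ.setSet s V' := by
  simp [Mem.setSet]

theorem Mem.setSet_self (σ : Mem n) (s : SetName) : σ.setSet s (σ.set s) = σ := by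
  simp [Mem.setSet]

theorem Mem.Fits.setReg {U : Finset (Fin n)} {σ : Mem n} (h : σ.Fits U) (r : Reg) (c : ℝ) :
    (σ.setReg r c).Fits U := ⟨h.dom, h.set⟩

theorem Mem.Fits.setVec {U : Finset (Fin n)} {σ : Mem n} (h : σ.Fits U) (v : VecName)
    {i : Fin n} (hi : i ∈ U) (c : ℝ) : (σ.setVec v i c).Fits U := by
  refine ⟨fun w => ?_, h.set⟩
  by_cases hw : w = v
  · subst hw
    simpa [Mem.setVec] using Finset.insert_subset hi (h.dom w)
  · simpa [Mem.setVec, hw] using h.dom w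

theorem Mem.Fits.setSet {U : Finset (Fin n)} {σ : Mem n} (h : σ.Fits U) (s : SetName)
    {V : Finset (Fin n)} (hV : V ⊆ U) : (σ.setSet s V).Fits U := by
  refine ⟨h.dom, fun s' => ?_⟩
  rw [Mem.setSet_set]
  split_ifs
  · exact hV
  · exact h.set s'

namespace Runs

theorem mono {c : Cmd n} {σ : Mem n} {T T' M M' : ℕ} {R R' : Mem n → Prop}
    (h : Runs Q b c σ T M R) (hT : T ≤ T') (hM : M ≤ M') (hR : ∀ τ, R τ → R' τ) :
    Runs Q b c σ T' M' R' := by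
  obtain ⟨σ', t, m, he, ht, hm, hr⟩ := h
  exact ⟨σ', t, m, he, ht.trans hT, hm.trans hM, hR _ hr⟩

theorem seq {c₁ c₂ : Cmd n} {σ : Mem n} {T₁ T₂ M : ℕ} {R R' : Mem n → Prop}
    (h₁ : Runs Q b c₁ σ T₁ M R') (h₂ : ∀ τ, R' τ → Runs Q b c₂ τ T₂ M R) :
    Runs Q b (c₁ ;; c₂) σ (T₁ + T₂) M R := by
  obtain ⟨σ₁, t₁, m₁, he₁, ht₁, hm₁, hr₁⟩ := h₁
  obtain ⟨σ₂, t₂, m₂, he₂, ht₂, hm₂, hr₂⟩ := h₂ σ₁ hr₁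
  exact ⟨σ₂, _, _, .seq he₁ he₂, by omega, max_le hm₁ hm₂, hr₂⟩

theorem assign {U : Finset (Fin n)} {σ : Mem n} (hσ : σ.Fits U) (r : Reg) (e : Expr n) {M : ℕ}
    (hM : spaceBound U ≤ M) {R : Mem n → Prop} (hR : R (σ.setReg r (e.eval Q b σ))) :
    Runs Q b (r ≔ e) σ (e.steps + 1) M R :=
  ⟨_, _, _, .assign r e σ, le_rfl,
    max_le (hσ.space_le.trans hM) ((hσ.setReg r _).space_le.trans hM), hR⟩

theorem store {U : Finset (Fin n)} {σ : Mem n} (hσ : σ.Fits U) (v : VecName) {i : Fin n}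
    (hi : i ∈ U) (e : Expr n) {M : ℕ} (hM : spaceBound U ≤ M) {R : Mem n → Prop}
    (hR : R (σ.setVec v i (e.eval Q b σ))) :
    Runs Q b (.store v i e) σ (e.steps + 1) M R :=
  ⟨_, _, _, .store v i e σ, le_rfl,
    max_le (hσ.space_le.trans hM) ((hσ.setVec v hi _).space_le.trans hM), hR⟩

theorem insert {U : Finset (Fin n)} {σ : Mem n} (hσ : σ.Fits U) (s : SetName) {i : Fin n}
    (hi : i ∈ U) {M : ℕ} (hM : spaceBound U ≤ M) {R : Mem n → Prop}
    (hR : R (σ.setSet s (Insert.insert i (σ.set s)))) :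
    Runs Q b (.insert s i) σ 1 M R :=
  ⟨_, _, _, .insert s i σ, le_rfl, max_le (hσ.space_le.trans hM)
    ((hσ.setSet s (Finset.insert_subset hi (hσ.set s))).space_le.trans hM), hR⟩

theorem clear {U : Finset (Fin n)} {σ : Mem n} (hσ : σ.Fits U) (s : SetName) {M : ℕ}
    (hM : spaceBound U ≤ M) {R : Mem n → Prop} (hR : R (σ.setSet s ∅)) :
    Runs Q b (.clear s) σ (U.card + 1) M R :=
  ⟨_, _, _, .clear s σ, by have := Finset.card_le_card (hσ.set s); omega,
    max_le (hσ.space_le.trans hM)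
      ((hσ.setSet s (Finset.empty_subset U)).space_le.trans hM), hR⟩

theorem ifNeg {e : Expr n} {c : Cmd n} {σ : Mem n} {T M : ℕ} {R : Mem n → Prop}
    (h₁ : e.eval Q b σ < 0 → Runs Q b c σ T M R) (h₂ : ¬ e.eval Q b σ < 0 → R σ)
    (hσ : σ.space ≤ M) : Runs Q b (.ifNeg e c) σ (e.steps + 1 + T) M R := by
  by_cases h : e.eval Q b σ < 0
  · obtain ⟨σ', t, m, he, ht, hm, hr⟩ := h₁ h
    exact ⟨σ', _, _, .ifNeg_true h he, by omega, hm, hr⟩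
  · exact ⟨σ, _, _, .ifNeg_false h, by omega, hσ, h₂ h⟩

theorem ifNotMem {i : Fin n} {s : SetName} {c : Cmd n} {σ : Mem n} {T M : ℕ}
    {R : Mem n → Prop} (h₁ : i ∉ σ.set s → Runs Q b c σ T M R) (h₂ : i ∈ σ.set s → R σ)
    (hσ : σ.space ≤ M) : Runs Q b (.ifNotMem i s c) σ (1 + T) M R := by
  by_cases h : i ∈ σ.set s
  · exact ⟨σ, _, _, .ifNotMem_false h, by omega, hσ, h₂ h⟩
  · obtain ⟨σ', t, m, he, ht, hm, hr⟩ := h₁ h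
    exact ⟨σ', _, _, .ifNotMem_true h he, by omega, hm, hr⟩

/-- A loop that makes exactly `N` passes; `I k` is the invariant after `k` passes. -/
theorem whilePos {e : Expr n} {c : Cmd n} {T M : ℕ} (N : ℕ) (I : ℕ → Mem n → Prop)
    (hpos : ∀ k < N, ∀ τ, I k τ → 0 < e.eval Q b τ)
    (hstep : ∀ k < N, ∀ τ, I k τ → Runs Q b c τ T M (I (k + 1)))
    (hend : ∀ τ, I N τ → ¬ 0 < e.eval Q b τ ∧ τ.space ≤ M) {σ : Mem n} (h0 : I 0 σ) :
    Runs Q b (.whilePos e c) σ (N * (e.steps + 1 + T) + (e.steps + 1)) M (I N) := by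
  suffices H : ∀ d k, k + d = N → ∀ τ, I k τ →
      Runs Q b (.whilePos e c) τ (d * (e.steps + 1 + T) + (e.steps + 1)) M (I N) from
    H N 0 (Nat.zero_add N) σ h0
  intro d
  induction d with
  | zero =>
    intro k hk τ hτ
    obtain rfl : k = N := by omega
    exact ⟨τ, _, _, .while_false (hend τ hτ).1, by omega, (hend τ hτ).2, hτ⟩
  | succ d ih =>
    intro k hk τ hτ
    obtain ⟨σ₁, t₁, m₁, he₁, ht₁, hm₁, hr₁⟩ := hstep k (by omega) τ hτ
    obtain ⟨σ₂, t₂, m₂, he₂, ht₂, hm₂, hr₂⟩ := ih (k + 1) (by omega) σ₁ hr₁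
    refine ⟨σ₂, _, _, .while_true (hpos k (by omega) τ hτ) he₁ he₂, ?_, max_le hm₁ hm₂, hr₂⟩
    rw [Nat.succ_mul]
    omega

theorem forList {c : Fin n → Cmd n} {M : ℕ} (I : Finset (Fin n) → Mem n → Prop)
    (τ : Fin n → ℕ) (hsp : ∀ P σ, I P σ → σ.space ≤ M) (l : List (Fin n)) :
    ∀ P : Finset (Fin n), l.Nodup → (∀ i ∈ l, i ∉ P) →
      (∀ P, ∀ i ∈ l, i ∉ P → ∀ σ, I P σ → Runs Q b (c i) σ (τ i) M (I (Insert.insert i P))) →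
      ∀ σ, I P σ →
      Runs Q b (.forList l c) σ (l.map fun i => τ i + 1).sum M (I (P ∪ l.toFinset)) := by
  induction l with
  | nil =>
    intro P _ _ _ σ hσ
    exact ⟨σ, _, _, .forList_nil, by simp, hsp P σ hσ, by simpa using hσ⟩
  | cons i l ih =>
    intro P hnd hP hstep σ hσ
    obtain ⟨hil, hnd'⟩ := List.nodup_cons.1 hnd
    obtain ⟨σ₁, t₁, m₁, he₁, ht₁, hm₁, hr₁⟩ :=
      hstep P i List.mem_cons_self (hP i List.mem_cons_self) σ hσ
    obtain ⟨σ₂, t₂, m₂, he₂, ht₂, hm₂, hr₂⟩ := ih (Insert.insert i P) hnd'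
      (fun j hj hjP => by
        rcases Finset.mem_insert.1 hjP with rfl | hjP
        · exact hil hj
        · exact hP j (List.mem_cons_of_mem _ hj) hjP)
      (fun P' j hj => hstep P' j (List.mem_cons_of_mem _ hj)) σ₁ hr₁
    refine ⟨σ₂, _, _, .forList_cons he₁ he₂, ?_, max_le hm₁ hm₂, ?_⟩
    · simp only [List.map_cons, List.sum_cons]
      omega
    · rwa [List.toFinset_cons, Finset.union_insert, ← Finset.insert_union]

/-- An enumeration loop; `I P` is the invariant when the elements of `P` have been processed, and
`τ i` bounds the time spent on the element `i`. -/
theorem forEach {it : Iter n} {c : Fin n → Cmd n} {M : ℕ} {σ : Mem n}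
    (I : Finset (Fin n) → Mem n → Prop) (τ : Fin n → ℕ) (h0 : I ∅ σ)
    (hsp : ∀ P σ, I P σ → σ.space ≤ M)
    (hstep : ∀ P, ∀ i ∈ it.toFinset Q b σ, i ∉ P → ∀ σ', I P σ' →
      Runs Q b (c i) σ' (τ i) M (I (Insert.insert i P))) :
    Runs Q b (.forEach it c) σ (∑ i ∈ it.toFinset Q b σ, (τ i + 1) + 1) (M + 1)
      (I (it.toFinset Q b σ)) := by
  obtain ⟨σ', t, m, he, ht, hm, hr⟩ := forList (Q := Q) (b := b) (c := c) I τ hsp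
    ((it.toFinset Q b σ).sort (· ≤ ·)) ∅ (Finset.sort_nodup _ _) (fun _ _ => Finset.notMem_empty _)
    (fun P i hi => hstep P i ((Finset.mem_sort _).1 hi)) σ h0
  refine ⟨σ', _, _, .forEach he, ?_, by omega, ?_⟩
  · rw [← List.sum_toFinset _ (Finset.sort_nodup _ _), Finset.sort_toFinset] at ht
    omega
  · rwa [Finset.empty_union, Finset.sort_toFinset] at hr

end Runs

namespace Expr

@[simp] theorem eval_add (σ : Mem n) (e₁ e₂ : Expr n) :
    (e₁ + e₂).eval Q b σ = e₁.eval Q b σ + e₂.eval Q b σ := rfl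

@[simp] theorem eval_sub (σ : Mem n) (e₁ e₂ : Expr n) :
    (e₁ - e₂).eval Q b σ = e₁.eval Q b σ - e₂.eval Q b σ := rfl

@[simp] theorem eval_mul (σ : Mem n) (e₁ e₂ : Expr n) :
    (e₁ * e₂).eval Q b σ = e₁.eval Q b σ * e₂.eval Q b σ := rfl

@[simp] theorem eval_div (σ : Mem n) (e₁ e₂ : Expr n) :
    (e₁ / e₂).eval Q b σ = e₁.eval Q b σ / e₂.eval Q b σ := rfl

end Expr

/-! ### Correctness and cost of the parts of the program -/

/-- The number of nonzero entries of row `i` in the columns of `S`. -/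
noncomputable def rowNnz (Q : Matrix (Fin n) (Fin n) ℝ) (S : Finset (Fin n)) (i : Fin n) : ℕ :=
  (S.filter fun j => Q i j ≠ 0).card

theorem sum_rowNnz (Q : Matrix (Fin n) (Fin n) ℝ) (S V : Finset (Fin n)) :
    ∑ i ∈ V, rowNnz Q S i = ((V ×ˢ S).filter fun p => Q p.1 p.2 ≠ 0).card := by
  simp only [rowNnz, Finset.card_filter]
  rw [Finset.sum_product]

theorem sum_rowNnz_eq_matIntVol (Q : Matrix (Fin n) (Fin n) ℝ) (S : Finset (Fin n)) :
    ∑ i ∈ S, rowNnz Q S i = matIntVol Q S := sum_rowNnz Q S S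

theorem matIntVol_mono (Q : Matrix (Fin n) (Fin n) ℝ) {S U : Finset (Fin n)} (h : S ⊆ U) :
    matIntVol Q S ≤ matIntVol Q U :=
  Finset.card_le_card (Finset.filter_subset_filter _ (Finset.product_subset_product h h))

theorem matVol_mono (Q : Matrix (Fin n) (Fin n) ℝ) {S U : Finset (Fin n)} (h : S ⊆ U) :
    matVol Q S ≤ matVol Q U :=
  Finset.card_le_card
    (Finset.filter_subset_filter _ (Finset.product_subset_product_right h))

theorem matIntVol_le_matVol (Q : Matrix (Fin n) (Fin n) ℝ) (S : Finset (Fin n)) :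
    matIntVol Q S ≤ matVol Q S :=
  Finset.card_le_card (Finset.filter_subset_filter _
    (Finset.product_subset_product_left (Finset.subset_univ S)))

theorem card_le_matIntVol (hdiag : ∀ i, Q i i ≠ 0) (S : Finset (Fin n)) :
    S.card ≤ matIntVol Q S := by
  rw [← sum_rowNnz_eq_matIntVol, Finset.card_eq_sum_ones]
  refine Finset.sum_le_sum fun i hi => Finset.card_pos.2 ⟨i, ?_⟩
  simp [hi, hdiag i]

open Expr in
theorem runs_computeGrad {U : Finset (Fin n)} {σ : Mem n} (hσ : σ.Fits U) (v : VecName)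
    (hv : ∀ j, j ∉ σ.set .known → σ.vec v j = 0) (i : Fin n) :
    Runs Q b (ASPR.computeGrad v i) σ (7 * rowNnz Q (σ.set .known) i + 5) (spaceBound U + 1)
      fun τ => τ = σ.setReg .grad (quadGrad Q b (σ.vec v) i) := by
  have h1 : Runs Q b (Reg.grad ≔ nat 0 - rhs i) σ 4 (spaceBound U + 1)
      fun τ => τ = σ.setReg .grad (-b i) :=
    Runs.assign hσ _ _ (by omega) (by simp [eval])
  refine (h1.seq (R := fun τ => τ = σ.setReg .grad (quadGrad Q b (σ.vec v) i))
    (T₂ := 7 * rowNnz Q (σ.set .known) i + 1) fun τ hτ => ?_).mono (by omega) le_rfl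
      fun _ h => h
  subst hτ
  refine (Runs.forEach (M := spaceBound U)
    (fun P τ => τ = σ.setReg .grad (∑ j ∈ P, Q i j * σ.vec v j - b i)) (fun _ => 6)
    (by simp) (fun P τ hτ => hτ ▸ (hσ.setReg _ _).space_le)
    fun P j _ hjP τ hτ => ?_).mono ?_ le_rfl fun τ hτ => ?_
  · subst hτ
    refine Runs.assign (hσ.setReg _ _) _ _ le_rfl ?_
    rw [Mem.setReg_setReg, Finset.sum_insert hjP]
    congr 1
    simp [eval]
    ring
  · rw [Finset.sum_const, smul_eq_mul]
    simp only [Iter.toFinset, Mem.setReg_set, rowNnz]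
    omega
  · subst hτ
    rw [quadGrad_apply]
    congr 2
    refine Finset.sum_subset (Finset.subset_univ _) fun j _ hj => ?_
    simp only [Iter.toFinset, Mem.setReg_set, Finset.mem_filter, not_and, not_not] at hj
    by_cases hjk : j ∈ σ.set .known
    · rw [hj hjk, zero_mul]
    · rw [hv j hjk, mul_zero]

/-- The part of the memory on which the passes of the main loop rely: the parameters, the index
sets `K` (known) and `F` (fresh), and the iterate `x`. All vectors vanish outside `K`. -/
structure MemInv (U : Finset (Fin n)) (α L ε : ℝ) (K F : Finset (Fin n)) (x : Fin n → ℝ)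
    (σ : Mem n) : Prop where
  fits : σ.Fits U
  alpha : σ.reg .alpha = α
  lip : σ.reg .lip = L
  eps : σ.reg .eps = ε
  known : σ.set .known = K
  fresh : σ.set .fresh = F
  x_eq : σ.vec .x = x
  off : ∀ v i, i ∉ K → σ.vec v i = 0

variable {U K F : Finset (Fin n)} {α L ε : ℝ} {x : Fin n → ℝ}

theorem MemInv.known_subset {σ : Mem n} (h : MemInv U α L ε K F x σ) : K ⊆ U :=
  h.known ▸ h.fits.set .known

theorem MemInv.setReg {σ : Mem n} (h : MemInv U α L ε K F x σ) {r : Reg} (h1 : r ≠ .alpha)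
    (h2 : r ≠ .lip) (h3 : r ≠ .eps) (c : ℝ) : MemInv U α L ε K F x (σ.setReg r c) where
  fits := h.fits.setReg r c
  alpha := by simpa [h1.symm] using h.alpha
  lip := by simpa [h2.symm] using h.lip
  eps := by simpa [h3.symm] using h.eps
  known := h.known
  fresh := h.fresh
  x_eq := h.x_eq
  off := h.off

theorem MemInv.setVec {σ : Mem n} (h : MemInv U α L ε K F x σ) {v : VecName} (hv : v ≠ .x)
    {i : Fin n} (hi : i ∈ K) (c : ℝ) : MemInv U α L ε K F x (σ.setVec v i c) where
  fits := h.fits.setVec v (h.known_subset hi) c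
  alpha := h.alpha
  lip := h.lip
  eps := h.eps
  known := h.known
  fresh := h.fresh
  x_eq := by simpa [hv.symm] using h.x_eq
  off := fun w j hj => by
    have hji : j ≠ i := fun e => hj (e ▸ hi)
    by_cases hw : w = v
    · subst hw
      simpa [hji] using h.off w j hj
    · simpa [hw] using h.off w j hj

open Expr in
theorem runs_computeNorm {σ : Mem n} (hσ : MemInv U α L ε K F x σ) :
    Runs Q b (ASPR.computeNorm n) σ (7 * matIntVol Q K + 12 * K.card + 3) (spaceBound U + 2)
      fun τ => ∃ g, τ = (σ.setReg .nrm (∑ i ∈ K, quadGrad Q b x i ^ 2)).setReg .grad g := by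
  have h1 : Runs Q b (Reg.nrm ≔ nat 0) σ 2 (spaceBound U + 2) fun τ => τ = σ.setReg .nrm 0 :=
    Runs.assign hσ.fits _ _ (by omega) (by simp [eval])
  refine (h1.seq (R := fun τ => ∃ g, τ
      = (σ.setReg .nrm (∑ i ∈ K, quadGrad Q b x i ^ 2)).setReg .grad g)
    (T₂ := 7 * matIntVol Q K + 12 * K.card + 1) fun τ hτ => ?_).mono (by omega) le_rfl
      fun _ h => h
  subst hτ
  refine (Runs.forEach (M := spaceBound U + 1)
    (fun P τ => ∃ g, τ = (σ.setReg .nrm (∑ i ∈ P, quadGrad Q b x i ^ 2)).setReg .grad g)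
    (fun i => 7 * rowNnz Q K i + 5 + 6) ?_ (fun P τ ⟨g, hτ⟩ => ?_)
    fun P i _ hiP τ ⟨g, hτ⟩ => ?_).mono ?_ le_rfl fun τ hτ => ?_
  · refine ⟨σ.reg .grad, ?_⟩
    rw [Finset.sum_empty, Mem.setReg_comm _ (by decide)]
    congr 1
    simp [Mem.setReg]
  · rw [hτ]
    exact ((hσ.fits.setReg _ _).setReg _ _).space_le.trans (by omega)
  · subst hτ
    have hfit := (hσ.fits.setReg .nrm (∑ i ∈ P, quadGrad Q b x i ^ 2)).setReg .grad g
    have h2 := runs_computeGrad (Q := Q) (b := b) hfit .x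
      (by simpa [hσ.known] using hσ.off .x) i
    simp only [Mem.setReg_set, Mem.setReg_vec, hσ.known, hσ.x_eq, Mem.setReg_setReg] at h2
    refine h2.seq fun τ hτ => ?_
    subst hτ
    refine Runs.assign ((hσ.fits.setReg _ _).setReg _ _) _ _ (by omega)
      ⟨quadGrad Q b x i, ?_⟩
    rw [Mem.setReg_comm _ (by decide), Mem.setReg_setReg, Finset.sum_insert hiP]
    congr 2
    simp [eval]
    ring
  · simp only [Iter.toFinset, Mem.setReg_set, hσ.known]
    rw [Finset.sum_add_distrib, Finset.sum_add_distrib, Finset.sum_add_distrib, ← Finset.mul_sum,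
      sum_rowNnz_eq_matIntVol]
    simp only [Finset.sum_const, smul_eq_mul]
    omega
  · simpa only [Iter.toFinset, Mem.setReg_set, hσ.known] using hτ

open Expr in
theorem runs_setParameters (hQ : Q.IsSymm) {σ : Mem n} (hσ : MemInv U α L ε K F x σ) :
    Runs Q b (ASPR.setParameters n) σ (7 * matIntVol Q K + 12 * K.card + 60) (spaceBound U + 2)
      fun τ => MemInv U α L ε K F x τ ∧ τ.reg .kappa = L / α
        ∧ τ.reg .delta = asprDelta α L ε K.card
        ∧ τ.reg .count = asprIters (quadObj Q b) α L ε K (WithLp.toLp 2 x) := by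
  have hM : spaceBound U ≤ spaceBound U + 2 := by omega
  refine Runs.mono (T := _ + (_ + (_ + (7 * matIntVol Q K + 12 * K.card + 3 + _)))) (R :=
    fun τ => MemInv U α L ε K F x τ ∧ τ.reg .kappa = L / α
        ∧ τ.reg .delta = asprDelta α L ε K.card
        ∧ τ.reg .count = asprIters (quadObj Q b) α L ε K (WithLp.toLp 2 x))
    (Runs.seq (R' := fun τ => MemInv U α L ε K F x τ ∧ τ.reg .kappa = L / α)
      (Runs.assign hσ.fits _ _ hM ?_) fun τ ⟨hτ, hκ⟩ =>
    Runs.seq (R' := fun τ => MemInv U α L ε K F x τ ∧ τ.reg .kappa = L / α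
        ∧ τ.reg .delta = asprDelta α L ε K.card)
      (Runs.assign hτ.fits _ _ hM ?_) fun τ ⟨hτ, hκ, hδ⟩ =>
    Runs.seq (R' := fun τ => MemInv U α L ε K F x τ ∧ τ.reg .kappa = L / α
        ∧ τ.reg .delta = asprDelta α L ε K.card
        ∧ τ.reg .acc = asprAccuracy α L ε K.card)
      (Runs.assign hτ.fits _ _ hM ?_) fun τ ⟨hτ, hκ, hδ, hacc⟩ =>
    Runs.seq (R' := fun τ => MemInv U α L ε K F x τ ∧ τ.reg .kappa = L / α
        ∧ τ.reg .delta = asprDelta α L ε K.card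
        ∧ τ.reg .acc = asprAccuracy α L ε K.card
        ∧ τ.reg .nrm = ∑ i ∈ K, quadGrad Q b x i ^ 2)
      ((runs_computeNorm hτ).mono le_rfl le_rfl ?_) fun τ ⟨hτ, hκ, hδ, hacc, hnrm⟩ =>
    Runs.assign hτ.fits _ _ hM ?_) ?_ le_rfl fun _ h => h
  · exact ⟨hσ.setReg (by decide) (by decide) (by decide) _, by simp [eval, hσ.lip, hσ.alpha]⟩
  · refine ⟨hτ.setReg (by decide) (by decide) (by decide) _, by simpa using hκ, ?_⟩
    simp [eval, hτ.lip, hτ.alpha, hτ.eps, hτ.known, asprDelta, sq]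
  · refine ⟨hτ.setReg (by decide) (by decide) (by decide) _, by simpa using hκ,
      by simpa using hδ, ?_⟩
    simp [eval, hτ.alpha, hδ, asprAccuracy, sq]
  · rintro τ' ⟨g, rfl⟩
    refine ⟨(hτ.setReg (by decide) (by decide) (by decide) _).setReg (by decide) (by decide)
      (by decide) _, ?_, ?_, ?_, ?_⟩
    · simpa using hκ
    · simpa using hδ
    · simpa using hacc
    · simp
  · refine ⟨hτ.setReg (by decide) (by decide) (by decide) _, by simpa using hκ,
      by simpa using hδ, ?_⟩
    rw [cast_asprIters hQ]
    simp [eval, hτ.lip, hτ.alpha, hκ, hacc, hnrm, sq]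
  · have e1 : (reg .lip / reg .alpha : Expr n).steps = 3 := rfl
    have e2 : (sqrt (reg .eps * reg .alpha
      / ((nat 1 + card .known) * (reg .lip * reg .lip))) : Expr n).steps = 12 := rfl
    have e3 : (reg .delta * reg .delta * reg .alpha / nat 2 : Expr n).steps = 7 := rfl
    have e4 : (Expr.max (nat 1) (nat 1 + ceil (nat 2 * sqrt (reg .kappa) *
      log ((reg .lip - reg .alpha) * reg .nrm
        / (nat 2 * reg .acc * (reg .alpha * reg .alpha))))) : Expr n).steps = 24 := rfl
    rw [e1, e2, e3, e4]
    omega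

end ProgramLogic

/-! ### Correctness and cost of a pass of the main loop -/

section Program

variable {n : ℕ} {Q : Matrix (Fin n) (Fin n) ℝ} {b : Fin n → ℝ}
variable {U K F : Finset (Fin n)} {α L ε : ℝ} {x : Fin n → ℝ}

/-- The memory during the subroutine: `s` is the current state of the accelerated method, `N` the
number of remaining iterations, and `δ` the retraction parameter. -/
structure APGDInv (U : Finset (Fin n)) (α L ε : ℝ) (K : Finset (Fin n)) (x : Fin n → ℝ)
    (δ : ℝ) (s : APGDState n) (N : ℝ) (σ : Mem n) : Prop where
  mem : MemInv U α L ε K ∅ x σ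
  kappa : σ.reg .kappa = L / α
  delta : σ.reg .delta = δ
  y_eq : σ.vec .y = s.y
  z_eq : σ.vec .z = s.z
  A_eq : σ.reg .A = s.A
  a_eq : σ.reg .a = s.a
  count : σ.reg .count = N

/-- Extensionality for vectors that were overwritten on `K` and vanish elsewhere. -/
theorem eq_of_overwritten {v w : Fin n → ℝ} (hK : ∀ i ∈ K, v i = w i)
    (hv : ∀ i, i ∉ K → v i = 0) (hw : ∀ i, i ∉ K → w i = 0) : v = w := by
  funext i
  by_cases hi : i ∈ K
  · exact hK i hi
  · rw [hv i hi, hw i hi]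

open Expr in
/-- The loop of an iteration that computes the point `p` at which the gradient is evaluated. -/
theorem runs_pointLoop {δ N : ℝ} {s : APGDState n} (hs : ∀ i, i ∉ K → s.y i = 0 ∧ s.z i = 0)
    {σ : Mem n} (hσ : APGDInv U α L ε K x δ s N σ) (hnew : σ.reg .Anew = s.A + s.a) :
    Runs Q b (.forEach (.elems .known) (fun i =>
        .store .p i (reg .A / reg .Anew * vec .y i + reg .a / reg .Anew * vec .z i)))
      σ (13 * K.card + 1) (spaceBound U + 2) fun τ => APGDInv U α L ε K x δ s N τ
        ∧ τ.reg .Anew = s.A + s.a ∧ τ.vec .p = s.point := by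
  refine (Runs.forEach (M := spaceBound U)
    (fun P τ => (APGDInv U α L ε K x δ s N τ ∧ τ.reg .Anew = s.A + s.a)
      ∧ ∀ i ∈ P, τ.vec .p i = s.point i) (fun _ => 12) ⟨⟨hσ, hnew⟩, by simp⟩
    (fun P τ hτ => hτ.1.1.mem.fits.space_le)
    fun P i hi _ τ ⟨⟨hτ, hnew⟩, hp⟩ => ?_).mono ?_ (by omega) fun τ hτ => ?_
  · have hiK : i ∈ K := by simpa [Iter.toFinset, hσ.mem.known] using hi
    refine Runs.store hτ.mem.fits _ (hτ.mem.known_subset hiK) _ le_rfl ⟨⟨?_, hnew⟩, ?_⟩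
    · exact
        { mem := hτ.mem.setVec (by decide) hiK _
          kappa := hτ.kappa
          delta := hτ.delta
          y_eq := by simpa using hτ.y_eq
          z_eq := by simpa using hτ.z_eq
          A_eq := hτ.A_eq
          a_eq := hτ.a_eq
          count := hτ.count }
    · intro j hj
      rcases eq_or_ne j i with rfl | hji
      · simp [eval, hτ.y_eq, hτ.z_eq, hτ.A_eq, hτ.a_eq, hnew, APGDState.point]
      · simpa [hji] using hp j (Finset.mem_of_mem_insert_of_ne hj hji)
  · simp only [Iter.toFinset, hσ.mem.known, Finset.sum_const, smul_eq_mul]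
    omega
  · obtain ⟨⟨hτ, hnew⟩, hp⟩ := hτ
    refine ⟨hτ, hnew, eq_of_overwritten (K := K) ?_ (hτ.mem.off .p) fun i hi => ?_⟩
    · simpa [Iter.toFinset, hσ.mem.known] using hp
    · simp [APGDState.point, hs i hi]

open Expr in
/-- The loop of an iteration that updates `z` and `y`. -/
theorem runs_updateLoop {δ N : ℝ} {s : APGDState n} (hs : ∀ i, i ∉ K → s.y i = 0 ∧ s.z i = 0)
    {σ : Mem n} (hσ : APGDInv U α L ε K x δ s N σ) (hnew : σ.reg .Anew = s.A + s.a)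
    (hp : σ.vec .p = s.point) :
    Runs Q b (.forEach (.elems .known) (fun i =>
      ASPR.computeGrad .p i ;;
      .store .z i (max (nat 0)
        ((reg .kappa - nat 1 + reg .A) / (reg .kappa - nat 1 + reg .Anew) * vec .z i
          + reg .a / (reg .kappa - nat 1 + reg .Anew)
            * (vec .p i - nat 1 / reg .alpha * reg .grad))) ;;
      .store .y i (reg .A / reg .Anew * vec .y i + reg .a / reg .Anew * vec .z i)))
      σ (7 * matIntVol Q K + 60 * K.card + 1) (spaceBound U + 2) fun τ =>
        APGDInv U α L ε K x δ ⟨(s.next Q b α L K).y, (s.next Q b α L K).z, s.A, s.a⟩ N τ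
        ∧ τ.reg .Anew = s.A + s.a := by
  refine (Runs.forEach (M := spaceBound U + 1)
    (fun P τ => (MemInv U α L ε K ∅ x τ ∧ τ.reg .kappa = L / α ∧ τ.reg .delta = δ
        ∧ τ.reg .A = s.A ∧ τ.reg .a = s.a ∧ τ.reg .count = N ∧ τ.reg .Anew = s.A + s.a
        ∧ τ.vec .p = s.point)
      ∧ (∀ i, τ.vec .z i = if i ∈ P then (s.next Q b α L K).z i else s.z i)
      ∧ ∀ i, τ.vec .y i = if i ∈ P then (s.next Q b α L K).y i else s.y i)
    (fun i => 7 * rowNnz Q K i + 5 + 54)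
    ⟨⟨hσ.mem, hσ.kappa, hσ.delta, hσ.A_eq, hσ.a_eq, hσ.count, hnew, hp⟩,
      by simp [hσ.z_eq], by simp [hσ.y_eq]⟩
    (fun P τ hτ => hτ.1.1.fits.space_le.trans (by omega))
    fun P i hi hiP τ ⟨⟨hτ, hκ, hδ, hA, ha, hc, hnew, hp⟩, hz, hy⟩ => ?_).mono ?_ le_rfl
      fun τ hτ => ?_
  · have hiK : i ∈ K := by simpa [Iter.toFinset, hσ.mem.known] using hi
    have hiU := hτ.known_subset hiK
    have hgrad := runs_computeGrad (Q := Q) (b := b) hτ.fits .p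
      (by rw [hτ.known]; exact hτ.off .p) i
    rw [hτ.known, hp] at hgrad
    refine (hgrad.seq (T₂ := _ + _) fun τ₁ hτ₁ => Runs.seq
      (R' := fun τ₂ => τ₂ = τ₁.setVec .z i ((s.next Q b α L K).z i))
      (Runs.store (U := U) ?_ _ hiU _ (by omega) ?_) fun τ₂ hτ₂ =>
      Runs.store (U := U) ?_ _ hiU _ (by omega) ?_).mono
        (T := 7 * rowNnz Q K i + 5 + (32 + 12)) (by omega) le_rfl fun _ h => h
    · subst hτ₁
      exact hτ.fits.setReg _ _
    · subst hτ₁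
      simp [eval, hκ, hA, ha, hnew, hτ.alpha, hz i, hiP, hp, APGDState.next, projOn, hiK,
        APGDState.step]
    · subst hτ₂ hτ₁
      exact (hτ.fits.setReg _ _).setVec _ hiU _
    · subst hτ₂ hτ₁
      refine ⟨⟨?_, ?_, ?_, ?_, ?_, ?_, ?_, ?_⟩, fun j => ?_, fun j => ?_⟩
      · exact ((hτ.setReg (by decide) (by decide) (by decide) _).setVec (by decide) hiK _).setVec
          (by decide) hiK _
      · simpa using hκ
      · simpa using hδ
      · simpa using hA
      · simpa using ha
      · simpa using hc
      · simpa using hnew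
      · simpa using hp
      · rcases eq_or_ne j i with rfl | hji
        · simp
        · simp [hji, hz j]
      · rcases eq_or_ne j i with rfl | hji
        · simp [eval, hA, ha, hnew, hy j, hiP, APGDState.next]
        · simp [hji, hy j]
  · simp only [Iter.toFinset, hσ.mem.known]
    rw [Finset.sum_add_distrib, Finset.sum_add_distrib, Finset.sum_add_distrib, ← Finset.mul_sum,
      sum_rowNnz_eq_matIntVol]
    simp only [Finset.sum_const, smul_eq_mul]
    omega
  · simp only [Iter.toFinset, hσ.mem.known] at hτ
    obtain ⟨⟨hτ, hκ, hδ, hA, ha, hc, hnew, -⟩, hz, hy⟩ := hτ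
    refine ⟨⟨hτ, hκ, hδ, ?_, ?_, hA, ha, hc⟩, hnew⟩
    · refine eq_of_overwritten (K := K) (fun i hi => by simp [hy i, hi]) (hτ.off .y)
        fun i hi => ?_
      simp [APGDState.next, hs i hi, projOn_of_notMem _ hi]
    · exact eq_of_overwritten (K := K) (fun i hi => by simp [hz i, hi]) (hτ.off .z)
        fun i hi => projOn_of_notMem _ hi

open Expr in
theorem runs_apgdStep {δ N : ℝ} {s : APGDState n} (hs : ∀ i, i ∉ K → s.y i = 0 ∧ s.z i = 0)
    {σ : Mem n} (hσ : APGDInv U α L ε K x δ s N σ) :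
    Runs Q b (ASPR.apgdStep n) σ (7 * matIntVol Q K + 73 * K.card + 40) (spaceBound U + 2)
      (APGDInv U α L ε K x δ (s.next Q b α L K) (N - 1)) := by
  have hM : spaceBound U ≤ spaceBound U + 2 := by omega
  refine Runs.mono (R := APGDInv U α L ε K x δ (s.next Q b α L K) (N - 1))
      (T := 4 + (13 * K.card + 1 + (7 * matIntVol Q K + 60 * K.card + 1 + (21 + (2 + 4)))))
    (Runs.seq (R' := fun τ => APGDInv U α L ε K x δ s N τ ∧ τ.reg .Anew = s.A + s.a)
      (Runs.assign hσ.mem.fits _ _ hM ⟨?_, ?_⟩) fun τ ⟨hτ, hnew⟩ =>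
    (runs_pointLoop hs hτ hnew).seq fun τ ⟨hτ, hnew, hp⟩ =>
    (runs_updateLoop hs hτ hnew hp).seq fun τ ⟨hτ, hnew⟩ =>
    Runs.seq (R' := fun τ => APGDInv U α L ε K x δ
        ⟨(s.next Q b α L K).y, (s.next Q b α L K).z, s.A, (s.next Q b α L K).a⟩ N τ
        ∧ τ.reg .Anew = s.A + s.a)
      (Runs.assign hτ.mem.fits _ _ hM ?_) fun τ ⟨hτ, hnew⟩ =>
    Runs.seq (R' := APGDInv U α L ε K x δ (s.next Q b α L K) N)
      (Runs.assign hτ.mem.fits _ _ hM ?_) fun τ hτ =>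
    Runs.assign hτ.mem.fits _ _ hM ?_)
      (by omega) le_rfl fun _ h => h
  · exact ⟨hσ.mem.setReg (by decide) (by decide) (by decide) _, by simpa using hσ.kappa,
      by simpa using hσ.delta, hσ.y_eq, hσ.z_eq, by simpa using hσ.A_eq,
      by simpa using hσ.a_eq, by simpa using hσ.count⟩
  · simp [eval, hσ.A_eq, hσ.a_eq]
  · refine ⟨⟨hτ.mem.setReg (by decide) (by decide) (by decide) _, by simpa using hτ.kappa,
      by simpa using hτ.delta, hτ.y_eq, hτ.z_eq, by simpa using hτ.A_eq, ?_,
      by simpa using hτ.count⟩, by simpa using hnew⟩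
    simp [eval, hτ.kappa, hnew, APGDState.next, apgdRatio]
  · refine ⟨hτ.mem.setReg (by decide) (by decide) (by decide) _, by simpa using hτ.kappa,
      by simpa using hτ.delta, hτ.y_eq, hτ.z_eq, ?_, by simpa using hτ.a_eq,
      by simpa using hτ.count⟩
    simp [eval, hnew, APGDState.next]
  · exact ⟨hτ.mem.setReg (by decide) (by decide) (by decide) _, by simpa using hτ.kappa,
      by simpa using hτ.delta, hτ.y_eq, hτ.z_eq, by simpa using hτ.A_eq,
      by simpa using hτ.a_eq, by simp [eval, hτ.count]⟩

open Expr in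
theorem runs_apgd {δ : ℝ} {N : ℕ} (hx : ∀ i, i ∉ K → x i = 0) {σ : Mem n}
    (hσ : MemInv U α L ε K ∅ x σ) (hκ : σ.reg .kappa = L / α) (hδ : σ.reg .delta = δ)
    (hN : σ.reg .count = N) :
    Runs Q b (ASPR.apgd n) σ
      (5 * K.card + 10 + N * (7 * matIntVol Q K + 73 * K.card + 42)) (spaceBound U + 2)
      fun τ => MemInv U α L ε K ∅ x τ ∧ τ.reg .delta = δ
        ∧ τ.vec .y = (apgdIter Q b α L K x N).y := by
  have hM : spaceBound U ≤ spaceBound U + 2 := by omega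
  have hinit : Runs Q b (.forEach (.elems .known) (fun i =>
      .store .z i (vec .x i) ;; .store .y i (vec .x i))) σ (5 * K.card + 1) (spaceBound U + 2)
      fun τ => MemInv U α L ε K ∅ x τ ∧ τ.reg = σ.reg ∧ τ.vec .y = x ∧ τ.vec .z = x := by
    refine (Runs.forEach (M := spaceBound U)
      (fun P τ => MemInv U α L ε K ∅ x τ ∧ τ.reg = σ.reg
        ∧ ∀ i ∈ P, τ.vec .y i = x i ∧ τ.vec .z i = x i) (fun _ => 4) ⟨hσ, rfl, by simp⟩
      (fun P τ hτ => hτ.1.fits.space_le)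
      fun P i hi _ τ ⟨hτ, hreg, hyz⟩ => ?_).mono ?_ (by omega) fun τ hτ => ?_
    · have hiK : i ∈ K := by simpa [Iter.toFinset, hσ.known] using hi
      have hiU := hτ.known_subset hiK
      refine (Runs.seq (R' := fun τ₁ => τ₁ = τ.setVec .z i (x i))
        (Runs.store hτ.fits _ hiU _ le_rfl ?_) fun τ₁ hτ₁ =>
        Runs.store (U := U) ?_ _ hiU _ le_rfl ?_).mono (le_refl (2 + 2)) le_rfl fun _ h => h
      · simp [eval, hτ.x_eq]
      · subst hτ₁
        exact hτ.fits.setVec _ hiU _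
      · subst hτ₁
        refine ⟨(hτ.setVec (by decide) hiK _).setVec (by decide) hiK _, hreg, fun j hj => ?_⟩
        rcases eq_or_ne j i with rfl | hji
        · simp [eval, hτ.x_eq]
        · simpa [hji] using hyz j (Finset.mem_of_mem_insert_of_ne hj hji)
    · simp only [Iter.toFinset, hσ.known, Finset.sum_const, smul_eq_mul]
      omega
    · simp only [Iter.toFinset, hσ.known] at hτ
      obtain ⟨hτ, hreg, hyz⟩ := hτ
      exact ⟨hτ, hreg, eq_of_overwritten (fun i hi => (hyz i hi).1) (hτ.off .y) hx,
        eq_of_overwritten (fun i hi => (hyz i hi).2) (hτ.off .z) hx⟩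
  refine (hinit.seq fun τ ⟨hτ, hreg, hy, hz⟩ =>
    Runs.seq (R' := fun τ' => τ' = τ.setReg .A 0) (Runs.assign hτ.fits _ _ hM (by simp [eval]))
      fun τ₁ hτ₁ =>
    Runs.seq (R' := APGDInv U α L ε K x δ (apgdIter Q b α L K x 0) (N - (0 : ℕ)))
      (Runs.assign (U := U) ?_ _ _ hM ?_) fun τ₂ hτ₂ =>
    (Runs.whilePos N (fun k => APGDInv U α L ε K x δ (apgdIter Q b α L K x k) (N - k))
      (T := 7 * matIntVol Q K + 73 * K.card + 40)
      (fun k hk τ hτ => ?_) (fun k hk τ hτ => ?_) (fun τ hτ => ⟨?_, ?_⟩) hτ₂).mono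
        (le_refl _) le_rfl fun τ hτ => ⟨hτ.mem, hτ.delta, hτ.y_eq⟩).mono
    (T := 5 * K.card + 1 + (2 + (2 + (N * (2 + (7 * matIntVol Q K + 73 * K.card + 40)) + 2))))
    ?_ le_rfl fun _ h => h
  · subst hτ₁
    exact hτ.fits.setReg _ _
  · subst hτ₁
    exact ⟨(hτ.setReg (by decide) (by decide) (by decide) _).setReg (by decide) (by decide)
      (by decide) _, by simpa [hreg] using hκ, by simpa [hreg] using hδ, hy, hz,
      by simp [apgdIter], by simp [apgdIter, eval], by simpa [hreg] using hN⟩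
  · have : (k : ℝ) < N := by exact_mod_cast hk
    simpa [eval, hτ.count] using this
  · refine (runs_apgdStep (fun i hi => apgdIter_support Q b α L hx k hi) hτ).mono le_rfl le_rfl
      fun τ h => ?_
    rw [show ((N : ℝ) - (k + 1 : ℕ)) = N - k - 1 by push_cast; ring]
    exact h
  · simp [eval, hτ.count]
  · exact hτ.mem.fits.space_le.trans hM
  · rw [show 2 + (7 * matIntVol Q K + 73 * K.card + 40)
      = 7 * matIntVol Q K + 73 * K.card + 42 by omega]
    omega

open Expr in
theorem runs_retract {δ : ℝ} {y : Fin n → ℝ} (hδ0 : 0 ≤ δ) (hy0 : ∀ i, i ∉ K → y i = 0)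
    {σ : Mem n} (hσ : MemInv U α L ε K ∅ x σ) (hδ : σ.reg .delta = δ) (hy : σ.vec .y = y) :
    Runs Q b (ASPR.retract n) σ (7 * K.card + 1) (spaceBound U + 2)
      (MemInv U α L ε K ∅ fun i => Max.max 0 (y i - δ)) := by
  refine (Runs.forEach (M := spaceBound U)
    (fun P τ => MemInv U α L ε K ∅ (τ.vec .x) τ ∧ τ.reg .delta = δ ∧ τ.vec .y = y
      ∧ ∀ i ∈ P, τ.vec .x i = Max.max 0 (y i - δ)) (fun _ => 6)
    ⟨by rw [hσ.x_eq]; exact hσ, hδ, hy, by simp⟩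
    (fun P τ hτ => hτ.1.fits.space_le)
    fun P i hi _ τ ⟨hτ, hδ, hy, hx⟩ => ?_).mono ?_ (by omega) fun τ hτ => ?_
  · have hiK : i ∈ K := by simpa [Iter.toFinset, hσ.known] using hi
    refine Runs.store hτ.fits _ (hτ.known_subset hiK) _ le_rfl ⟨?_, hδ, by simpa using hy, ?_⟩
    · exact
        { fits := hτ.fits.setVec _ (hτ.known_subset hiK) _
          alpha := hτ.alpha
          lip := hτ.lip
          eps := hτ.eps
          known := hτ.known
          fresh := hτ.fresh
          x_eq := rfl
          off := fun w j hj => by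
            have hji : j ≠ i := fun e => hj (e ▸ hiK)
            by_cases hw : w = .x
            · subst hw
              simpa [hji] using hτ.off .x j hj
            · simpa [hw] using hτ.off w j hj }
    · intro j hj
      rcases eq_or_ne j i with rfl | hji
      · simp [eval, hy, hδ]
      · simpa [hji] using hx j (Finset.mem_of_mem_insert_of_ne hj hji)
  · simp only [Iter.toFinset, hσ.known, Finset.sum_const, smul_eq_mul]
    omega
  · simp only [Iter.toFinset, hσ.known] at hτ
    obtain ⟨hτ, -, -, hx⟩ := hτ
    rw [eq_of_overwritten (w := fun i => Max.max 0 (y i - δ)) hx (hτ.off .x)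
      fun i hi => by simp [hy0 i hi, hδ0]] at hτ
    exact hτ

open Expr in
/-- A coordinate outside `K` with a negative partial derivative at `x` either is a neighbour of `K`
or has `b i > 0`; the latter coordinates are in `K` from the start. -/
theorem runs_expand (hQ : Q.IsSymm) {N : Finset (Fin n)}
    (hN : N = negCoords (quadObj Q b) (WithLp.toLp 2 x)) (hNU : N ⊆ U)
    (hx : ∀ i, i ∉ K → x i = 0) (hb : ∀ i, 0 < b i → i ∈ K) {σ : Mem n}
    (hσ : MemInv U α L ε K ∅ x σ) :
    Runs Q b (ASPR.expand n) σ (17 * matVol Q K + 1) (spaceBound U + 2)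
      (MemInv U α L ε K ((K ∪ N) \ K) x) := by
  classical
  have hmem : ∀ i, i ∈ N ↔ quadGrad Q b x i < 0 := fun i => by rw [hN, mem_negCoords hQ]
  have hnbrs : (Iter.nbrs SetName.known).toFinset Q b σ
      = Finset.univ.filter fun i => ∃ j ∈ K, Q i j ≠ 0 := by
    ext i
    simp [Iter.toFinset, hσ.known]
  refine (Runs.forEach (M := spaceBound U + 1)
    (fun P τ => MemInv U α L ε K ((P ∩ N) \ K) x τ)
    (fun i => 7 * rowNnz Q K i + 5 + 4) (by simpa using hσ)
    (fun P τ hτ => hτ.fits.space_le.trans (by omega))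
    fun P i _ _ τ hτ => ?_).mono ?_ le_rfl fun τ hτ => ?_
  · have hgrad := runs_computeGrad (Q := Q) (b := b) hτ.fits .x
      (by rw [hτ.known]; exact hτ.off .x) i
    rw [hτ.known, hτ.x_eq] at hgrad
    refine (hgrad.seq (T₂ := 2 + (1 + 1)) fun τ₁ hτ₁ => ?_).mono le_rfl le_rfl fun _ h => h
    have hτ' : MemInv U α L ε K ((P ∩ N) \ K) x τ₁ := by
      subst hτ₁
      exact hτ.setReg (by decide) (by decide) (by decide) _
    have hg : τ₁.reg .grad = quadGrad Q b x i := by simp [hτ₁]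
    have hsp : τ₁.space ≤ spaceBound U + 1 := hτ'.fits.space_le.trans (by omega)
    refine Runs.ifNeg (fun hneg => Runs.ifNotMem (fun hi => ?_) (fun hi => ?_) hsp)
      (fun hneg => ?_) hsp
    · have hiN : i ∈ N := by rw [hmem, ← hg]; exact hneg
      refine Runs.insert hτ'.fits _ (hNU hiN) (by omega) ?_
      rw [hτ'.known] at hi
      exact
        { fits := hτ'.fits.setSet _ (Finset.insert_subset (hNU hiN) (hτ'.fits.set .fresh))
          alpha := hτ'.alpha
          lip := hτ'.lip
          eps := hτ'.eps
          known := hτ'.known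
          fresh := by
            simp [hτ'.fresh, Finset.insert_inter_of_mem hiN, Finset.insert_sdiff_of_notMem _ hi]
          x_eq := hτ'.x_eq
          off := hτ'.off }
    · rw [hτ'.known] at hi
      convert hτ' using 1
      ext j
      simp only [Finset.mem_sdiff, Finset.mem_inter, Finset.mem_insert]
      constructor
      · rintro ⟨⟨rfl | hj, hjN⟩, hjK⟩
        · exact absurd hi hjK
        · exact ⟨⟨hj, hjN⟩, hjK⟩
      · exact fun ⟨⟨hj, hjN⟩, hjK⟩ => ⟨⟨Or.inr hj, hjN⟩, hjK⟩
    · have hiN : i ∉ N := by rw [hmem, ← hg]; exact hneg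
      rwa [Finset.insert_inter_of_notMem hiN]
  · rw [hnbrs]
    have h1 : ∀ i ∈ Finset.univ.filter (fun i => ∃ j ∈ K, Q i j ≠ 0),
        7 * rowNnz Q K i + 5 + 4 + 1 ≤ 17 * rowNnz Q K i := by
      intro i hi
      obtain ⟨j, hj, hij⟩ := (Finset.mem_filter.1 hi).2
      have : 0 < rowNnz Q K i := Finset.card_pos.2 ⟨j, by simp [hj, hij]⟩
      omega
    have h2 : ∑ i ∈ Finset.univ.filter (fun i => ∃ j ∈ K, Q i j ≠ 0), 17 * rowNnz Q K i
        ≤ 17 * matVol Q K := by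
      rw [← Finset.mul_sum]
      refine Nat.mul_le_mul_left _ ?_
      rw [matVol, ← sum_rowNnz]
      exact Finset.sum_le_sum_of_subset (Finset.subset_univ _)
    have h3 := (Finset.sum_le_sum h1).trans h2
    exact Nat.add_le_add_right h3 1
  · rw [hnbrs] at hτ
    convert hτ using 1
    ext i
    simp only [Finset.mem_sdiff, Finset.mem_union, Finset.mem_inter, Finset.mem_filter,
      Finset.mem_univ, true_and]
    constructor
    · rintro ⟨hi | hi, hiK⟩
      · exact absurd hi hiK
      · refine ⟨⟨?_, hi⟩, hiK⟩
        by_contra! hno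
        have h1 := (hmem i).1 hi
        rw [quadGrad_apply, Finset.sum_eq_zero fun j _ => ?_] at h1
        · exact hiK (hb i (by linarith))
        · by_cases hj : j ∈ K
          · rw [hno j hj, zero_mul]
          · rw [hx j hj, mul_zero]
    · exact fun ⟨⟨_, hi⟩, hiK⟩ => ⟨Or.inr hi, hiK⟩

/-- The body of the main loop. -/
theorem runs_pass (hQ : Q.IsSymm) {S : Finset (Fin n)} (hKF : K ∪ F = S) (hSU : S ⊆ U)
    (hx : ∀ i, i ∉ S → x i = 0) (hb : ∀ i, 0 < b i → i ∈ S)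
    (hNU : negCoords (quadObj Q b) (WithLp.toLp 2 (asprNext Q b α L ε S x)) ⊆ U) {σ : Mem n}
    (hσ : MemInv U α L ε K F x σ) :
    Runs Q b (.forEach (.elems .fresh) (fun i => .insert .known i) ;;
        .clear .fresh ;;
        ASPR.setParameters n ;;
        ASPR.apgd n ;;
        ASPR.retract n ;;
        ASPR.expand n) σ
      (100 + 30 * U.card + 7 * matIntVol Q S + 17 * matVol Q S
        + asprIters (quadObj Q b) α L ε S (WithLp.toLp 2 x)
          * (7 * matIntVol Q S + 73 * S.card + 42))
      (spaceBound U + 2)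
      (MemInv U α L ε S ((S ∪ negCoords (quadObj Q b)
        (WithLp.toLp 2 (asprNext Q b α L ε S x))) \ S) (asprNext Q b α L ε S x)) := by
  have hM : spaceBound U ≤ spaceBound U + 2 := by omega
  have hSc := Finset.card_le_card hSU
  have hFc : F.card ≤ U.card := Finset.card_le_card ((hKF ▸ Finset.subset_union_right).trans hSU)
  have hins : Runs Q b (.forEach (.elems .fresh) (fun i => .insert .known i)) σ
      (2 * F.card + 1) (spaceBound U + 2) (MemInv U α L ε S F x) := by
    refine (Runs.forEach (M := spaceBound U) (fun P τ => MemInv U α L ε (K ∪ P) F x τ)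
      (fun _ => 1) (by simpa using hσ) (fun P τ hτ => hτ.fits.space_le)
      fun P i hi _ τ hτ => ?_).mono ?_ (by omega) fun τ hτ => ?_
    · have hiF : i ∈ F := by simpa [Iter.toFinset, hσ.fresh] using hi
      have hiU : i ∈ U := hSU (hKF ▸ Finset.mem_union_right _ hiF)
      refine Runs.insert hτ.fits _ hiU le_rfl ?_
      exact
        { fits := hτ.fits.setSet _ (Finset.insert_subset hiU (hτ.fits.set .known))
          alpha := hτ.alpha
          lip := hτ.lip
          eps := hτ.eps
          known := by simp [hτ.known]
          fresh := by simpa using hτ.fresh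
          x_eq := hτ.x_eq
          off := fun v j hj => hτ.off v j fun hj' => hj (by
            rw [Finset.union_insert]
            exact Finset.mem_insert_of_mem hj') }
    · simp only [Iter.toFinset, hσ.fresh, Finset.sum_const, smul_eq_mul]
      omega
    · simpa only [Iter.toFinset, hσ.fresh, hKF] using hτ
  refine (hins.seq fun τ hτ =>
    Runs.seq (R' := MemInv U α L ε S ∅ x) (Runs.clear hτ.fits _ hM ?_) fun τ hτ =>
    (runs_setParameters hQ hτ).seq fun τ ⟨hτ, hκ, hδ, hN⟩ =>
    (runs_apgd hx hτ hκ hδ hN).seq fun τ ⟨hτ, hδ, hy⟩ =>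
    (runs_retract (asprDelta_nonneg α L ε S.card)
      (fun i hi => (apgdIter_support Q b α L hx _ hi).1) hτ hδ hy).seq fun τ hτ =>
    runs_expand hQ rfl hNU (fun i hi => asprNext_of_notMem Q b α L ε hx hi) hb hτ).mono
      ?_ le_rfl fun _ h => h
  · exact
      { fits := hτ.fits.setSet _ (Finset.empty_subset _)
        alpha := hτ.alpha
        lip := hτ.lip
        eps := hτ.eps
        known := by simpa using hτ.known
        fresh := by simp
        x_eq := hτ.x_eq
        off := hτ.off }
  · generalize asprIters (quadObj Q b) α L ε S (WithLp.toLp 2 x)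
        * (7 * matIntVol Q S + 73 * S.card + 42) = X
    omega

end Program

/-! ### The complexity of ASPR -/

section Complexity

variable {n : ℕ} {Q : Matrix (Fin n) (Fin n) ℝ} {b : Fin n → ℝ} {α L ε : ℝ}

theorem asprSeq_zero_subset (Q : Matrix (Fin n) (Fin n) ℝ) (b : Fin n → ℝ) (α L ε : ℝ) (t : ℕ) :
    (asprSeq Q b α L ε 0).2 ⊆ (asprSeq Q b α L ε t).2 := by
  induction t with
  | zero => exact subset_rfl
  | succ t ih => exact ih.trans Finset.subset_union_left

/-- The program follows the iterates of ASPR. The bound is in terms of a number `N` that dominates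
the iteration counts of the subroutine in all passes. -/
theorem IsBoundedMMatrix.exists_asprRunsIn_le (h : IsBoundedMMatrix Q α L) (hε : 0 < ε)
    {xs : Fin n → ℝ} (hxs : IsKKTPoint Q b xs) {U : Finset (Fin n)} (hU : ∀ i, 0 < xs i → i ∈ U)
    {N : ℕ} (hN : ∀ t, (asprSeq Q b α L ε t).2.Nonempty →
      asprIters (quadObj Q b) α L ε (asprSeq Q b α L ε t).2
        (WithLp.toLp 2 (asprSeq Q b α L ε t).1) ≤ N) :
    ∃ t m : ℕ, ASPRRunsIn Q b α L ε t m
      ∧ t ≤ 2 * U.card + 3 + U.card * (102 + 30 * U.card + 7 * matIntVol Q U + 17 * matVol Q U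
          + N * (7 * matIntVol Q U + 73 * U.card + 42))
      ∧ m ≤ 6 * U.card + 14 := by
  set S : ℕ → Finset (Fin n) := fun t => (asprSeq Q b α L ε t).2 with hS
  have hSU : ∀ t, S t ⊆ U := fun t i hi =>
    hU i ((h.asprSeq_invariant hε hxs t).2.2.2 i hi)
  have hb : ∀ t i, 0 < b i → i ∈ S t := fun t i hi =>
    asprSeq_zero_subset Q b α L ε t ((mem_negCoords h.symm b 0 i).2 (by simp [quadGrad, hi]))
  obtain ⟨T, hT, hrun⟩ := h.exists_isASPRRun hε hxs hU
  have hpos0 : (Iter.posRhs : Iter n).toFinset Q b (ASPR.initMem n α L ε) = S 0 := by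
    ext i
    simp [Iter.toFinset, hS, asprSeq, mem_negCoords h.symm, quadGrad]
  have hfit0 : (ASPR.initMem n α L ε).Fits U :=
    ⟨fun _ => Finset.empty_subset U, fun _ => Finset.empty_subset U⟩
  have hinit : Runs Q b (.forEach .posRhs (fun i => .insert .fresh i)) (ASPR.initMem n α L ε)
      (2 * U.card + 1) (spaceBound U + 2) fun τ =>
        MemInv U α L ε (prevSet S 0) (S 0 \ prevSet S 0) (asprSeq Q b α L ε 0).1 τ := by
    refine (Runs.forEach (M := spaceBound U)
      (fun P τ => τ = (ASPR.initMem n α L ε).setSet .fresh P ∧ τ.Fits U) (fun _ => 1)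
      ⟨(Mem.setSet_self _ _).symm, hfit0⟩ (fun P τ hτ => hτ.2.space_le)
      fun P i hi _ τ ⟨hτ, hfit⟩ => ?_).mono ?_ (by omega) fun τ ⟨hτ, hfit⟩ => ?_
    · rw [hpos0] at hi
      refine Runs.insert hfit _ (hSU 0 hi) le_rfl
        ⟨?_, hfit.setSet _ (Finset.insert_subset (hSU 0 hi) (hfit.set .fresh))⟩
      rw [hτ, Mem.setSet_setSet]
      simp
    · rw [hpos0, Finset.sum_const, smul_eq_mul]
      have := Finset.card_le_card (hSU 0)
      omega
    · rw [hpos0] at hτ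
      subst hτ
      exact
        { fits := hfit
          alpha := rfl
          lip := rfl
          eps := rfl
          known := rfl
          fresh := by simp [prevSet]
          x_eq := rfl
          off := fun _ _ _ => rfl }
  set B := 100 + 30 * U.card + 7 * matIntVol Q U + 17 * matVol Q U
    + N * (7 * matIntVol Q U + 73 * U.card + 42) with hB
  set J : ℕ → Mem n → Prop := fun t τ =>
    MemInv U α L ε (prevSet S t) (S t \ prevSet S t) (asprSeq Q b α L ε t).1 τ with hJ
  have hpass : ∀ k < T, ∀ τ, J k τ → Runs Q b
      (.forEach (.elems .fresh) (fun i => .insert .known i) ;;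
        .clear .fresh ;;
        ASPR.setParameters n ;;
        ASPR.apgd n ;;
        ASPR.retract n ;;
        ASPR.expand n) τ B (spaceBound U + 2) (J (k + 1)) := by
    intro k hk τ hτ
    have hsub := prevSet_asprSeq_subset Q b α L ε k
    have hne : (S k).Nonempty := by
      refine Finset.nonempty_iff_ne_empty.2 fun he => hrun.continues k hk ?_
      change S k = prevSet S k
      rw [he]
      exact (Finset.subset_empty.1 (he ▸ hsub)).symm
    have hinv := h.asprSeq_invariant hε hxs k
    refine (runs_pass h.symm (Finset.union_sdiff_of_subset hsub) (hSU k) hinv.2.2.1 (hb k)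
      (Finset.subset_union_right.trans (hSU (k + 1))) hτ).mono ?_ le_rfl fun _ h => h
    have h1 := matIntVol_mono Q (hSU k)
    have h2 := matVol_mono Q (hSU k)
    have h3 := Finset.card_le_card (hSU k)
    have h4 := Nat.mul_le_mul (hN k hne)
      (show 7 * matIntVol Q (S k) + 73 * (S k).card + 42
        ≤ 7 * matIntVol Q U + 73 * U.card + 42 by omega)
    simp only [hS] at h1 h2 h3 h4
    omega
  obtain ⟨σ, t, m, he, ht, hm, hσ⟩ := hinit.seq fun τ hτ =>
    Runs.whilePos (Q := Q) (b := b) (e := .card .fresh) T J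
      (fun k hk τ hτ => by
        have hlt : prevSet S k ⊂ S k :=
          (prevSet_asprSeq_subset Q b α L ε k).ssubset_of_ne (hrun.continues k hk).symm
        have := Finset.card_pos.2 (Finset.sdiff_nonempty.2 hlt.2)
        simpa [Expr.eval, hτ.fresh] using this)
      hpass
      (fun τ hτ => ⟨by
        have : S T \ prevSet S T = ∅ :=
          Finset.sdiff_eq_empty_iff_subset.2 (le_of_eq hrun.stops)
        simp [Expr.eval, hτ.fresh, this], hτ.fits.space_le.trans (by omega)⟩) hτ
  refine ⟨t, m, ⟨T, _, _, σ, hrun, he, hσ.x_eq⟩, ht.trans ?_, hm.trans ?_⟩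
  · have e1 : (Expr.card .fresh : Expr n).steps = 1 := rfl
    have h1 : T * (1 + 1 + B) ≤ U.card * (102 + 30 * U.card + 7 * matIntVol Q U
        + 17 * matVol Q U + N * (7 * matIntVol Q U + 73 * U.card + 42)) :=
      Nat.mul_le_mul hT (by omega)
    rw [e1]
    omega
  · simp only [spaceBound]
    omega

/-- The bound on time and space for symmetric positive-definite M-matrices. -/
theorem IsBoundedMMatrix.exists_asprRunsIn (h : IsBoundedMMatrix Q α L) (hε : 0 < ε)
    {xs : Fin n → ℝ} (hxs : IsKKTPoint Q b xs) {U : Finset (Fin n)}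
    (hU : ∀ i, 0 < xs i → i ∈ U) :
    ∃ t m : ℕ, ASPRRunsIn Q b α L ε t m
      ∧ (t : ℝ) ≤ 1000 * (U.card * matIntVol Q U * Real.sqrt (L / α)
          * Real.log (2 + L ^ 4 * (1 + U.card) * (L - α) * (xs ⬝ᵥ xs) / (α ^ 4 * ε))
          + U.card * matVol Q U + 1)
      ∧ (m : ℝ) ≤ 1000 * (U.card + 1) := by
  have hSU : ∀ t, (asprSeq Q b α L ε t).2 ⊆ U := fun t i hi =>
    hU i ((h.asprSeq_invariant hε hxs t).2.2.2 i hi)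
  set ℓ := Real.log (2 + L ^ 4 * (1 + U.card) * (L - α) * (xs ⬝ᵥ xs) / (α ^ 4 * ε)) with hℓ
  obtain ⟨t, m, hrun, ht, hm⟩ := h.exists_asprRunsIn_le hε hxs hU
    (N := ⌊2 + 2 * Real.sqrt (L / α) * ℓ⌋₊) fun t hne => Nat.le_floor <| by
      obtain ⟨h0, hle, -, hS⟩ := h.asprSeq_invariant hε hxs t
      exact h.cast_asprIters_le hε hxs hne hS (Finset.card_le_card (hSU t)) h0 hle
  refine ⟨t, m, hrun, ?_, ?_⟩
  -- if `U = ∅` then possibly `n = 0` and `L < α`, so `ℓ` may be meaningless, but it is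
  -- multiplied by zero
  · rcases U.eq_empty_or_nonempty with rfl | ⟨i, hi⟩
    · have ht' : (t : ℝ) ≤ 3 := by exact_mod_cast (by simpa using ht : t ≤ 3)
      simp only [Finset.card_empty, Nat.cast_zero, zero_mul, zero_add]
      linarith
    have hα := h.pos
    have hαL := h.le_of_index i
    have hL : 0 < L := hα.trans_le hαL
    have hsqrt : 1 ≤ Real.sqrt (L / α) := Real.one_le_sqrt.2 ((one_le_div hα).2 hαL)
    have hX : 0 ≤ L ^ 4 * (1 + U.card) * (L - α) * (xs ⬝ᵥ xs) / (α ^ 4 * ε) := by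
      have h1 : 0 ≤ L - α := by linarith
      have h2 := dotProduct_self_nonneg xs
      positivity
    have hℓ2 : 1 / 2 ≤ ℓ := by
      have h1 := Real.log_two_gt_d9
      have h2 : Real.log 2 ≤ ℓ := Real.log_le_log two_pos (by linarith)
      linarith
    -- so the additive constant in the number of iterations is absorbed
    have hsℓ : 1 / 2 ≤ Real.sqrt (L / α) * ℓ := by nlinarith
    have hN : (⌊2 + 2 * Real.sqrt (L / α) * ℓ⌋₊ : ℝ) ≤ 6 * (Real.sqrt (L / α) * ℓ) :=
      (Nat.floor_le (by nlinarith)).trans (by linarith)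
    set N := ⌊2 + 2 * Real.sqrt (L / α) * ℓ⌋₊
    have hu1 : 1 ≤ U.card := Finset.card_pos.2 ⟨i, hi⟩
    have huiv : U.card ≤ matIntVol Q U := card_le_matIntVol h.diag_ne_zero U
    have hiv := matIntVol_le_matVol Q U
    -- lower-order terms are absorbed by `1 ≤ |U| ≤ matIntVol Q U ≤ matVol Q U`
    have h1 : t ≤ U.card * (158 * matVol Q U + 122 * (N * matIntVol Q U)) + 3 := by
      refine ht.trans ?_
      have h2 : N * (7 * matIntVol Q U + 73 * U.card + 42) ≤ N * (122 * matIntVol Q U) :=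
        Nat.mul_le_mul_left _ (by omega)
      have h3 : 102 + 30 * U.card + 7 * matIntVol Q U + 17 * matVol Q U
          + N * (7 * matIntVol Q U + 73 * U.card + 42) + 2
          ≤ 158 * matVol Q U + 122 * (N * matIntVol Q U) := by
        rw [mul_left_comm] at h2
        omega
      have h4 := Nat.mul_le_mul_left U.card h3
      rw [Nat.mul_add U.card _ 2] at h4
      omega
    have h2 : (t : ℝ) ≤ U.card * (158 * matVol Q U + 122 * (N * matIntVol Q U)) + 3 := by
      exact_mod_cast h1
    have h3 : (U.card : ℝ) * (122 * (N * matIntVol Q U))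
        ≤ U.card * (122 * (6 * (Real.sqrt (L / α) * ℓ) * matIntVol Q U)) := by gcongr
    have h4 : (0 : ℝ) ≤ U.card * matIntVol Q U * Real.sqrt (L / α) * ℓ := by
      have : 0 ≤ ℓ := by linarith
      positivity
    have h5 : (0 : ℝ) ≤ U.card * matVol Q U := by positivity
    linarith
  · have hm' : (m : ℝ) ≤ 6 * U.card + 14 := by exact_mod_cast hm
    have : (0 : ℝ) ≤ U.card := by positivity
    linarith

end Complexity

/-! ### Regularized PageRank -/

section PageRank

variable {n : ℕ} (G : SimpleGraph (Fin n)) [DecidableRel G.Adj]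

theorem pageRankMatrix_apply (α : ℝ) (i j : Fin n) :
    pageRankMatrix G α i j = (Real.sqrt (G.degree i))⁻¹
      * ((if i = j then (1 + α) / 2 * G.degree i else 0) - (1 - α) / 2 * G.adjMatrix ℝ i j)
      * (Real.sqrt (G.degree j))⁻¹ := by
  simp only [pageRankMatrix, Matrix.diagonal_mul, Matrix.mul_diagonal, Matrix.sub_apply,
    Matrix.smul_apply, Matrix.add_apply, Matrix.diagonal_apply, smul_eq_mul]
  congr 2
  split_ifs <;> ring

theorem one_le_degree {G : SimpleGraph (Fin n)} [DecidableRel G.Adj] (hn : 2 ≤ n)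
    (hG : G.Connected) (i : Fin n) : (1 : ℝ) ≤ G.degree i := by
  have : Nontrivial (Fin n) := Fin.nontrivial_iff_two_le.2 hn
  exact_mod_cast hG.preconnected.degree_pos_of_nontrivial i

theorem sum_adjMatrix_mul_sq (y : Fin n → ℝ) :
    ∑ i, ∑ j, G.adjMatrix ℝ i j * y i ^ 2 = ∑ i, G.degree i * y i ^ 2 := by
  refine Finset.sum_congr rfl fun i _ => ?_
  rw [← Finset.sum_mul]
  congr 1
  simp only [SimpleGraph.adjMatrix_apply, Finset.sum_boole]
  rw [← G.card_neighborFinset_eq_degree, G.neighborFinset_eq_filter]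

theorem sum_adjMatrix_mul_sq' (y : Fin n → ℝ) :
    ∑ i, ∑ j, G.adjMatrix ℝ i j * y j ^ 2 = ∑ i, G.degree i * y i ^ 2 := by
  rw [Finset.sum_comm, ← sum_adjMatrix_mul_sq]
  refine Finset.sum_congr rfl fun i _ => Finset.sum_congr rfl fun j _ => ?_
  simp [SimpleGraph.adjMatrix_apply, G.adj_comm]

theorem abs_sum_adjMatrix_le (y : Fin n → ℝ) :
    |∑ i, ∑ j, G.adjMatrix ℝ i j * (y i * y j)| ≤ ∑ i, G.degree i * y i ^ 2 := by
  have h : ∀ c : ℝ, c ^ 2 = 1 → 0 ≤ 2 * ∑ i, G.degree i * y i ^ 2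
      + 2 * c * ∑ i, ∑ j, G.adjMatrix ℝ i j * (y i * y j) := by
    intro c hc
    have h1 : (0 : ℝ) ≤ ∑ i, ∑ j, G.adjMatrix ℝ i j * (y i + c * y j) ^ 2 :=
      Finset.sum_nonneg fun i _ => Finset.sum_nonneg fun j _ => mul_nonneg
        (by simp only [SimpleGraph.adjMatrix_apply]; split_ifs <;> norm_num) (sq_nonneg _)
    have h2 : ∀ i j, G.adjMatrix ℝ i j * (y i + c * y j) ^ 2
        = G.adjMatrix ℝ i j * y i ^ 2 + G.adjMatrix ℝ i j * y j ^ 2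
          + 2 * c * (G.adjMatrix ℝ i j * (y i * y j)) := fun i j => by
      linear_combination G.adjMatrix ℝ i j * y j ^ 2 * hc
    simp only [h2, Finset.sum_add_distrib] at h1
    rw [sum_adjMatrix_mul_sq, sum_adjMatrix_mul_sq'] at h1
    simp only [← Finset.mul_sum] at h1
    linarith
  rw [abs_le]
  constructor <;> linarith [h 1 (by norm_num), h (-1) (by norm_num)]

/-- In the coordinates `y = D^{-1/2} x` the quadratic form is a combination of `∑ d_i y_i²` and
the form of the adjacency matrix. -/
theorem pageRank_quadForm {G : SimpleGraph (Fin n)} [DecidableRel G.Adj]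
    (hd : ∀ i, (1 : ℝ) ≤ G.degree i) (α : ℝ) (x : Fin n → ℝ) :
    x ⬝ᵥ (pageRankMatrix G α).mulVec x = (1 + α) / 2 * (x ⬝ᵥ x)
      - (1 - α) / 2 * ∑ i, ∑ j, G.adjMatrix ℝ i j
        * ((Real.sqrt (G.degree i))⁻¹ * x i * ((Real.sqrt (G.degree j))⁻¹ * x j)) := by
  simp only [dotProduct, Matrix.mulVec, Finset.mul_sum, ← Finset.sum_sub_distrib]
  refine Finset.sum_congr rfl fun i _ => ?_
  have hdi : (0 : ℝ) < G.degree i := by linarith [hd i]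
  have hs : (Real.sqrt (G.degree i))⁻¹ * G.degree i * (Real.sqrt (G.degree i))⁻¹ = 1 := by
    have h1 := Real.sq_sqrt hdi.le
    have h2 := (Real.sqrt_pos.2 hdi).ne'
    field_simp
    exact h1.symm
  have h1 : ∀ j, x i * (pageRankMatrix G α i j * x j)
      = (if i = j then (1 + α) / 2 * (x i * x i) else 0)
        - (1 - α) / 2 * (G.adjMatrix ℝ i j
        * ((Real.sqrt (G.degree i))⁻¹ * x i * ((Real.sqrt (G.degree j))⁻¹ * x j))) := by
    intro j
    rw [pageRankMatrix_apply]
    by_cases hij : i = j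
    · subst hij
      simp only [if_true]
      linear_combination (1 + α) / 2 * (x i * x i) * hs
    · simp only [hij, if_false]
      ring
  simp only [h1, Finset.sum_sub_distrib]
  simp

theorem sum_degree_mul_sq {G : SimpleGraph (Fin n)} [DecidableRel G.Adj]
    (hd : ∀ i, (1 : ℝ) ≤ G.degree i) (x : Fin n → ℝ) :
    ∑ i, G.degree i * ((Real.sqrt (G.degree i))⁻¹ * x i) ^ 2 = x ⬝ᵥ x := by
  refine Finset.sum_congr rfl fun i _ => ?_
  have hdi : (0 : ℝ) < G.degree i := by linarith [hd i]
  rw [mul_pow, inv_pow, Real.sq_sqrt hdi.le, ← mul_assoc, mul_inv_cancel₀ hdi.ne', one_mul, sq]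

theorem pageRank_quadForm_le {G : SimpleGraph (Fin n)} [DecidableRel G.Adj]
    (hd : ∀ i, (1 : ℝ) ≤ G.degree i) {α : ℝ} (hα1 : α < 1) (x : Fin n → ℝ) :
    x ⬝ᵥ (pageRankMatrix G α).mulVec x ≤ x ⬝ᵥ x := by
  rw [pageRank_quadForm hd]
  have h1 := (abs_le.1 (abs_sum_adjMatrix_le G fun i => (Real.sqrt (G.degree i))⁻¹ * x i)).1
  rw [sum_degree_mul_sq hd] at h1
  nlinarith

theorem isBoundedMMatrix_pageRankMatrix {G : SimpleGraph (Fin n)} [DecidableRel G.Adj]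
    (hd : ∀ i, (1 : ℝ) ≤ G.degree i) {α L : ℝ} (hα : 0 < α) (hα1 : α < 1)
    (hL : ∀ x : Fin n → ℝ, x ⬝ᵥ (pageRankMatrix G α).mulVec x ≤ L * (x ⬝ᵥ x)) :
    IsBoundedMMatrix (pageRankMatrix G α) α L where
  symm := by
    ext i j
    rw [Matrix.transpose_apply, pageRankMatrix_apply, pageRankMatrix_apply]
    rcases eq_or_ne i j with rfl | hij
    · rfl
    · simp only [hij, hij.symm, if_false, SimpleGraph.adjMatrix_apply, G.adj_comm j i]
      ring
  offDiag := fun i j hij => by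
    rw [pageRankMatrix_apply, if_neg hij]
    have h0 : (0 : ℝ) ≤ G.adjMatrix ℝ i j := by
      simp only [SimpleGraph.adjMatrix_apply]; split_ifs <;> norm_num
    refine mul_nonpos_of_nonpos_of_nonneg (mul_nonpos_of_nonneg_of_nonpos (by positivity) ?_)
      (by positivity)
    nlinarith
  pos := hα
  lower := fun x => by
    rw [pageRank_quadForm hd]
    have h1 := (abs_le.1 (abs_sum_adjMatrix_le G fun i => (Real.sqrt (G.degree i))⁻¹ * x i)).2
    rw [sum_degree_mul_sq hd] at h1
    nlinarith
  upper := hL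

theorem pageRankMatrix_ne_zero {α : ℝ} {i j : Fin n} (h : pageRankMatrix G α i j ≠ 0) :
    i = j ∨ G.Adj i j := by
  by_contra! hno
  apply h
  rw [pageRankMatrix_apply]
  simp [hno.1, hno.2]

theorem matVol_pageRankMatrix_le (α : ℝ) (S : Finset (Fin n)) :
    matVol (pageRankMatrix G α) S ≤ graphVol G S := by
  rw [matVol, Finset.card_filter, Finset.sum_product_right, graphVol, Finset.card_eq_sum_ones,
    ← Finset.sum_add_distrib]
  refine Finset.sum_le_sum fun j _ => ?_
  rw [← Finset.card_filter]
  calc _ ≤ (insert j (G.neighborFinset j)).card := by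
        refine Finset.card_le_card fun i hi => ?_
        rcases pageRankMatrix_ne_zero G (i := i) (j := j) (Finset.mem_filter.1 hi).2 with rfl | hadj
        · exact Finset.mem_insert_self _ _
        · exact Finset.mem_insert_of_mem ((G.mem_neighborFinset j i).2 hadj.symm)
    _ ≤ _ := by
        rw [← G.card_neighborFinset_eq_degree]
        exact Finset.card_insert_le _ _

theorem matIntVol_pageRankMatrix_le (α : ℝ) (S : Finset (Fin n)) :
    matIntVol (pageRankMatrix G α) S ≤ graphIntVol G S := by
  have h : ((S ×ˢ S).filter fun p : Fin n × Fin n => pageRankMatrix G α p.1 p.2 ≠ 0)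
      ⊆ S.diag ∪ (S ×ˢ S).filter fun p : Fin n × Fin n => G.Adj p.1 p.2 := by
    intro p hp
    obtain ⟨hpS, hp0⟩ := Finset.mem_filter.1 hp
    rcases pageRankMatrix_ne_zero G hp0 with heq | hadj
    · exact Finset.mem_union_left _ (Finset.mem_diag.2 ⟨(Finset.mem_product.1 hpS).1, heq⟩)
    · exact Finset.mem_union_right _ (Finset.mem_filter.2 ⟨hpS, hadj⟩)
  calc _ ≤ _ := Finset.card_le_card h
    _ ≤ _ := Finset.card_union_le _ _
    _ = _ := by rw [Finset.diag_card, graphIntVol]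

variable {G} {α ρ : ℝ} {s : Fin n → ℝ}

theorem pageRankObj_of_nonneg {x : EVec n} (hx : x ∈ nonnegOrthant n) :
    pageRankObj G α ρ s x = quadObj (pageRankMatrix G α) (pageRankRhs G α ρ s) x := by
  simp only [pageRankObj, quadObj, dotProduct, pageRankRhs, Finset.mul_sum]
  rw [sub_add, ← Finset.sum_sub_distrib]
  congr 1
  refine Finset.sum_congr rfl fun i _ => ?_
  rw [abs_of_nonneg (mul_nonneg (Real.sqrt_nonneg _) (hx i))]
  ring

/-- Dropping the negative part of `x` decreases the objective: the off-diagonal entries of the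
matrix are nonpositive, and `s ≥ 0`. -/
theorem pageRankObj_posPart_add_le {L : ℝ} (h : IsBoundedMMatrix (pageRankMatrix G α) α L)
    (hρ : 0 ≤ ρ) (hs : ∀ i, 0 ≤ s i) (x : EVec n) :
    pageRankObj G α ρ s (WithLp.toLp 2 fun i => max (x i) 0)
      + α / 2 * ∑ i, max (-x i) 0 ^ 2 ≤ pageRankObj G α ρ s x := by
  set p : Fin n → ℝ := fun i => max (x i) 0 with hp
  set q : Fin n → ℝ := fun i => max (-x i) 0 with hq
  have hα := h.pos
  have hp0 : ∀ i, 0 ≤ p i := fun i => le_max_right _ _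
  have hq0 : ∀ i, 0 ≤ q i := fun i => le_max_right _ _
  have hx : ∀ i, x i = p i - q i := fun i => by
    simp only [hp, hq]
    rcases le_total 0 (x i) with h0 | h0
    · rw [max_eq_left h0, max_eq_right (by linarith)]; ring
    · rw [max_eq_right h0, max_eq_left (by linarith)]; ring
  have hpq : ∀ i, p i * q i = 0 := fun i => by
    simp only [hp, hq]
    rcases le_total 0 (x i) with h0 | h0
    · rw [max_eq_right (by linarith : -x i ≤ 0), mul_zero]
    · rw [max_eq_right h0, zero_mul]
  have hx' : x.ofLp = p - q := funext hx
  have hcross : p ⬝ᵥ (pageRankMatrix G α).mulVec q ≤ 0 := by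
    refine Finset.sum_nonpos fun i _ => ?_
    rw [Matrix.mulVec, dotProduct, Finset.mul_sum]
    refine Finset.sum_nonpos fun j _ => ?_
    rcases eq_or_ne i j with rfl | hij
    · rw [mul_left_comm, hpq, mul_zero]
    · exact mul_nonpos_of_nonneg_of_nonpos (hp0 i)
        (mul_nonpos_of_nonpos_of_nonneg (h.offDiag i j hij) (hq0 j))
  have hquad : quadForm (pageRankMatrix G α) (WithLp.toLp 2 p) + α * ∑ i, q i ^ 2
      ≤ quadForm (pageRankMatrix G α) x := by
    have h1 := h.lower q
    have h2 := dotProduct_mulVec_symm h.symm q p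
    have h3 : q ⬝ᵥ q = ∑ i, q i ^ 2 := by simp [dotProduct, sq]
    rw [quadForm, quadForm, hx', Matrix.mulVec_sub, dotProduct_sub, sub_dotProduct,
      sub_dotProduct, h2]
    rw [h3] at h1
    linarith
  have hlin : ∑ i, s i * ((Real.sqrt (G.degree i))⁻¹ * x i)
      ≤ ∑ i, s i * ((Real.sqrt (G.degree i))⁻¹ * p i) := by
    refine Finset.sum_le_sum fun i _ => ?_
    have := hs i
    gcongr
    exact le_max_left _ _
  have habs : ∑ i, |Real.sqrt (G.degree i) * p i| ≤ ∑ i, |Real.sqrt (G.degree i) * x i| := by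
    refine Finset.sum_le_sum fun i _ => ?_
    rw [abs_mul, abs_mul, abs_of_nonneg (hp0 i)]
    refine mul_le_mul_of_nonneg_left ?_ (abs_nonneg _)
    exact max_le (le_abs_self _) (abs_nonneg _)
  have h1 := mul_le_mul_of_nonneg_left hlin hα.le
  have h2 := mul_le_mul_of_nonneg_left habs (mul_nonneg hα.le hρ)
  simp only [pageRankObj]
  linarith

/-- The regularized PageRank vector is the minimizer of a quadratic objective over the
nonnegative orthant. -/
theorem isKKTPoint_pageRank {L : ℝ} (h : IsBoundedMMatrix (pageRankMatrix G α) α L)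
    (hρ : 0 ≤ ρ) (hs : ∀ i, 0 ≤ s i) {xs : EVec n}
    (hmin : IsMinOn (pageRankObj G α ρ s) Set.univ xs) :
    IsKKTPoint (pageRankMatrix G α) (pageRankRhs G α ρ s) xs.ofLp := by
  have h0 : xs ∈ nonnegOrthant n := by
    intro i
    have h1 := pageRankObj_posPart_add_le h hρ hs xs
    have h2 : pageRankObj G α ρ s xs
        ≤ pageRankObj G α ρ s (WithLp.toLp 2 fun i => max (xs i) 0) := hmin (Set.mem_univ _)
    have h3 : ∑ i, max (-xs i) 0 ^ 2 ≤ 0 := by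
      have := h.pos
      by_contra! hlt
      have : 0 < α / 2 * ∑ i, max (-xs i) 0 ^ 2 := by positivity
      linarith
    have h4 := Finset.single_le_sum (f := fun i => max (-xs i) 0 ^ 2)
      (fun j _ => sq_nonneg _) (Finset.mem_univ i)
    have h5 : max (-xs i) 0 = 0 :=
      pow_eq_zero_iff two_ne_zero |>.1 (le_antisymm (h4.trans h3) (sq_nonneg _))
    linarith [max_eq_right_iff.1 h5]
  refine isKKTPoint_of_isMinOn h.symm h0 fun y hy => ?_
  have h1 : pageRankObj G α ρ s xs ≤ pageRankObj G α ρ s y := hmin (Set.mem_univ y)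
  rwa [pageRankObj_of_nonneg h0, pageRankObj_of_nonneg hy] at h1

theorem pageRank_norm_sq_le_one {L : ℝ} (h : IsBoundedMMatrix (pageRankMatrix G α) α L)
    (hd : ∀ i, (1 : ℝ) ≤ G.degree i) (hρ : 0 ≤ ρ) (hs : s ∈ stdSimplex ℝ (Fin n))
    {x : Fin n → ℝ} (hx : IsKKTPoint (pageRankMatrix G α) (pageRankRhs G α ρ s) x) :
    x ⬝ᵥ x ≤ 1 := by
  have hα := h.pos
  have hcompl : x ⬝ᵥ (pageRankMatrix G α).mulVec x = ∑ i, x i * pageRankRhs G α ρ s i := by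
    refine Finset.sum_congr rfl fun i _ => ?_
    rcases (hx.nonneg i).lt_or_eq with hpos | hzero
    · have h1 := hx.grad_eq_zero i hpos
      rw [quadGrad, Pi.sub_apply, sub_eq_zero] at h1
      rw [h1]
    · have h1 : x i = 0 := hzero.symm
      rw [h1, zero_mul, zero_mul]
  have hle : ∑ i, x i * pageRankRhs G α ρ s i ≤ ∑ i, α * ((x i * x i + s i) / 2) := by
    refine Finset.sum_le_sum fun i _ => ?_
    have h0 : 0 ≤ x i := hx.nonneg i
    have hs0 := hs.1 i
    have hs1 : s i ≤ 1 := hs.2 ▸ Finset.single_le_sum (fun j _ => hs.1 j) (Finset.mem_univ i)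
    have hinv : (Real.sqrt (G.degree i))⁻¹ ≤ 1 := inv_le_one_of_one_le₀ (Real.one_le_sqrt.2 (hd i))
    have hb : pageRankRhs G α ρ s i ≤ α * s i := by
      have h1 : 0 ≤ α * ρ * Real.sqrt (G.degree i) := by positivity
      have h2 : (Real.sqrt (G.degree i))⁻¹ * s i ≤ 1 * s i := by gcongr
      have h3 := mul_le_mul_of_nonneg_left h2 hα.le
      rw [pageRankRhs]
      linarith
    calc x i * pageRankRhs G α ρ s i ≤ x i * (α * s i) := by gcongr
      _ = α * (x i * s i) := by ring
      _ ≤ α * ((x i * x i + s i) / 2) := by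
        gcongr
        nlinarith [sq_nonneg (x i - s i)]
  rw [← Finset.mul_sum, ← Finset.sum_div, Finset.sum_add_distrib, hs.2] at hle
  have h1 := h.lower x
  rw [hcompl] at h1
  have h2 : x ⬝ᵥ x ≤ (∑ i, x i * x i + 1) / 2 := le_of_mul_le_mul_left (h1.trans hle) hα
  change x ⬝ᵥ x ≤ (x ⬝ᵥ x + 1) / 2 at h2
  linarith

end PageRank

/-! ### The complexity bounds for both problem classes -/

theorem mem_vecSupp_of_pos {n : ℕ} {xs : EVec n} (i : Fin n) (hi : 0 < xs.ofLp i) :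
    i ∈ vecSupp xs := by
  simp [vecSupp, hi.ne']

theorem mainTheorem2 :
    ∃ C : ℝ, 0 < C ∧
      -- general symmetric positive-definite M-matrices
      (∀ (n : ℕ) (Q : Matrix (Fin n) (Fin n) ℝ) (b : Fin n → ℝ) (α L ε : ℝ) (xs : EVec n),
        Q.IsSymm → (∀ i j, i ≠ j → Q i j ≤ 0) → 0 < α → 0 < ε →
        (∀ x : EVec n, α * ‖x‖ ^ 2 ≤ quadForm Q x) →
        (∀ x : EVec n, quadForm Q x ≤ L * ‖x‖ ^ 2) →
        xs ∈ nonnegOrthant n → IsMinOn (quadObj Q b) (nonnegOrthant n) xs →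
        ∃ t m : ℕ, ASPRRunsIn Q b α L ε t m ∧
          (t : ℝ) ≤ C *
            ((vecSupp xs).card * matIntVol Q (vecSupp xs) * Real.sqrt (L / α)
              * Real.log (2 + L ^ 4 * (1 + (vecSupp xs).card) * (L - α) * ‖xs‖ ^ 2
                  / (α ^ 4 * ε))
              + (vecSupp xs).card * matVol Q (vecSupp xs) + 1) ∧
          (m : ℝ) ≤ C * ((vecSupp xs).card + 1)) ∧
      -- personalized PageRank with ℓ₁-regularization
      (∀ (n : ℕ) (G : SimpleGraph (Fin n)) [DecidableRel G.Adj] (α ρ ε : ℝ) (s : Fin n → ℝ)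
        (xs : EVec n),
        2 ≤ n → G.Connected → 0 < α → α < 1 → 0 < ρ → 0 < ε → s ∈ stdSimplex ℝ (Fin n) →
        IsMinOn (pageRankObj G α ρ s) Set.univ xs →
        (∀ x : EVec n, quadForm (pageRankMatrix G α) x ≤ 1 * ‖x‖ ^ 2) ∧
        ∀ L : ℝ, (∀ x : EVec n, quadForm (pageRankMatrix G α) x ≤ L * ‖x‖ ^ 2) →
          ∃ t m : ℕ, ASPRRunsIn (pageRankMatrix G α) (pageRankRhs G α ρ s) α L ε t m ∧
            (t : ℝ) ≤ C *
              ((vecSupp xs).card * graphIntVol G (vecSupp xs) * Real.sqrt (L / α)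
                * Real.log (2 + 2 * L ^ 4 * (1 + (vecSupp xs).card) * (L - α)
                    * (vecSupp xs).card * graphVol G (vecSupp xs) / (α ^ 6 * ε))
                + (vecSupp xs).card * graphVol G (vecSupp xs) + 1) ∧
            (m : ℝ) ≤ C * ((vecSupp xs).card + 1)) := by
  refine ⟨1000, by norm_num, ?_, ?_⟩
  · intro n Q b α L ε xs hsymm hoff hα hε hlow hup h0 hmin
    have h : IsBoundedMMatrix Q α L :=
      { symm := hsymm
        offDiag := hoff
        pos := hα
        lower := fun x => by
          have := hlow (WithLp.toLp 2 x)
          rwa [norm_sq_eq_dotProduct] at this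
        upper := fun x => by
          have := hup (WithLp.toLp 2 x)
          rwa [norm_sq_eq_dotProduct] at this }
    rw [norm_sq_eq_dotProduct]
    exact h.exists_asprRunsIn hε (isKKTPoint_of_isMinOn hsymm h0 hmin) mem_vecSupp_of_pos
  · intro n G _ α ρ ε s xs hn hG hα hα1 hρ hε hs hmin
    have hd := one_le_degree hn hG
    refine ⟨fun x => ?_, fun L hL => ?_⟩
    · rw [norm_sq_eq_dotProduct, one_mul]
      exact pageRank_quadForm_le hd hα1 x.ofLp
    have h : IsBoundedMMatrix (pageRankMatrix G α) α L :=
      isBoundedMMatrix_pageRankMatrix hd hα hα1 fun x => by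
        have := hL (WithLp.toLp 2 x)
        rwa [norm_sq_eq_dotProduct] at this
    have hxs := isKKTPoint_pageRank h hρ.le hs.1 hmin
    obtain ⟨t, m, hrun, ht, hm⟩ :=
      h.exists_asprRunsIn hε hxs (U := vecSupp xs) mem_vecSupp_of_pos
    refine ⟨t, m, hrun, ht.trans ?_, hm⟩
    have hnorm := pageRank_norm_sq_le_one h hd hρ.le hs hxs
    have hvol : (matVol (pageRankMatrix G α) (vecSupp xs) : ℝ) ≤ graphVol G (vecSupp xs) := by
      exact_mod_cast matVol_pageRankMatrix_le G α _
    have hint : (matIntVol (pageRankMatrix G α) (vecSupp xs) : ℝ)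
        ≤ graphIntVol G (vecSupp xs) := by
      exact_mod_cast matIntVol_pageRankMatrix_le G α _
    have hcv : ((vecSupp xs).card : ℝ) ≤ graphVol G (vecSupp xs) := by
      exact_mod_cast Nat.le_add_left _ _
    set u := (vecSupp xs).card with hu
    rcases Nat.eq_zero_or_pos u with h0 | hpos
    · simp [h0]
    have hu1 : (1 : ℝ) ≤ u := by exact_mod_cast hpos
    have hLα : 0 ≤ L - α := sub_nonneg.2 (h.le_of_index ⟨0, by omega⟩)
    have hL0 : 0 < L := by linarith
    have hx0 := dotProduct_self_nonneg xs.ofLp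
    -- `‖xs‖² ≤ 1` is far below the factor `2 |S| vol(S) / α²`
    have hX : L ^ 4 * (1 + u) * (L - α) * (xs.ofLp ⬝ᵥ xs.ofLp) / (α ^ 4 * ε)
        ≤ 2 * L ^ 4 * (1 + u) * (L - α) * u * graphVol G (vecSupp xs) / (α ^ 6 * ε) := by
      have h1 : xs.ofLp ⬝ᵥ xs.ofLp ≤ 2 * (u * graphVol G (vecSupp xs)) / α ^ 2 := by
        refine hnorm.trans ?_
        rw [le_div_iff₀ (by positivity)]
        nlinarith
      calc L ^ 4 * (1 + u) * (L - α) * (xs.ofLp ⬝ᵥ xs.ofLp) / (α ^ 4 * ε)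
          ≤ L ^ 4 * (1 + u) * (L - α) * (2 * (u * graphVol G (vecSupp xs)) / α ^ 2)
            / (α ^ 4 * ε) := by gcongr
        _ = _ := by field_simp
    have hlog := Real.log_le_log (x := 2 + L ^ 4 * (1 + u) * (L - α) * (xs.ofLp ⬝ᵥ xs.ofLp)
      / (α ^ 4 * ε)) (by positivity) (add_le_add_right hX 2)
    have hlog0 : 0 ≤ Real.log (2 + L ^ 4 * (1 + u) * (L - α) * (xs.ofLp ⬝ᵥ xs.ofLp)
      / (α ^ 4 * ε)) := Real.log_nonneg (by
        have : 0 ≤ L ^ 4 * (1 + u) * (L - α) * (xs.ofLp ⬝ᵥ xs.ofLp) / (α ^ 4 * ε) := by positivity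
        linarith)
    gcongr
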